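/- **Setting.** Let $\mu$ be a $\sigma$-finite measure on a measurable space $\mathcal X$, let $\Theta\subset\mathbb R^p$ be open, and let $\{f_\theta:\theta\in\Theta\}$ be an identifiable family of probability densities with respect to $\mu$ (jointly measurable in $(\theta,x)$) with common support $\{x: f_\theta(x)>0\}$ not depending on $\theta$. Let $g:\mathbb R^p\to\mathbb R^r$, $r<p$, be differentiable on $\Theta$ with a continuous $p\times r$ matrix $G(\theta)=\partial g^T(\theta)/\partial\theta$ of rank $r$, and let $\Theta_0=\{\theta\in\Theta: g(\theta)=0\}$. Let $\beta,\gamma\ge 0$, and let $X_1,X_2,\dots$ be i.i.d. with density $f_{\theta_0}$, where $\theta_0\in\Theta_0$ (the null hypothesis $H_0$). Put $u_\theta=\partial_\theta\log f_\theta$ and $$d_\gamma(h,f)=\int\Big\{f^{1+\gamma}-\big(1+\tfrac1\gamma\big)f^\gamma h+\tfrac1\gamma h^{1+\gamma}\Big\}d\mu\quad(\gamma>0),\qquad d_0(h,f)=\int h\log(h/f)\,d\mu,$$ $$V_\theta(x)=\int f_\theta^{1+\beta}d\mu-\big(1+\tfrac1\beta\big)f_\theta^\beta(x)\quad(\beta>0),\qquad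 V_\theta(x)=-\log f_\theta(x)\quad(\beta=0),$$ $$J_\beta(\theta)=\int u_\theta u_\theta^Tf_\theta^{1+\beta}d\mu,\qquad K_\beta(\theta)=\int u_\theta u_\theta^Tf_\theta^{1+2\beta}d\mu-\xi_\beta\xi_\beta^T,\qquad \xi_\beta(\theta)=\int u_\theta f_\theta^{1+\beta}d\mu,$$ $$A_\gamma(\theta)=(1+\gamma)\Big(\int f_\theta^{\gamma-1}\,\frac{\partial f_\theta}{\partial\theta_j}\,\frac{\partial f_\theta}{\partial\theta_i}\,d\mu\Big)_{i,j},\qquad B_\beta=J_\beta^{-1}G\,[G^TJ_\beta^{-1}G]^{-1}G^TJ_\beta^{-1}.$$ **Regularity conditions.** There is an open set $\omega\subset\Theta$ containing $\theta_0$ such that: 1. for $\mu$-almost every $x$, $\theta\mapsto f_\theta(x)$ is three times continuously differentiable on $\omega$; 2. $\int f_\theta^{1+\beta}d\mu$ and $\int f_\theta^\beta f_{\theta_0}d\mu$ can be differentiated three times with respect to $\theta\in\omega$, and the derivatives can be taken under the integral sign; 3. $J_\beta(\theta_0)$ is positive definite, and the integrals defining $K_\beta(\theta_0)$ converge absolutely;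 4. for $P_{\theta_0}$-almost every $x$, the third partial derivatives of $V_\theta(x)$ are bounded in absolute value, for all $\theta\in\omega$, by a function $M(x)$ with $\int M f_{\theta_0}d\mu<\infty$; 5. $\int f_\theta^{1+\gamma}d\mu$ and, for each $\tau\in\omega$, $d_\gamma(f_\theta,f_\tau)$ can be differentiated twice with respect to $\theta\in\omega$ under the integral sign, and the second derivatives of $d_\gamma(f_\theta,f_\tau)$ in $\theta$ are continuous in $(\theta,\tau)\in\omega\times\omega$. **Estimators.** A minimum density power divergence estimator (MDPDE) is a sequence $\hat\theta_\beta=\hat\theta_{n,\beta}$ of measurable functions of $X_1,\dots,X_n$ that is consistent for $\theta_0$ and, with probability tending to one, is a root in $\Theta$ of $\frac1n\sum_{i=1}^nu_\theta(X_i)f_\theta^\beta(X_i)-\int u_\theta f_\theta^{1+\beta}d\mu=0$. A restricted one (RMDPDE) is a sequence $\tilde\theta_\beta=\tilde\theta_{n,\beta}$ of measurable functions of $X_1,\dots,X_n$ that is consistent for $\theta_0$ and, with probability tending to one, minimizes (at least locally) $\frac1n\sum_{i=1}^nV_\theta(X_i)$ subject to $\theta\in\Theta_0$. **Theorem.** Under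 these conditions an MDPDE and an RMDPDE exist. The matrix $A_\gamma(\theta_0)B_\beta(\theta_0)K_\beta(\theta_0)B_\beta(\theta_0)$ has, counted with algebraic multiplicity, exactly $$k=\operatorname{rank}\big(B_\beta K_\beta B_\beta A_\gamma B_\beta K_\beta B_\beta\big)(\theta_0)$$ nonzero eigenvalues $\lambda_1,\dots,\lambda_k$, and they are all real. For every MDPDE $\hat\theta_\beta$ and every RMDPDE $\tilde\theta_\beta$, $$T_\gamma(\hat\theta_\beta,\tilde\theta_\beta)=2n\,d_\gamma\big(f_{\hat\theta_\beta},f_{\tilde\theta_\beta}\big)\ \xrightarrow{\ \mathcal L\ }\ \sum_{i=1}^k\lambda_iZ_i^2\qquad(n\to\infty),$$ where $Z_1,\dots,Z_k$ are independent standard normal variables. -/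

import Mathlib

open MeasureTheory ProbabilityTheory Filter Topology Matrix Polynomial

namespace DPD

noncomputable section

/-- The parameter space `ℝ^p` with its Euclidean norm. -/
abbrev Param (p : ℕ) : Type := EuclideanSpace ℝ (Fin p)

/-- The `i`-th partial derivative at `θ` of a real function of the parameter. -/
def partialDeriv {p : ℕ} (F : Param p → ℝ) (θ : Param p) (i : Fin p) : ℝ :=
  fderiv ℝ F θ (EuclideanSpace.single i 1)

section Model

variable {𝒳 : Type*} [MeasurableSpace 𝒳]

/-- `f` is an identifiable parametric family of probability densities with respect to `μ`,
indexed by the open set `Θ ⊆ ℝ^p`, whose support does not depend on the parameter. Only the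
values `f θ x` with `θ ∈ Θ` matter; the family is taken jointly measurable in `(θ, x)`, so that
functions of estimators such as `d_γ(f_θ, f_τ)` are random variables. -/
structure IsParametricModel {p : ℕ} (μ : Measure 𝒳) (Θ : Set (Param p))
    (f : Param p → 𝒳 → ℝ) : Prop where
  isOpen : IsOpen Θ
  measurable : Measurable (Function.uncurry f)
  nonneg : ∀ θ ∈ Θ, ∀ x, 0 ≤ f θ x
  integral_eq_one : ∀ θ ∈ Θ, ∫ x, f θ x ∂μ = 1
  common_support : ∀ θ ∈ Θ, ∀ τ ∈ Θ, {x | 0 < f θ x} = {x | 0 < f τ x}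
  identifiable : ∀ θ ∈ Θ, ∀ τ ∈ Θ, f θ =ᵐ[μ] f τ → θ = τ

/-- The distribution `P_θ` with density `f θ` with respect to `μ`. -/
def modelLaw {p : ℕ} (μ : Measure 𝒳) (f : Param p → 𝒳 → ℝ) (θ : Param p) : Measure 𝒳 :=
  μ.withDensity (fun x => ENNReal.ofReal (f θ x))

/-- The integrand of the density power divergence `d_β(h, f)`, at a point where the densities
take the values `h` and `f`. -/
def dpdIntegrand (β h f : ℝ) : ℝ :=
  if β = 0 then h * Real.log (h / f)
  else f ^ (1 + β) - (1 + 1 / β) * f ^ β * h + 1 / β * h ^ (1 + β)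

/-- The density power divergence `d_β(h, f)` with tuning parameter `β ≥ 0`. -/
def dpd (μ : Measure 𝒳) (β : ℝ) (h f : 𝒳 → ℝ) : ℝ :=
  ∫ x, dpdIntegrand β (h x) (f x) ∂μ

/-- The function `V_θ(x)` whose sample mean is the objective function of the minimum density
power divergence estimators. -/
def objective {p : ℕ} (μ : Measure 𝒳) (f : Param p → 𝒳 → ℝ) (β : ℝ) (θ : Param p) (x : 𝒳) : ℝ :=
  if β = 0 then -Real.log (f θ x)
  else ∫ y, f θ y ^ (1 + β) ∂μ - (1 + 1 / β) * f θ x ^ β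

/-- The empirical objective function `n⁻¹ ∑ V_θ(x_i)` of the data `x_1, …, x_n`. -/
def empObjective {p : ℕ} (μ : Measure 𝒳) (f : Param p → 𝒳 → ℝ) (β : ℝ) {n : ℕ}
    (x : Fin n → 𝒳) (θ : Param p) : ℝ :=
  (n : ℝ)⁻¹ * ∑ i, objective μ f β θ (x i)

/-- The likelihood score `u_θ(x)`, by coordinates. -/
def score {p : ℕ} (f : Param p → 𝒳 → ℝ) (θ : Param p) (x : 𝒳) (i : Fin p) : ℝ :=
  partialDeriv (fun τ => Real.log (f τ x)) θ i

/-- The vector `ξ_β(θ)` when the true density is `f θ`. -/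
def xiVec {p : ℕ} (μ : Measure 𝒳) (f : Param p → 𝒳 → ℝ) (β : ℝ) (θ : Param p) : Fin p → ℝ :=
  fun i => ∫ x, score f θ x i * f θ x ^ (1 + β) ∂μ

/-- The matrix `J_β(θ)` when the true density is `f θ`. -/
def jMat {p : ℕ} (μ : Measure 𝒳) (f : Param p → 𝒳 → ℝ) (β : ℝ) (θ : Param p) :
    Matrix (Fin p) (Fin p) ℝ :=
  Matrix.of fun i j => ∫ x, score f θ x i * score f θ x j * f θ x ^ (1 + β) ∂μ

/-- The matrix `K_β(θ)` when the true density is `f θ`. -/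
def kMat {p : ℕ} (μ : Measure 𝒳) (f : Param p → 𝒳 → ℝ) (β : ℝ) (θ : Param p) :
    Matrix (Fin p) (Fin p) ℝ :=
  Matrix.of fun i j => ∫ x, score f θ x i * score f θ x j * f θ x ^ (1 + 2 * β) ∂μ
    - xiVec μ f β θ i * xiVec μ f β θ j

/-- The matrix `A_γ(θ)`. -/
def aMat {p : ℕ} (μ : Measure 𝒳) (f : Param p → 𝒳 → ℝ) (γ : ℝ) (θ : Param p) :
    Matrix (Fin p) (Fin p) ℝ :=
  Matrix.of fun i j => (1 + γ) * ∫ x, f θ x ^ (γ - 1)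
    * partialDeriv (fun τ => f τ x) θ j * partialDeriv (fun τ => f τ x) θ i ∂μ

/-- The `p × r` matrix `G(θ) = ∂gᵀ(θ)/∂θ` of the constraint function `g`. -/
def gMat {p r : ℕ} (g : Param p → Param r) (θ : Param p) : Matrix (Fin p) (Fin r) ℝ :=
  Matrix.of fun i j => partialDeriv (fun τ => g τ j) θ i

/-- `g` is differentiable on `Θ` with a continuous derivative matrix `G` of rank `r`. -/
structure IsConstraint {p r : ℕ} (Θ : Set (Param p)) (g : Param p → Param r) : Prop where
  differentiable : ∀ θ ∈ Θ, DifferentiableAt ℝ g θ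
  continuous : ContinuousOn (gMat g) Θ
  rank : ∀ θ ∈ Θ, (gMat g θ).rank = r

/-- The null set `Θ₀ = {θ ∈ Θ : g θ = 0}`. -/
def nullSet {p r : ℕ} (Θ : Set (Param p)) (g : Param p → Param r) : Set (Param p) :=
  {θ | θ ∈ Θ ∧ g θ = 0}

/-- `B_β(θ) = J⁻¹ G [Gᵀ J⁻¹ G]⁻¹ Gᵀ J⁻¹`. -/
def bMat {p r : ℕ} (μ : Measure 𝒳) (f : Param p → 𝒳 → ℝ) (g : Param p → Param r) (β : ℝ)
    (θ : Param p) : Matrix (Fin p) (Fin p) ℝ :=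
  (jMat μ f β θ)⁻¹ * gMat g θ * ((gMat g θ)ᵀ * (jMat μ f β θ)⁻¹ * gMat g θ)⁻¹
    * (gMat g θ)ᵀ * (jMat μ f β θ)⁻¹

/-- `A_γ(θ) B_β(θ) K_β(θ) B_β(θ)`. -/
def limitMat {p r : ℕ} (μ : Measure 𝒳) (f : Param p → 𝒳 → ℝ) (g : Param p → Param r) (β γ : ℝ)
    (θ : Param p) : Matrix (Fin p) (Fin p) ℝ :=
  aMat μ f γ θ * bMat μ f g β θ * kMat μ f β θ * bMat μ f g β θ

/-- `k = rank (B K B A B K B)`. -/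
def limitRank {p r : ℕ} (μ : Measure 𝒳) (f : Param p → 𝒳 → ℝ) (g : Param p → Param r) (β γ : ℝ)
    (θ : Param p) : ℕ :=
  (bMat μ f g β θ * kMat μ f β θ * bMat μ f g β θ * aMat μ f γ θ
    * bMat μ f g β θ * kMat μ f β θ * bMat μ f g β θ).rank

/-- The integral `∫ F θ x dμ(x)` can be differentiated `m` times with respect to `θ ∈ U`, and all
its directional (in particular partial) derivatives up to order `m` are obtained by
differentiating under the integral sign. The case `j = 0` says that `F θ` is integrable. -/
def DiffUnderIntegral {p : ℕ} (μ : Measure 𝒳) (m : ℕ) (U : Set (Param p))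
    (F : Param p → 𝒳 → ℝ) : Prop :=
  (∀ j < m, ∀ θ ∈ U, DifferentiableAt ℝ (iteratedFDeriv ℝ j (fun τ => ∫ x, F τ x ∂μ)) θ) ∧
  ∀ j ≤ m, ∀ θ ∈ U, ∀ v : Fin j → Param p,
    Integrable (fun x => iteratedFDeriv ℝ j (fun τ => F τ x) θ v) μ ∧
    iteratedFDeriv ℝ j (fun τ => ∫ x, F τ x ∂μ) θ v
      = ∫ x, iteratedFDeriv ℝ j (fun τ => F τ x) θ v ∂μ

/-- The Lehmann and Basu et al. conditions with tuning parameter `β`, for the true density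
`f θ₀`, on the open neighbourhood `U ⊆ Θ` of `θ₀` (the common support is part of
`IsParametricModel`). At `θ₀` the general `J_β(θ)` is `jMat`, the true density being `f θ₀`. -/
structure LehmannBasu {p : ℕ} (μ : Measure 𝒳) (Θ : Set (Param p)) (f : Param p → 𝒳 → ℝ)
    (β : ℝ) (θ₀ : Param p) (U : Set (Param p)) : Prop where
  isOpen : IsOpen U
  subset : U ⊆ Θ
  mem : θ₀ ∈ U
  smooth : ∀ᵐ x ∂μ, ContDiffOn ℝ 3 (fun θ => f θ x) U
  diff_power : DiffUnderIntegral μ 3 U (fun θ x => f θ x ^ (1 + β))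
  diff_cross : DiffUnderIntegral μ 3 U (fun θ x => f θ x ^ β * f θ₀ x)
  posDef : (jMat μ f β θ₀).PosDef
  /-- the third partial derivatives of `V_θ(x)` are dominated by a function with a finite mean
  under the true density -/
  dominated : ∃ M : 𝒳 → ℝ, Integrable (fun x => M x * f θ₀ x) μ ∧
    ∀ᵐ x ∂μ, 0 < f θ₀ x → ∀ θ ∈ U,
      ‖iteratedFDeriv ℝ 3 (fun τ => objective μ f β τ x) θ‖ ≤ M x
  /-- the integrals that define `K_β(θ₀)` exist -/
  finite_kMat : ∀ i : Fin p, Integrable (fun x => score f θ₀ x i ^ 2 * f θ₀ x ^ (1 + 2 * β)) μ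

/-- Regularity of the divergence `d_γ` on the model near the true parameter: the integrals
`∫ f_θ^{1+γ} dμ` and `d_γ(f_θ, f_τ)` can be differentiated twice with respect to `θ` under the
integral sign, and the second derivatives of the latter are continuous in `(θ, τ)`. -/
structure DivergenceRegular {p : ℕ} (μ : Measure 𝒳) (f : Param p → 𝒳 → ℝ) (γ : ℝ)
    (U : Set (Param p)) : Prop where
  diff_power : DiffUnderIntegral μ 2 U (fun θ x => f θ x ^ (1 + γ))
  diff_dpd : ∀ τ ∈ U, DiffUnderIntegral μ 2 U (fun θ x => dpdIntegrand γ (f θ x) (f τ x))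
  continuous : ∀ v : Fin 2 → Param p, ContinuousOn
    (fun q : Param p × Param p => iteratedFDeriv ℝ 2 (fun θ => dpd μ γ (f θ) (f q.2)) q.1 v)
    (U ×ˢ U)

/-- `θ` is a root in `Θ` of the minimum density power divergence estimating equation for the data
`x_1, …, x_n`. -/
def IsEstimatingRoot {p : ℕ} (μ : Measure 𝒳) (Θ : Set (Param p)) (f : Param p → 𝒳 → ℝ) (β : ℝ)
    {n : ℕ} (x : Fin n → 𝒳) (θ : Param p) : Prop :=
  θ ∈ Θ ∧ ∀ j : Fin p, (n : ℝ)⁻¹ * ∑ i, score f θ (x i) j * f θ (x i) ^ β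
    - ∫ y, score f θ y j * f θ y ^ (1 + β) ∂μ = 0

/-- `θ` minimizes the empirical objective function (at least locally) subject to `g θ = 0`. -/
def IsRestrictedMin {p r : ℕ} (μ : Measure 𝒳) (Θ : Set (Param p)) (f : Param p → 𝒳 → ℝ)
    (g : Param p → Param r) (β : ℝ) {n : ℕ} (x : Fin n → 𝒳) (θ : Param p) : Prop :=
  θ ∈ nullSet Θ g ∧ IsLocalMinOn (empObjective μ f β x) (nullSet Θ g) θ

variable {Ω : Type*} [MeasurableSpace Ω]

/-- The first `n` observations. -/
def sample (X : ℕ → Ω → 𝒳) (n : ℕ) (ω : Ω) : Fin n → 𝒳 := fun i => X i ω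

/-- `X 0, X 1, …` is a random sample (iid observations) from the distribution `ν`. -/
structure IsRandomSample (P : Measure Ω) (X : ℕ → Ω → 𝒳) (ν : Measure 𝒳) : Prop where
  measurable : ∀ i, Measurable (X i)
  indep : iIndepFun X P
  law : ∀ i, P.map (X i) = ν

/-- `T n`, a measurable function of the first `n` observations for each `n`, is a consistent
sequence of estimators of `θ₀` and, with probability tending to one, its value has the property
`C` that defines the estimator. -/
structure IsConsistentSeq {p : ℕ} (P : Measure Ω) (X : ℕ → Ω → 𝒳) (θ₀ : Param p)
    (C : ∀ n : ℕ, (Fin n → 𝒳) → Param p → Prop)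
    (T : ∀ n : ℕ, (Fin n → 𝒳) → Param p) : Prop where
  measurable : ∀ n, Measurable (T n)
  consistent : TendstoInMeasure P (fun n ω => T n (sample X n ω)) atTop (fun _ => θ₀)
  property : Tendsto (fun n => P {ω | ¬ C n (sample X n ω) (T n (sample X n ω))}) atTop (𝓝 0)

/-- `T` is a minimum density power divergence estimator: a consistent sequence of roots of the
estimating equation. -/
def IsMDPDE {p : ℕ} (μ : Measure 𝒳) (Θ : Set (Param p)) (f : Param p → 𝒳 → ℝ) (β : ℝ)
    (θ₀ : Param p) (P : Measure Ω) (X : ℕ → Ω → 𝒳)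
    (T : ∀ n : ℕ, (Fin n → 𝒳) → Param p) : Prop :=
  IsConsistentSeq P X θ₀ (fun _ x θ => IsEstimatingRoot μ Θ f β x θ) T

/-- `T` is a restricted minimum density power divergence estimator: a consistent sequence of
minimizers of the empirical objective function subject to `g θ = 0`. -/
def IsRMDPDE {p r : ℕ} (μ : Measure 𝒳) (Θ : Set (Param p)) (f : Param p → 𝒳 → ℝ)
    (g : Param p → Param r) (β : ℝ) (θ₀ : Param p) (P : Measure Ω) (X : ℕ → Ω → 𝒳)
    (T : ∀ n : ℕ, (Fin n → 𝒳) → Param p) : Prop :=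
  IsConsistentSeq P X θ₀ (fun _ x θ => IsRestrictedMin μ Θ f g β x θ) T

/-- The test statistic `2 n d_γ(f_θ̂, f_θ̃)` computed from the first `n` observations. -/
def testStat {p : ℕ} (μ : Measure 𝒳) (f : Param p → 𝒳 → ℝ) (γ : ℝ) (X : ℕ → Ω → 𝒳)
    (T S : ∀ n : ℕ, (Fin n → 𝒳) → Param p) (n : ℕ) (ω : Ω) : ℝ :=
  2 * n * dpd μ γ (f (T n (sample X n ω))) (f (S n (sample X n ω)))

end Model

end

end DPD

open DPD

/-! Let H_n be the empirical objective and z_n its gradient at θ₀, the sample mean of the gradients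
of V_θ(X_i). These gradients are i.i.d., centred, with covariance (1+β)²K, and the Hessian of V at
θ₀ has mean (1+β)J. The law of large numbers for the Hessians and the domination of the third
derivatives give, on a ball around θ₀ and with probability tending to one, ∇H_n(θ) = z_n +
(1+β)J(θ-θ₀) up to ε‖θ-θ₀‖ (`IsRandomSample.exists_ball_norm_fderiv_empObjective_sub_le`).

Existence: this expansion integrates to a quadratic lower bound for H_n, so a minimizer of H_n over
a small compact piece of Θ or Θ₀ lies within O(‖z_n‖) of θ₀ and is eventually interior to the ball.
A measurable selection makes it a statistic.

Limit law: at the MDPDE the gradient vanishes, so (1+β)(θ̂-θ₀) ≈ -J⁻¹z_n. At the RMDPDE the gradient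
is G(θ̃)l for a Lagrange multiplier l, while Gᵀ(θ̃-θ₀) ≈ 0. As 1-JB annihilates G and BJ factors
through Gᵀ, this yields (1+β)(θ̃-θ₀) ≈ -(J⁻¹-B)z_n, hence (1+β)(θ̂-θ̃) ≈ -Bz_n
(`IsMDPDE.isLittleO_sub`). The divergence is zero and stationary on the diagonal, with Hessian A at
θ₀, so the statistic is close to (1+β)⁻² n (Bz_n)ᵀA(Bz_n) (`IsMDPDE.tendsto_testStat_sub`). By the
central limit theorem √n z_n tends to (1+β)RZ for any R with RRᵀ = K, and the limit is ZᵀRᵀBABRZ.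
`exists_factor_diagonalizing` picks R so that this form is diagonal, with the eigenvalues of ABKB as
coefficients.

Stochastic orders are treated as ordinary Landau symbols along the filter `probFilter`; Markov's
inequality then turns an error o(n‖z_n‖²) into convergence to zero in probability. -/

namespace DPD

/-! ### Measurable selection of minimizers. -/

section MeasurableSelection

variable {α E : Type*} [MeasurableSpace α] [MetricSpace E]

/-- A minimizer lies in `C` exactly when the infimum over `C` does not exceed the global one.
Compactness makes it attained, and continuity lets both infima be taken over countable dense
sequences. -/
theorem measurableSet_exists_argmin_mem [CompactSpace E] {F : E → α → ℝ}
    (hm : ∀ θ, Measurable (F θ)) (hc : ∀ a, Continuous fun θ => F θ a) {C : Set E}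
    (hC : IsClosed C) : MeasurableSet {a | ∃ θ ∈ C, ∀ τ, F θ a ≤ F τ a} := by
  rcases C.eq_empty_or_nonempty with rfl | hne
  · simp
  have : Nonempty C := hne.to_subtype
  have : Nonempty E := ⟨hne.some⟩
  have hset : {a | ∃ θ ∈ C, ∀ τ, F θ a ≤ F τ a} =
      ⋂ (i : ℕ) (k : ℕ), ⋃ j : ℕ, {a | F (TopologicalSpace.denseSeq C j) a
        < F (TopologicalSpace.denseSeq E i) a + 1 / ((k : ℝ) + 1)} := by
    ext a
    simp only [Set.mem_ofPred_eq, Set.mem_iInter, Set.mem_iUnion]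
    constructor
    · rintro ⟨θ, hθC, hθ⟩ i k
      have hopen : IsOpen {t : C | F t a < F (TopologicalSpace.denseSeq E i) a + 1 / ((k : ℝ) + 1)} :=
        isOpen_lt ((hc a).comp continuous_subtype_val) continuous_const
      obtain ⟨j, hj⟩ := (TopologicalSpace.denseRange_denseSeq C).exists_mem_open hopen
        ⟨⟨θ, hθC⟩, (hθ _).trans_lt (lt_add_of_pos_right _ (by positivity))⟩
      exact ⟨j, hj⟩
    · intro h
      obtain ⟨θ, hθC, hθ⟩ := hC.isCompact.exists_isMinOn hne (hc a).continuousOn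
      refine ⟨θ, hθC, fun τ => ?_⟩
      have hdense : ∀ i, F θ a ≤ F (TopologicalSpace.denseSeq E i) a := by
        intro i
        refine le_of_forall_pos_lt_add fun ε hε => ?_
        obtain ⟨k, hk⟩ := exists_nat_one_div_lt hε
        obtain ⟨j, hj⟩ := h i k
        have := hθ (TopologicalSpace.denseSeq C j).2
        simp only [Set.mem_ofPred_eq] at this
        linarith
      have hcl : IsClosed {t : E | F θ a ≤ F t a} := isClosed_le continuous_const (hc a)
      have := hcl.closure_subset_iff.2 (Set.range_subset_iff.2 hdense)
      exact this ((TopologicalSpace.denseRange_denseSeq E) τ)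
  rw [hset]
  exact .iInter fun i => .iInter fun k => .iUnion fun j =>
    measurableSet_lt (hm _) ((hm _).add_const _)

/-- One refinement step: take the first point of a dense sequence within `3 * r` of `f a` whose
closed `r`-ball contains a minimizer. Both conditions are measurable in `a`, hence so is the least
index; `3 * r` is the old radius `2 * r` plus the new one. -/
theorem exists_measurable_approx_argmin_succ [CompactSpace E] [Nonempty E] [MeasurableSpace E]
    [BorelSpace E] {F : E → α → ℝ} (hm : ∀ θ, Measurable (F θ))
    (hc : ∀ a, Continuous fun θ => F θ a) {r : ℝ} (hr : 0 < r) {f : α → E} (hf : Measurable f)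
    (h : ∀ a, ∃ θ, dist θ (f a) ≤ 2 * r ∧ ∀ τ, F θ a ≤ F τ a) :
    ∃ f' : α → E, Measurable f' ∧ (∀ a, dist (f a) (f' a) ≤ 3 * r) ∧
      ∀ a, ∃ θ, dist θ (f' a) ≤ r ∧ ∀ τ, F θ a ≤ F τ a := by
  classical
  let d := TopologicalSpace.denseSeq E
  let p : ℕ → α → Prop := fun j a => dist (f a) (d j) ≤ 3 * r ∧
    ∃ θ ∈ Metric.closedBall (d j) r, ∀ τ, F θ a ≤ F τ a
  have hp : ∀ a, ∃ j, p j a := by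
    intro a
    obtain ⟨θ, hθ, hmin⟩ := h a
    obtain ⟨j, hj⟩ := (TopologicalSpace.denseRange_denseSeq E).exists_dist_lt θ hr
    refine ⟨j, ?_, θ, hj.le, hmin⟩
    have := dist_triangle_left (f a) (d j) θ
    have : dist θ (d j) < r := hj
    linarith
  have hpm : ∀ j, MeasurableSet {a | p j a} := fun j =>
    (measurableSet_le (hf.dist measurable_const) measurable_const).inter
      (measurableSet_exists_argmin_mem hm hc Metric.isClosed_closedBall)
  refine ⟨fun a => d (Nat.find (hp a)), Measurable.find (fun j => measurable_const) hpm hp,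
    fun a => (Nat.find_spec (hp a)).1, fun a => ?_⟩
  obtain ⟨θ, hθ, hmin⟩ := (Nat.find_spec (hp a)).2
  exact ⟨θ, hθ, hmin⟩

/-- Measurable selection of a minimizer of a Carathéodory function on a compact space. -/
theorem exists_measurable_argmin_of_compactSpace [CompactSpace E] [Nonempty E] [MeasurableSpace E]
    [BorelSpace E] {F : E → α → ℝ} (hm : ∀ θ, Measurable (F θ))
    (hc : ∀ a, Continuous fun θ => F θ a) :
    ∃ T : α → E, Measurable T ∧ ∀ a τ, F (T a) a ≤ F τ a := by
  obtain ⟨R, hR⟩ := (Metric.isBounded_iff.1 (isCompact_univ (X := E)).isBounded)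
  let x₀ : E := Classical.arbitrary E
  let R' := |R| + 1
  have hR' : 0 < R' := by positivity
  have hmin : ∀ a, ∃ θ, ∀ τ, F θ a ≤ F τ a := fun a => by
    obtain ⟨θ, -, hθ⟩ := isCompact_univ.exists_isMinOn Set.univ_nonempty (hc a).continuousOn
    exact ⟨θ, fun τ => hθ (Set.mem_univ τ)⟩
  let S : ℕ → Type _ := fun n => {f : α → E // Measurable f ∧
    ∀ a, ∃ θ, dist θ (f a) ≤ R' / 2 ^ n ∧ ∀ τ, F θ a ≤ F τ a}
  have hstep : ∀ n (f : S n), ∃ f' : S (n + 1), ∀ a, dist (f.1 a) (f'.1 a) ≤ 3 * R' / 2 / 2 ^ n := by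
    rintro n ⟨f, hf, h⟩
    -- Radii halve at each stage, so the displacements form a geometric series and the
    -- approximations are Cauchy.
    have e : R' / 2 ^ n = 2 * (R' / 2 ^ (n + 1)) := by field_simp; ring
    obtain ⟨f', hf', hd, h'⟩ := exists_measurable_approx_argmin_succ hm hc
      (r := R' / 2 ^ (n + 1)) (by positivity) hf (by simpa only [e] using h)
    refine ⟨⟨f', hf', h'⟩, fun a => (hd a).trans_eq ?_⟩
    field_simp; ring
  choose step hstep using hstep
  let s : ∀ n, S n := fun n => Nat.rec (motive := S) ⟨fun _ => x₀, measurable_const, fun a => by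
    obtain ⟨θ, hθ⟩ := hmin a
    refine ⟨θ, ?_, hθ⟩
    have := hR (Set.mem_univ θ) (Set.mem_univ x₀)
    have := le_abs_self R
    simp only [pow_zero, div_one, R']
    linarith⟩ (fun n f => step n f) n
  have hs : ∀ n a, dist ((s n).1 a) ((s (n + 1)).1 a) ≤ 3 * R' / 2 / 2 ^ n :=
    fun n a => hstep n (s n) a
  have hcauchy : ∀ a, CauchySeq fun n => (s n).1 a := fun a =>
    cauchySeq_of_le_geometric_two fun n => hs n a
  choose T hT using fun a => cauchySeq_tendsto_of_complete (hcauchy a)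
  refine ⟨T, measurable_of_tendsto_metrizable (fun n => (s n).2.1) (tendsto_pi_nhds.2 hT), ?_⟩
  intro a τ
  -- Exact minimizers within `R' / 2 ^ n` of the approximations share their limit, and continuity
  -- passes minimality on to it.
  choose θ hθ hθmin using fun n => (s n).2.2 a
  have hθT : Tendsto θ atTop (𝓝 (T a)) := by
    refine (tendsto_iff_of_dist ?_).2 (hT a)
    refine squeeze_zero (fun _ => dist_nonneg) hθ ?_
    simpa [div_eq_mul_inv] using
      (tendsto_pow_atTop_nhds_zero_of_lt_one (r := (2 : ℝ)⁻¹) (by norm_num) (by norm_num)).const_mul R'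
  exact le_of_tendsto' (((hc a).tendsto (T a)).comp hθT) fun n => hθmin n τ

theorem exists_measurable_argmin [MeasurableSpace E] [BorelSpace E] {K : Set E} (hK : IsCompact K)
    (hne : K.Nonempty) {F : E → α → ℝ} (hm : ∀ θ ∈ K, Measurable (F θ))
    (hc : ∀ a, ContinuousOn (fun θ => F θ a) K) :
    ∃ T : α → E, Measurable T ∧ ∀ a, T a ∈ K ∧ ∀ τ ∈ K, F (T a) a ≤ F τ a := by
  have : CompactSpace K := isCompact_iff_compactSpace.1 hK
  have : Nonempty K := hne.to_subtype
  obtain ⟨T, hT, h⟩ := exists_measurable_argmin_of_compactSpace (E := K) (α := α)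
    (F := fun θ a => F θ a) (fun θ => hm θ θ.2) (fun a => (hc a).domRestrict)
  exact ⟨fun a => T a, measurable_subtype_coe.comp hT,
    fun a => ⟨(T a).2, fun τ hτ => h a ⟨τ, hτ⟩⟩⟩

end MeasurableSelection

/-! ### Convergence in probability as convergence along a filter. -/

section ProbFilter

variable {Ω : Type*} [MeasurableSpace Ω] {P : Measure Ω}

/-- The filter on `ℕ × Ω` of the sequences of events whose probabilities tend to one: a property
holds eventually along it if it holds with probability tending to one, and convergence to a constant
along it is convergence in probability. -/
def probFilter (P : Measure Ω) : Filter (ℕ × Ω) where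
  sets := {S | Tendsto (fun n => P {ω | (n, ω) ∉ S}) atTop (𝓝 0)}
  univ_sets := by simp
  sets_of_superset {S T} hS hST := tendsto_of_tendsto_of_tendsto_of_le_of_le tendsto_const_nhds hS
    (fun _ => zero_le) fun n => measure_mono fun ω hω h => hω (hST h)
  inter_sets {S T} hS hT := by
    have h := Tendsto.add hS hT
    rw [add_zero] at h
    refine tendsto_of_tendsto_of_tendsto_of_le_of_le tendsto_const_nhds h (fun _ => zero_le)
      fun n => (measure_mono fun ω hω => ?_).trans (measure_union_le _ _)
    by_cases h' : (n, ω) ∈ S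
    · exact Or.inr fun h'' => hω ⟨h', h''⟩
    · exact Or.inl h'

theorem eventually_probFilter {p : ℕ × Ω → Prop} :
    (∀ᶠ q in probFilter P, p q) ↔ Tendsto (fun n => P {ω | ¬ p (n, ω)}) atTop (𝓝 0) := Iff.rfl

theorem tendstoInMeasure_const_iff {E : Type*} [PseudoMetricSpace E] {f : ℕ → Ω → E} {c : E} :
    TendstoInMeasure P f atTop (fun _ => c) ↔
      Tendsto (fun q : ℕ × Ω => f q.1 q.2) (probFilter P) (𝓝 c) := by
  simp only [tendstoInMeasure_iff_dist, Metric.tendsto_nhds, eventually_probFilter, not_lt,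
    gt_iff_lt]

theorem eventually_probFilter_of_ae {p : ℕ × Ω → Prop} (h : ∀ᵐ ω ∂P, ∀ n, p (n, ω)) :
    ∀ᶠ q in probFilter P, p q := by
  refine eventually_probFilter.2 (tendsto_const_nhds.congr fun n => ?_)
  have : ∀ᵐ ω ∂P, p (n, ω) := h.mono fun ω hω => hω n
  exact (ae_iff.1 this).symm

theorem tendsto_fst_probFilter : Tendsto Prod.fst (probFilter P) atTop := by
  intro s hs
  refine eventually_probFilter.2 (tendsto_const_nhds.congr' ?_)
  filter_upwards [hs] with n hn
  simp [show n ∈ s from hn]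

/-- Bounded first absolute moments make `N` bounded in probability by Markov's inequality, so a
remainder that is o(N) tends to zero in probability. -/
theorem tendsto_zero_of_isLittleO_probFilter {R : ℕ × Ω → ℝ} {N : ℕ → Ω → ℝ}
    (hN : ∀ n, AEMeasurable (N n) P) {C : ENNReal} (hC : C ≠ ⊤)
    (hNC : ∀ n, ∫⁻ ω, ENNReal.ofReal ‖N n ω‖ ∂P ≤ C)
    (hR : R =o[probFilter P] fun q => N q.1 q.2) : Tendsto R (probFilter P) (𝓝 0) := by
  rw [Metric.tendsto_nhds]
  intro δ hδ
  rw [eventually_probFilter, ENNReal.tendsto_nhds_zero]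
  intro η hη
  rcases eq_or_ne η ⊤ with rfl | hη'
  · exact Eventually.of_forall fun n => le_top
  have hη2 : 0 < (η / 2).toReal := ENNReal.toReal_pos (ENNReal.half_pos hη.ne').ne'
    (ENNReal.div_lt_top hη' two_ne_zero).ne
  -- Chosen so that Markov at level `δ / ε` gives C(η/2)/(C+1) ≤ η/2; the `+ 1` covers `C = 0`.
  set ε : ℝ := δ * (η / 2).toReal / (C.toReal + 1) with hε
  have hεpos : 0 < ε := by positivity
  have h1 := eventually_probFilter.1 (hR.def hεpos)
  rw [ENNReal.tendsto_nhds_zero] at h1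
  filter_upwards [h1 (η / 2) (ENNReal.half_pos hη.ne')] with n hn
  have hmarkov : P {ω | ENNReal.ofReal (δ / ε) ≤ ENNReal.ofReal ‖N n ω‖} ≤ η / 2 := by
    have hm := (mul_meas_ge_le_lintegral₀ (hN n).norm.ennreal_ofReal (ENNReal.ofReal (δ / ε))).trans
      (hNC n)
    have hpos : ENNReal.ofReal (δ / ε) ≠ 0 := by
      simpa using div_pos hδ hεpos
    rw [mul_comm, ← ENNReal.le_div_iff_mul_le (Or.inl hpos) (Or.inl ENNReal.ofReal_ne_top)] at hm
    refine hm.trans (ENNReal.div_le_of_le_mul ?_)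
    rw [← ENNReal.ofReal_toReal hC, ← ENNReal.ofReal_toReal (ENNReal.div_lt_top hη' two_ne_zero).ne,
      ← ENNReal.ofReal_mul hη2.le]
    refine ENNReal.ofReal_le_ofReal ?_
    have : (η / 2).toReal * (δ / ε) = C.toReal + 1 := by
      rw [hε]; field_simp
    rw [this]; linarith
  refine (measure_mono fun ω hω => ?_).trans ((measure_union_le _ _).trans
    ((add_le_add hn hmarkov).trans_eq (ENNReal.add_halves η)))
  simp only [dist_zero_right, not_lt, Set.mem_ofPred_eq] at hω
  by_cases hb : ‖R (n, ω)‖ ≤ ε * ‖N n ω‖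
  · refine Or.inr (ENNReal.ofReal_le_ofReal ?_)
    rw [div_le_iff₀ hεpos, mul_comm]
    exact hω.trans hb
  · exact Or.inl hb

end ProbFilter

/-! ### Transfer from the law to the sample, and the law of large numbers. -/

section Sample

variable {𝒳 Ω : Type*} [MeasurableSpace 𝒳] [MeasurableSpace Ω] {P : Measure Ω}
  {X : ℕ → Ω → 𝒳} {ν : Measure 𝒳}

theorem IsRandomSample.ae_forall (hX : IsRandomSample P X ν) {p : 𝒳 → Prop} (h : ∀ᵐ x ∂ν, p x) :
    ∀ᵐ ω ∂P, ∀ i, p (X i ω) := by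
  rw [ae_all_iff]
  intro i
  rw [← hX.law i] at h
  exact ae_of_ae_map (hX.measurable i).aemeasurable h

theorem IsRandomSample.identDistrib (hX : IsRandomSample P X ν) {β : Type*} [MeasurableSpace β]
    {h : 𝒳 → β} (hh : AEMeasurable h ν) (i : ℕ) :
    IdentDistrib (fun ω => h (X i ω)) (fun ω => h (X 0 ω)) P P := by
  have : IdentDistrib (X i) (X 0) P P := ⟨(hX.measurable i).aemeasurable,
    (hX.measurable 0).aemeasurable, by rw [hX.law, hX.law]⟩
  exact this.comp_of_aemeasurable (by rwa [hX.law])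

theorem IsRandomSample.iIndepFun_comp (hX : IsRandomSample P X ν) {β : Type*} [MeasurableSpace β]
    {h : 𝒳 → β} (hh : AEMeasurable h ν) : iIndepFun (fun i ω => h (X i ω)) P :=
  hX.indep.comp₀ (fun _ => h) (fun i => (hX.measurable i).aemeasurable)
    fun i => by rwa [hX.law]

theorem IsRandomSample.integral_comp (hX : IsRandomSample P X ν) {E : Type*}
    [NormedAddCommGroup E] [NormedSpace ℝ E] {h : 𝒳 → E} (hh : AEStronglyMeasurable h ν) (i : ℕ) :
    ∫ ω, h (X i ω) ∂P = ∫ x, h x ∂ν := by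
  rw [← hX.law i, integral_map (hX.measurable i).aemeasurable (by rwa [hX.law])]

/-- The law of large numbers for sample means, in probability. -/
theorem IsRandomSample.tendsto_mean [IsProbabilityMeasure P] (hX : IsRandomSample P X ν)
    {h : 𝒳 → ℝ} (hh : Integrable h ν) :
    Tendsto (fun q : ℕ × Ω => (q.1 : ℝ)⁻¹ * ∑ i, h (sample X q.1 q.2 i)) (probFilter P)
      (𝓝 (∫ x, h x ∂ν)) := by
  have hm := hh.1.aemeasurable
  have hint : ∀ i, Integrable (fun ω => h (X i ω)) P := fun i =>
    (Integrable.comp_measurable (by rwa [hX.law]) (hX.measurable i))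
  have hlln := strong_law_ae_real (fun i ω => h (X i ω)) (hint 0)
    (fun i j hij => (hX.iIndepFun_comp hm).indepFun hij) (hX.identDistrib hm)
  rw [hX.integral_comp hh.1 0] at hlln
  refine (tendstoInMeasure_const_iff
    (f := fun n ω => (n : ℝ)⁻¹ * ∑ i, h (sample X n ω i))).1 ?_
  refine tendstoInMeasure_of_tendsto_ae (fun n => ?_) ?_
  · exact (Finset.aestronglyMeasurable_fun_sum _ fun (i : Fin n) _ => (hint i).1).const_mul _
  · filter_upwards [hlln] with ω hω
    refine hω.congr fun n => ?_
    rw [div_eq_inv_mul, ← Fin.sum_univ_eq_sum_range (fun i => h (X i ω)) n]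
    rfl

end Sample

/-! ### Diagonalization of the limiting quadratic form. -/

section LinearAlgebra

variable {p : ℕ}

open scoped MatrixOrder Matrix.Norms.L2Operator in
theorem exists_transpose_mul_self_of_posSemidef {K : Matrix (Fin p) (Fin p) ℝ}
    (hK : K.PosSemidef) : ∃ L : Matrix (Fin p) (Fin p) ℝ, K = Lᵀ * L := by
  obtain ⟨L, hL⟩ := CStarAlgebra.nonneg_iff_eq_star_mul_self.1 hK.nonneg
  exact ⟨L, by rw [hL, Matrix.star_eq_conjTranspose, Matrix.conjTranspose_eq_transpose_of_trivial]⟩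

theorem rank_eq_of_ker_mulVecLin_eq {M N : Matrix (Fin p) (Fin p) ℝ}
    (h : M.mulVecLin.ker = N.mulVecLin.ker) : M.rank = N.rank := by
  have h1 := M.mulVecLin.finrank_range_add_finrank_ker
  have h2 := N.mulVecLin.finrank_range_add_finrank_ker
  rw [h] at h1
  unfold Matrix.rank
  omega

/-- Over the reals `S` and `Sᵀ * S` have the same kernel, hence so do their products with `Y`. -/
theorem rank_transpose_mul_mul (S Y : Matrix (Fin p) (Fin p) ℝ) :
    (Sᵀ * (S * Y)).rank = (S * Y).rank := by
  refine rank_eq_of_ker_mulVecLin_eq ?_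
  rw [← Matrix.mul_assoc, Matrix.mulVecLin_mul (Sᵀ * S), Matrix.mulVecLin_mul S,
    LinearMap.ker_comp, LinearMap.ker_comp, Matrix.ker_mulVecLin_transpose_mul_self]

/-- A covariance matrix `K` has a factorization `R Rᵀ` for which `Rᵀ B A B R` is diagonal; its
diagonal consists of the eigenvalues of `A B K B`. -/
theorem exists_factor_diagonalizing {K A B : Matrix (Fin p) (Fin p) ℝ} (hK : K.PosSemidef)
    (hA : Aᵀ = A) (hB : Bᵀ = B) :
    ∃ (R : Matrix (Fin p) (Fin p) ℝ) (l : Fin p → ℝ), R * Rᵀ = K ∧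
      Rᵀ * (B * A * B) * R = diagonal l ∧
      (A * B * K * B).charpoly = ∏ i, (Polynomial.X - C (l i)) ∧
      (B * K * B * A * B * K * B).rank = Fintype.card {i // l i ≠ 0} := by
  obtain ⟨L, rfl⟩ := exists_transpose_mul_self_of_posSemidef hK
  -- With K = LᵀL, every R = LᵀU with U orthogonal satisfies RRᵀ = K and RᵀBABR = UᵀMU. The spectral
  -- theorem for the symmetric M supplies U, without any invertibility of K.
  set M : Matrix (Fin p) (Fin p) ℝ := L * (B * A * B) * Lᵀ with hM
  have hMt : Mᵀ = M := by
    simp only [hM, Matrix.transpose_mul, Matrix.transpose_transpose, hA, hB, Matrix.mul_assoc]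
  have hMH : M.IsHermitian := by
    rw [Matrix.IsHermitian, Matrix.conjTranspose_eq_transpose_of_trivial, hMt]
  set U : Matrix (Fin p) (Fin p) ℝ := (hMH.eigenvectorUnitary : Matrix (Fin p) (Fin p) ℝ) with hU
  have hUU : U * Uᵀ = 1 := by
    have := Unitary.mul_star_self_of_mem hMH.eigenvectorUnitary.2
    rwa [Matrix.star_eq_conjTranspose, Matrix.conjTranspose_eq_transpose_of_trivial] at this
  have hdiag : Uᵀ * M * U = diagonal hMH.eigenvalues := by
    have := hMH.conjStarAlgAut_star_eigenvectorUnitary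
    rw [Unitary.conjStarAlgAut_apply] at this
    simpa [Matrix.star_eq_conjTranspose, Matrix.conjTranspose_eq_transpose_of_trivial,
      Function.comp_def] using this
  refine ⟨Lᵀ * U, hMH.eigenvalues, ?_, ?_, ?_, ?_⟩
  · rw [Matrix.transpose_mul, Matrix.transpose_transpose, Matrix.mul_assoc, ← Matrix.mul_assoc U,
      hUU, Matrix.one_mul]
  · rw [← hdiag, hM]
    simp only [Matrix.transpose_mul, Matrix.transpose_transpose, Matrix.mul_assoc]
  -- ABKB = (ABLᵀ)(LB) and M = (LB)(ABLᵀ): products of square matrices in either order have the same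
  -- characteristic polynomial.
  · have h1 : A * B * (Lᵀ * L) * B = (A * B * Lᵀ) * (L * B) := by simp only [Matrix.mul_assoc]
    have h2 : (L * B) * (A * B * Lᵀ) = M := by simp only [hM, Matrix.mul_assoc]
    rw [h1, Matrix.charpoly_mul_comm, h2, hMH.charpoly_eq]
    rfl
  · rw [← hMH.rank_eq_card_non_zero_eigs]
    -- Now M = SASᵀ and BKBABKB = SᵀSASᵀS. The outer factor `Sᵀ` on the left, and after
    -- transposition the outer `S` on the right, are dropped without changing the rank.
    set S := L * B with hS
    have hMS : M = S * (A * Sᵀ) := by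
      simp only [hM, hS, Matrix.transpose_mul, hB, Matrix.mul_assoc]
    have h1 : B * (Lᵀ * L) * B * A * B * (Lᵀ * L) * B = Sᵀ * (S * (A * (Sᵀ * S))) := by
      simp only [hS, Matrix.transpose_mul, hB, Matrix.mul_assoc]
    rw [h1, rank_transpose_mul_mul, ← Matrix.rank_transpose, ← Matrix.rank_transpose M, hMS]
    simp only [Matrix.transpose_mul, Matrix.transpose_transpose, hA]
    rw [show Sᵀ * S * A * Sᵀ = Sᵀ * (S * (A * Sᵀ)) by simp only [Matrix.mul_assoc],
      rank_transpose_mul_mul, Matrix.mul_assoc S]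

theorem prod_eq_X_pow_mul_prod_ne_zero {k : ℕ} (l : Fin p → ℝ) (e : Fin k ≃ {i // l i ≠ 0}) :
    ∏ i, (Polynomial.X - C (l i)) =
      Polynomial.X ^ (p - k) * ∏ i, (Polynomial.X - C (l (e i))) := by
  classical
  have hk : k = Fintype.card {i // l i ≠ 0} := by
    simpa using Fintype.card_congr e
  rw [← Fintype.prod_subtype_mul_prod_subtype (fun i => l i ≠ 0), mul_comm,
    Equiv.prod_comp e (fun i => (Polynomial.X - C (l i)))]
  congr 1
  rw [Finset.prod_congr rfl (g := fun _ => Polynomial.X)]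
  · rw [Finset.prod_const, Finset.card_univ]
    congr 1
    have := Fintype.card_subtype_compl (fun i => l i ≠ 0)
    rw [this, Fintype.card_fin, hk]
  · rintro ⟨i, hi⟩ -
    simp [not_not.1 hi]

/-- Terms with zero weight drop out, and the remaining coordinates are still independent standard
normal. -/
theorem map_sum_mul_sq_eq {k : ℕ} (l : Fin p → ℝ) (e : Fin k ≃ {i // l i ≠ 0}) :
    (Measure.pi fun _ : Fin p => gaussianReal 0 1).map (fun z => ∑ i, l i * z i ^ 2) =
      (Measure.pi fun _ : Fin k => gaussianReal 0 1).map (fun z => ∑ i, l (e i) * z i ^ 2) := by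
  have hind : iIndepFun (fun (i : Fin p) (z : Fin p → ℝ) => z i)
      (Measure.pi fun _ : Fin p => gaussianReal 0 1) :=
    iIndepFun_pi (X := fun _ x => x) fun _ => aemeasurable_id
  have hinj : Function.Injective fun i => (e i : Fin p) :=
    Subtype.val_injective.comp e.injective
  have h := (iIndepFun_iff_map_fun_eq_pi_map
    (fun i => (measurable_pi_apply (e i : Fin p)).aemeasurable)).1 (hind.precomp hinj)
  have hev : ∀ i : Fin p, (Measure.pi fun _ : Fin p => gaussianReal 0 1).map (fun z => z i) =
      gaussianReal 0 1 := fun i =>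
    (measurePreserving_eval (fun _ : Fin p => gaussianReal 0 1) i).map_eq
  simp only [hev] at h
  rw [← h, Measure.map_map (by fun_prop) (by fun_prop)]
  congr 1
  ext z
  simp only [Function.comp_apply]
  rw [← Fintype.sum_subtype_add_sum_subtype (fun i => l i ≠ 0),
    Equiv.sum_comp e (fun i => l i * z i ^ 2), add_eq_left]
  refine Finset.sum_eq_zero ?_
  rintro ⟨i, hi⟩ -
  simp [not_not.1 hi]

end LinearAlgebra

/-! ### The multivariate central limit theorem and moment bounds. -/

section CentralLimit

/-- Only the law of the limit matters; this moves the limit from ℝ^p to ℝ^k once the zero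
eigenvalues are discarded. -/
theorem tendstoInDistribution_congr_law {E Ω Ω' Ω'' : Type*} [TopologicalSpace E]
    [MeasurableSpace E] [OpensMeasurableSpace E] [MeasurableSpace Ω] [MeasurableSpace Ω']
    [MeasurableSpace Ω''] {P : Measure Ω} [IsProbabilityMeasure P] {P' : Measure Ω'}
    [IsProbabilityMeasure P'] {P'' : Measure Ω''} [IsProbabilityMeasure P''] {X : ℕ → Ω → E}
    {Y : Ω' → E} {Z : Ω'' → E} (h : TendstoInDistribution X atTop Y (fun _ => P) P')
    (hZ : AEMeasurable Z P'') (hYZ : P'.map Y = P''.map Z) :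
    TendstoInDistribution X atTop Z (fun _ => P) P'' where
  forall_aemeasurable := h.forall_aemeasurable
  aemeasurable_limit := hZ
  tendsto := by
    have := h.tendsto
    simp only [hYZ] at this
    exact this

variable {p m : ℕ}

/-- The Cramér–Wold device: it reduces the vector limit theorem to the scalar one. -/
theorem charFun_map_eq_charFun_map_inner {Ω : Type*} [MeasurableSpace Ω] {P : Measure Ω}
    {Y : Ω → Param p} (hY : AEMeasurable Y P) (t : Param p) :
    charFun (P.map Y) t = charFun (P.map fun ω => inner ℝ (Y ω) t) 1 := by
  have hY' : AEMeasurable (fun ω => inner ℝ (Y ω) t) P := by fun_prop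
  rw [charFun_apply, charFun_apply, integral_map hY, integral_map hY']
  · simp
  · exact Measurable.aestronglyMeasurable (by fun_prop)
  · exact Measurable.aestronglyMeasurable (by fun_prop)

/-- The characteristic function of the standard Gaussian at Rᵀt. A degenerate R Rᵀ is allowed, as K
may be singular. -/
theorem charFun_map_mulVec_pi_gaussianReal (R : Matrix (Fin p) (Fin m) ℝ) (t : Param p) :
    charFun ((Measure.pi fun _ : Fin m => gaussianReal 0 1).map
      fun z => (WithLp.toLp 2 (R *ᵥ z) : Param p)) t =
      Complex.exp (-((t.ofLp ⬝ᵥ (R * Rᵀ) *ᵥ t.ofLp : ℝ) : ℂ) / 2) := by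
  have hmeas : Measurable fun z : Fin m → ℝ => (WithLp.toLp 2 (R *ᵥ z) : Param p) :=
    Continuous.measurable (by fun_prop)
  have hstd : charFun (stdGaussian (EuclideanSpace ℝ (Fin m))) (WithLp.toLp 2 (Rᵀ *ᵥ t.ofLp)) =
      Complex.exp (-((t.ofLp ⬝ᵥ (R * Rᵀ) *ᵥ t.ofLp : ℝ) : ℂ) / 2) := by
    rw [charFun_stdGaussian, ← Complex.ofReal_pow, EuclideanSpace.real_norm_sq_eq]
    congr 4
    rw [← Matrix.mulVec_mulVec, Matrix.dotProduct_mulVec, ← Matrix.mulVec_transpose]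
    simp [dotProduct, pow_two]
  rw [← hstd, ← map_pi_eq_stdGaussian, charFun_apply, charFun_apply,
    integral_map hmeas.aemeasurable, integral_map (by fun_prop)]
  · congr 1
    ext z
    congr 3
    rw [EuclideanSpace.inner_eq_star_dotProduct, EuclideanSpace.inner_eq_star_dotProduct]
    simp only [star_trivial]
    rw [Matrix.dotProduct_mulVec, ← Matrix.mulVec_transpose]
  · exact Measurable.aestronglyMeasurable (by fun_prop)
  · exact Measurable.aestronglyMeasurable (by fun_prop)

variable {𝒳 Ω : Type*} [MeasurableSpace 𝒳] [MeasurableSpace Ω] {P : Measure Ω}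
  [IsProbabilityMeasure P] {X : ℕ → Ω → 𝒳} {ν : Measure 𝒳}

/-- The sample mean of the vectors `w (X i)`. -/
noncomputable def sampleMean (X : ℕ → Ω → 𝒳) (w : 𝒳 → Param p) (q : ℕ × Ω) : Param p :=
  (q.1 : ℝ)⁻¹ • ∑ i, w (sample X q.1 q.2 i)

omit [IsProbabilityMeasure P] in
theorem aemeasurable_sampleMean (hX : IsRandomSample P X ν) {w : 𝒳 → Param p}
    (hw : AEMeasurable w ν) (n : ℕ) : AEMeasurable (fun ω => sampleMean X w (n, ω)) P := by
  have : ∀ i, AEMeasurable (fun ω => w (X i ω)) P := fun i =>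
    (AEMeasurable.comp_measurable (by rwa [hX.law]) (hX.measurable i))
  have hsum : AEMeasurable (fun ω => ∑ i : Fin n, w (sample X n ω i)) P :=
    Finset.aemeasurable_fun_sum _ fun (i : Fin n) _ => this i
  exact (measurable_const_smul (n : ℝ)⁻¹).comp_aemeasurable hsum

omit [MeasurableSpace 𝒳] [MeasurableSpace Ω] in
theorem sqrt_mul_inner_sampleMean (w : 𝒳 → Param p) (n : ℕ) (ω : Ω) (t : Param p) :
    inner ℝ (√n • sampleMean X w (n, ω)) t =
      (√n)⁻¹ * ∑ k ∈ Finset.range n, inner ℝ (w (X k ω)) t := by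
  rw [sampleMean, smul_smul, inner_smul_left, sum_inner,
    ← Fin.sum_univ_eq_sum_range (fun k => inner ℝ (w (X k ω)) t) n]
  congr 1
  simp only [conj_trivial]
  rw [← div_eq_mul_inv, Real.sqrt_div_self', one_div]

/-- The multivariate central limit theorem for centred vectors with covariance matrix `R Rᵀ`. -/
theorem IsRandomSample.tendstoInDistribution_sqrt_smul_sampleMean (hX : IsRandomSample P X ν)
    {w : 𝒳 → Param p} (hw : AEMeasurable w ν) (hL2 : ∀ i, MemLp (fun x => w x i) 2 ν)
    (hmean : ∀ i, ∫ x, w x i ∂ν = 0) (R : Matrix (Fin p) (Fin m) ℝ)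
    (hcov : ∀ i j, ∫ x, w x i * w x j ∂ν = (R * Rᵀ) i j) :
    TendstoInDistribution (fun (n : ℕ) ω => √n • sampleMean X w (n, ω)) atTop
      (fun z : Fin m → ℝ => (WithLp.toLp 2 (R *ᵥ z) : Param p)) (fun _ => P)
      (Measure.pi fun _ => gaussianReal 0 1) where
  forall_aemeasurable n :=
    (measurable_const_smul √(n : ℝ)).comp_aemeasurable (aemeasurable_sampleMean hX hw n)
  aemeasurable_limit := Measurable.aemeasurable (Continuous.measurable (by fun_prop))
  tendsto := by
    refine ProbabilityMeasure.tendsto_iff_tendsto_charFun.2 fun t => ?_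
    have : IsProbabilityMeasure ν := by
      rw [← hX.law 0]
      exact Measure.isProbabilityMeasure_map (hX.measurable 0).aemeasurable
    have hinner : ∀ x, inner ℝ (w x) t = ∑ i, t i * w x i := fun x => by
      simp [PiLp.inner_apply]
    have hht : AEMeasurable (fun x => inner ℝ (w x) t) ν := by fun_prop
    have hmt : MemLp (fun x => inner ℝ (w x) t) 2 ν := by
      simp only [hinner]
      exact memLp_finsetSum _ fun i _ => (hL2 i).const_mul _
    have hint : ∫ x, inner ℝ (w x) t ∂ν = 0 := by
      simp only [hinner]
      rw [integral_finsetSum _ fun i _ => ((hL2 i).integrable one_le_two).const_mul _]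
      simp [integral_const_mul, hmean]
    have hvar : Var[fun x => inner ℝ (w x) t; ν] = t.ofLp ⬝ᵥ (R * Rᵀ) *ᵥ t.ofLp := by
      rw [variance_of_integral_eq_zero hht hint]
      have : ∀ x, (inner ℝ (w x) t) ^ 2 = ∑ i, ∑ j, (t i * t j) * (w x i * w x j) := fun x => by
        rw [hinner, pow_two, Finset.sum_mul_sum]
        exact Finset.sum_congr rfl fun i _ => Finset.sum_congr rfl fun j _ => by ring
      simp only [this]
      have hi : ∀ i j, Integrable (fun x => (t i * t j) * (w x i * w x j)) ν := fun i j =>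
        ((hL2 i).integrable_mul (hL2 j)).const_mul _
      rw [integral_finsetSum _ fun i _ => integrable_finsetSum _ fun j _ => hi i j]
      simp only [dotProduct, mulVec, Finset.mul_sum]
      refine Finset.sum_congr rfl fun i _ => ?_
      rw [integral_finsetSum _ fun j _ => hi i j]
      refine Finset.sum_congr rfl fun j _ => ?_
      rw [integral_const_mul, hcov]
      ring
    have hid := hX.identDistrib hht
    have hint0 : ∫ ω, inner ℝ (w (X 0 ω)) t ∂P = 0 :=
      (hX.integral_comp hht.aestronglyMeasurable 0).trans hint
    have hvar0 : Var[fun ω => inner ℝ (w (X 0 ω)) t; P] = t.ofLp ⬝ᵥ (R * Rᵀ) *ᵥ t.ofLp := by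
      rw [← hvar, ← hX.law 0, variance_map (by rwa [hX.law]) (hX.measurable 0).aemeasurable]
      rfl
    have hmt0 : MemLp (fun ω => inner ℝ (w (X 0 ω)) t) 2 P :=
      hmt.comp_measurePreserving ⟨hX.measurable 0, hX.law 0⟩
    -- The scalar theorem for ⟨w(X_i), t⟩; its characteristic functions at 1 are those of the vector
    -- at t.
    have hclt := tendstoInDistribution_inv_sqrt_mul_sum_sub (P' := gaussianReal 0
      (Var[fun ω => inner ℝ (w (X 0 ω)) t; P]).toNNReal) (Y := id) HasLaw.id
      (X := fun i ω => inner ℝ (w (X i ω)) t) hmt0 (hX.iIndepFun_comp hht) hid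
    have hlim := ProbabilityMeasure.tendsto_iff_tendsto_charFun.1 hclt.tendsto 1
    simp only [ProbabilityMeasure.coe_mk, Measure.map_id, charFun_gaussianReal] at hlim
    simp only [ProbabilityMeasure.coe_mk, charFun_map_mulVec_pi_gaussianReal]
    convert! hlim using 2 with n
    · rw [charFun_map_eq_charFun_map_inner (Y := fun ω => √(n : ℝ) • sampleMean X w (n, ω))
        ((measurable_const_smul √(n : ℝ)).comp_aemeasurable (aemeasurable_sampleMean hX hw n))]
      simp only [hint0, mul_zero, sub_zero]
      congr 2
      ext ω
      exact sqrt_mul_inner_sampleMean w n ω t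
    · rw [hvar0]
      have hnn : 0 ≤ t.ofLp ⬝ᵥ (R * Rᵀ) *ᵥ t.ofLp := by
        rw [← hvar]
        exact variance_nonneg _ _
      simp [Real.coe_toNNReal _ hnn, neg_div]

theorem IsRandomSample.integral_sq_sum (hX : IsRandomSample P X ν) {h : 𝒳 → ℝ}
    (hL2 : MemLp h 2 ν) (hmean : ∫ x, h x ∂ν = 0) (n : ℕ) :
    ∫ ω, (∑ i : Fin n, h (sample X n ω i)) ^ 2 ∂P = n * ∫ x, h x ^ 2 ∂ν := by
  have hm := hL2.1.aemeasurable
  have hYL2 : ∀ i : Fin n, MemLp (fun ω => h (sample X n ω i)) 2 P := fun i =>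
    hL2.comp_measurePreserving ⟨hX.measurable i, hX.law i⟩
  have hmean' : ∀ i : Fin n, ∫ ω, h (sample X n ω i) ∂P = 0 := fun i =>
    (hX.integral_comp hL2.1 i).trans hmean
  have hsum : (fun ω => ∑ i : Fin n, h (sample X n ω i)) = ∑ i : Fin n, fun ω => h (sample X n ω i) := by
    ext ω; simp
  have h0 : ∫ ω, ∑ i : Fin n, h (sample X n ω i) ∂P = 0 := by
    rw [integral_finsetSum _ fun i _ => (hYL2 i).integrable one_le_two]
    simp [hmean']
  rw [← variance_of_integral_eq_zero (memLp_finsetSum _ fun i _ => hYL2 i).1.aemeasurable h0, hsum,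
    IndepFun.variance_sum (fun i _ => hYL2 i)]
  · have : ∀ i : Fin n, Var[fun ω => h (sample X n ω i); P] = ∫ x, h x ^ 2 ∂ν := fun i => by
      rw [variance_of_integral_eq_zero (hYL2 i).1.aemeasurable (hmean' i)]
      exact hX.integral_comp (hL2.1.pow 2) i
    simp [this]
  · intro i _ j _ hij
    exact (hX.iIndepFun_comp hm).indepFun (fun h => hij (Fin.ext h))

/-- By independence the expectation of n‖mean‖² is the trace of the covariance for every n ≥ 1, and
it is 0 for n = 0. This is the moment bound that Markov's inequality uses. -/
theorem IsRandomSample.exists_lintegral_sq_le (hX : IsRandomSample P X ν) {w : 𝒳 → Param p}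
    (hL2 : ∀ i, MemLp (fun x => w x i) 2 ν) (hmean : ∀ i, ∫ x, w x i ∂ν = 0) :
    ∃ C : ENNReal, C ≠ ⊤ ∧ ∀ n : ℕ,
      ∫⁻ ω, ENNReal.ofReal ‖(n : ℝ) * ‖sampleMean X w (n, ω)‖ ^ 2‖ ∂P ≤ C := by
  refine ⟨ENNReal.ofReal (∑ i, ∫ x, w x i ^ 2 ∂ν), ENNReal.ofReal_ne_top, fun n => ?_⟩
  have hYL2 : ∀ (k : Fin p), MemLp (fun ω => ∑ i : Fin n, w (sample X n ω i) k) 2 P := fun k =>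
    memLp_finsetSum _ fun i _ => (hL2 k).comp_measurePreserving ⟨hX.measurable i, hX.law i⟩
  have he : ∀ ω, ‖(n : ℝ) * ‖sampleMean X w (n, ω)‖ ^ 2‖ =
      (n : ℝ)⁻¹ * ∑ k, (∑ i : Fin n, w (sample X n ω i) k) ^ 2 := fun ω => by
    rw [Real.norm_of_nonneg (by positivity), EuclideanSpace.real_norm_sq_eq]
    simp only [sampleMean, PiLp.smul_apply, smul_eq_mul, mul_pow, ← Finset.mul_sum,
      WithLp.ofLp_sum, Finset.sum_apply]
    rcases eq_or_ne (n : ℝ) 0 with h | h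
    · simp [h]
    · field_simp
  simp only [he]
  rw [← ofReal_integral_eq_lintegral_ofReal]
  · refine ENNReal.ofReal_le_ofReal ?_
    rw [integral_const_mul, integral_finsetSum _ fun k _ => (hYL2 k).integrable_sq]
    simp only [hX.integral_sq_sum (hL2 _) (hmean _), ← Finset.mul_sum]
    have hnn : 0 ≤ ∑ i, ∫ x, w x i ^ 2 ∂ν :=
      Finset.sum_nonneg fun i _ => integral_nonneg fun x => sq_nonneg _
    rcases eq_or_ne (n : ℝ) 0 with h | h
    · simpa [h] using hnn
    · rw [inv_mul_cancel_left₀ h]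
  · exact (integrable_finsetSum _ fun k _ => (hYL2 k).integrable_sq).const_mul _
  · exact ae_of_all _ fun ω => by positivity

end CentralLimit

/-! ### Second and third derivatives by repeated `fderiv`. -/

section Calculus

variable {E : Type*} [NormedAddCommGroup E] [NormedSpace ℝ E]

/-- The two iterated derivatives differ by currying, a continuous linear equivalence. Repeated use
translates hypotheses on `iteratedFDeriv` into nested `fderiv`. -/
theorem _root_.DifferentiableAt.iteratedFDeriv_fderiv {F : Type*} [NormedAddCommGroup F]
    [NormedSpace ℝ F] {φ : E → F} {θ : E} {n : ℕ}
    (h : DifferentiableAt ℝ (iteratedFDeriv ℝ (n + 1) φ) θ) :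
    DifferentiableAt ℝ (iteratedFDeriv ℝ n (fderiv ℝ φ)) θ := by
  have : iteratedFDeriv ℝ n (fderiv ℝ φ) = continuousMultilinearCurryRightEquiv' ℝ n E F ∘
      iteratedFDeriv ℝ (n + 1) φ := by
    ext1 y
    rw [Function.comp_apply, iteratedFDeriv_succ_eq_comp_right]
    simp
  rw [this]
  have hc := ((continuousMultilinearCurryRightEquiv' ℝ n E F).toContinuousLinearEquiv :
    (E [×n.succ]→L[ℝ] F) →L[ℝ] (E [×n]→L[ℝ] E →L[ℝ] F)).differentiableAt
      (x := iteratedFDeriv ℝ (n + 1) φ θ)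
  exact DifferentiableAt.comp θ hc h

theorem differentiableAt_iteratedFDeriv_zero_iff {F : Type*} [NormedAddCommGroup F]
    [NormedSpace ℝ F] {φ : E → F} {θ : E} :
    DifferentiableAt ℝ (iteratedFDeriv ℝ 0 φ) θ ↔ DifferentiableAt ℝ φ θ := by
  rw [iteratedFDeriv_zero_eq_comp]
  exact (continuousMultilinearCurryFin0 ℝ E F).symm.comp_differentiableAt_iff

set_option maxSynthPendingDepth 5 in
theorem norm_fderiv_fderiv_fderiv (φ : E → ℝ) (θ : E) :
    ‖fderiv ℝ (fderiv ℝ (fderiv ℝ φ)) θ‖ = ‖iteratedFDeriv ℝ 3 φ θ‖ := by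
  rw [← norm_iteratedFDeriv_fderiv, ← norm_iteratedFDeriv_fderiv, ← norm_iteratedFDeriv_fderiv,
    norm_iteratedFDeriv_zero]

theorem fderiv_comp_of_hasDerivAt {h h₁ : ℝ → ℝ} (hh : ∀ y, 0 < y → HasDerivAt h (h₁ y) y)
    {F : E → ℝ} {θ : E} (hF : DifferentiableAt ℝ F θ) (hpos : 0 < F θ) :
    fderiv ℝ (fun τ => h (F τ)) θ = h₁ (F θ) • fderiv ℝ F θ :=
  ((hh _ hpos).comp_hasFDerivAt θ hF.hasFDerivAt).fderiv

theorem hasFDerivAt_fderiv_comp {h h₁ h₂ : ℝ → ℝ} (hh : ∀ y, 0 < y → HasDerivAt h (h₁ y) y)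
    (hh₁ : ∀ y, 0 < y → HasDerivAt h₁ (h₂ y) y) {F : E → ℝ} {U : Set E} (hU : IsOpen U) {θ : E}
    (hθ : θ ∈ U) (hF : ∀ τ ∈ U, DifferentiableAt ℝ F τ) (hF₁ : DifferentiableAt ℝ (fderiv ℝ F) θ)
    (hpos : ∀ τ ∈ U, 0 < F τ) :
    HasFDerivAt (fderiv ℝ fun τ => h (F τ)) (h₁ (F θ) • fderiv ℝ (fderiv ℝ F) θ +
      (h₂ (F θ) • fderiv ℝ F θ).smulRight (fderiv ℝ F θ)) θ := by
  have heq : (fderiv ℝ fun τ => h (F τ)) =ᶠ[𝓝 θ] fun τ => h₁ (F τ) • fderiv ℝ F τ := by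
    filter_upwards [hU.mem_nhds hθ] with τ hτ
    exact fderiv_comp_of_hasDerivAt hh (hF τ hτ) (hpos τ hτ)
  refine HasFDerivAt.congr_of_eventuallyEq ?_ heq
  exact ((hh₁ _ (hpos θ hθ)).comp_hasFDerivAt θ (hF θ hθ).hasFDerivAt).fun_smul hF₁.hasFDerivAt

theorem fderiv_fderiv_comp_apply {h h₁ h₂ : ℝ → ℝ} (hh : ∀ y, 0 < y → HasDerivAt h (h₁ y) y)
    (hh₁ : ∀ y, 0 < y → HasDerivAt h₁ (h₂ y) y) {F : E → ℝ} {U : Set E} (hU : IsOpen U) {θ : E}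
    (hθ : θ ∈ U) (hF : ∀ τ ∈ U, DifferentiableAt ℝ F τ) (hF₁ : DifferentiableAt ℝ (fderiv ℝ F) θ)
    (hpos : ∀ τ ∈ U, 0 < F τ) (v w : E) :
    fderiv ℝ (fderiv ℝ fun τ => h (F τ)) θ v w =
      h₂ (F θ) * fderiv ℝ F θ v * fderiv ℝ F θ w + h₁ (F θ) * fderiv ℝ (fderiv ℝ F) θ v w := by
  rw [(hasFDerivAt_fderiv_comp hh hh₁ hU hθ hF hF₁ hpos).fderiv]
  simp only [_root_.add_apply, _root_.smul_apply, smul_eq_mul,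
    ContinuousLinearMap.smulRight_apply]
  ring

/-- `φ` is three times differentiable at the points of `U`. -/
structure ThriceDifferentiableOn (φ : E → ℝ) (U : Set E) : Prop where
  differentiableAt : ∀ θ ∈ U, DifferentiableAt ℝ φ θ
  differentiableAt_fderiv : ∀ θ ∈ U, DifferentiableAt ℝ (fderiv ℝ φ) θ
  differentiableAt_fderiv_fderiv : ∀ θ ∈ U, DifferentiableAt ℝ (fderiv ℝ (fderiv ℝ φ)) θ

theorem _root_.ContDiffOn.thriceDifferentiableOn {φ : E → ℝ} {U : Set E} (hU : IsOpen U)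
    (h : ContDiffOn ℝ 3 φ U) : ThriceDifferentiableOn φ U := by
  have h1 : ContDiffOn ℝ 2 (fderiv ℝ φ) U := h.fderiv_of_isOpen hU (by norm_num)
  have h2 : ContDiffOn ℝ 1 (fderiv ℝ (fderiv ℝ φ)) U := h1.fderiv_of_isOpen hU (by norm_num)
  exact ⟨fun θ hθ => (h.contDiffAt (hU.mem_nhds hθ)).differentiableAt (by norm_num),
    fun θ hθ => (h1.contDiffAt (hU.mem_nhds hθ)).differentiableAt (by norm_num),
    fun θ hθ => (h2.contDiffAt (hU.mem_nhds hθ)).differentiableAt (by norm_num)⟩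

theorem ThriceDifferentiableOn.fderiv_sub_const_mul {φ ψ : E → ℝ} {U : Set E}
    (hφ : ThriceDifferentiableOn φ U) (hψ : ThriceDifferentiableOn ψ U) (a : ℝ) {θ : E}
    (hθ : θ ∈ U) : fderiv ℝ (fun τ => φ τ - a * ψ τ) θ = fderiv ℝ φ θ - a • fderiv ℝ ψ θ :=
  ((hφ.differentiableAt θ hθ).hasFDerivAt.sub
    ((hψ.differentiableAt θ hθ).hasFDerivAt.const_mul a)).fderiv

theorem ThriceDifferentiableOn.hasFDerivAt_fderiv_sub_const_mul {φ ψ : E → ℝ} {U : Set E}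
    (hU : IsOpen U) (hφ : ThriceDifferentiableOn φ U) (hψ : ThriceDifferentiableOn ψ U) (a : ℝ)
    {θ : E} (hθ : θ ∈ U) : HasFDerivAt (fderiv ℝ fun τ => φ τ - a * ψ τ)
      (fderiv ℝ (fderiv ℝ φ) θ - a • fderiv ℝ (fderiv ℝ ψ) θ) θ := by
  have heq : (fderiv ℝ fun τ => φ τ - a * ψ τ) =ᶠ[𝓝 θ] fun τ => fderiv ℝ φ τ - a • fderiv ℝ ψ τ := by
    filter_upwards [hU.mem_nhds hθ] with τ hτ using hφ.fderiv_sub_const_mul hψ a hτ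
  exact ((hφ.differentiableAt_fderiv θ hθ).hasFDerivAt.sub
    ((hψ.differentiableAt_fderiv θ hθ).hasFDerivAt.const_smul a)).congr_of_eventuallyEq heq

set_option maxSynthPendingDepth 5 in
theorem ThriceDifferentiableOn.sub_const_mul {φ ψ : E → ℝ} {U : Set E} (hU : IsOpen U)
    (hφ : ThriceDifferentiableOn φ U) (hψ : ThriceDifferentiableOn ψ U) (a : ℝ) :
    ThriceDifferentiableOn (fun τ => φ τ - a * ψ τ) U where
  differentiableAt θ hθ := (hφ.differentiableAt θ hθ).sub ((hψ.differentiableAt θ hθ).const_mul a)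
  differentiableAt_fderiv θ hθ :=
    (hφ.hasFDerivAt_fderiv_sub_const_mul hU hψ a hθ).differentiableAt
  differentiableAt_fderiv_fderiv θ hθ := by
    have heq : (fderiv ℝ (fderiv ℝ fun τ => φ τ - a * ψ τ)) =ᶠ[𝓝 θ]
        fun τ => fderiv ℝ (fderiv ℝ φ) τ - a • fderiv ℝ (fderiv ℝ ψ) τ := by
      filter_upwards [hU.mem_nhds hθ] with τ hτ
        using (hφ.hasFDerivAt_fderiv_sub_const_mul hU hψ a hτ).fderiv
    refine DifferentiableAt.congr_of_eventuallyEq ?_ heq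
    exact (hφ.differentiableAt_fderiv_fderiv θ hθ).fun_sub
      ((hψ.differentiableAt_fderiv_fderiv θ hθ).fun_const_smul a)

end Calculus

/-! ### Differentiation under the integral sign, in terms of `fderiv`. -/

section DiffUnderIntegral

variable {𝒳 : Type*} [MeasurableSpace 𝒳] {μ : Measure 𝒳} {p m : ℕ} {U : Set (Param p)}
  {F : Param p → 𝒳 → ℝ} {θ : Param p}

theorem DiffUnderIntegral.differentiableAt (h : DiffUnderIntegral μ m U F) (hm : 0 < m)
    (hθ : θ ∈ U) : DifferentiableAt ℝ (fun τ => ∫ x, F τ x ∂μ) θ :=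
  differentiableAt_iteratedFDeriv_zero_iff.1 (h.1 0 hm θ hθ)

theorem DiffUnderIntegral.differentiableAt_fderiv (h : DiffUnderIntegral μ m U F) (hm : 1 < m)
    (hθ : θ ∈ U) : DifferentiableAt ℝ (fderiv ℝ fun τ => ∫ x, F τ x ∂μ) θ :=
  differentiableAt_iteratedFDeriv_zero_iff.1
    (h.1 1 hm θ hθ).iteratedFDeriv_fderiv

theorem DiffUnderIntegral.thriceDifferentiableOn (h : DiffUnderIntegral μ 3 U F) :
    ThriceDifferentiableOn (fun τ => ∫ x, F τ x ∂μ) U where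
  differentiableAt _ hθ := h.differentiableAt (by norm_num) hθ
  differentiableAt_fderiv _ hθ := h.differentiableAt_fderiv (by norm_num) hθ
  differentiableAt_fderiv_fderiv θ hθ := differentiableAt_iteratedFDeriv_zero_iff.1
    (h.1 2 (by norm_num) θ hθ).iteratedFDeriv_fderiv.iteratedFDeriv_fderiv

theorem DiffUnderIntegral.integrable_fderiv (h : DiffUnderIntegral μ m U F) (hm : 1 ≤ m)
    (hθ : θ ∈ U) (v : Param p) : Integrable (fun x => fderiv ℝ (fun τ => F τ x) θ v) μ := by
  simpa using (h.2 1 hm θ hθ fun _ => v).1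

theorem DiffUnderIntegral.fderiv_apply (h : DiffUnderIntegral μ m U F) (hm : 1 ≤ m)
    (hθ : θ ∈ U) (v : Param p) : fderiv ℝ (fun τ => ∫ x, F τ x ∂μ) θ v =
      ∫ x, fderiv ℝ (fun τ => F τ x) θ v ∂μ := by
  simpa using (h.2 1 hm θ hθ fun _ => v).2

theorem DiffUnderIntegral.integrable_fderiv_fderiv (h : DiffUnderIntegral μ m U F) (hm : 2 ≤ m)
    (hθ : θ ∈ U) (v w : Param p) :
    Integrable (fun x => fderiv ℝ (fderiv ℝ fun τ => F τ x) θ v w) μ := by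
  simpa [iteratedFDeriv_two_apply] using (h.2 2 hm θ hθ ![v, w]).1

theorem DiffUnderIntegral.fderiv_fderiv_apply (h : DiffUnderIntegral μ m U F) (hm : 2 ≤ m)
    (hθ : θ ∈ U) (v w : Param p) : fderiv ℝ (fderiv ℝ fun τ => ∫ x, F τ x ∂μ) θ v w =
      ∫ x, fderiv ℝ (fderiv ℝ fun τ => F τ x) θ v w ∂μ := by
  simpa [iteratedFDeriv_two_apply] using (h.2 2 hm θ hθ ![v, w]).2

end DiffUnderIntegral

/-! ### Derivatives of functions of the density at a fixed observation. -/

section RegularPoint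

variable {𝒳 : Type*} {p : ℕ} {U Θ : Set (Param p)} {f : Param p → 𝒳 → ℝ}
  {x : 𝒳} {θ : Param p}

/-- The density at `x` is a positive, three times continuously differentiable function on `U`. -/
structure IsRegularPoint (f : Param p → 𝒳 → ℝ) (U : Set (Param p)) (x : 𝒳) : Prop where
  isOpen : IsOpen U
  pos : ∀ θ ∈ U, 0 < f θ x
  contDiffOn : ContDiffOn ℝ 3 (fun θ => f θ x) U

theorem IsRegularPoint.thriceDifferentiableOn (h : IsRegularPoint f U x) :
    ThriceDifferentiableOn (fun θ => f θ x) U := h.contDiffOn.thriceDifferentiableOn h.isOpen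

theorem IsRegularPoint.fderiv_comp (h : IsRegularPoint f U x) (hθ : θ ∈ U) {g g₁ : ℝ → ℝ}
    (hg : ∀ y, 0 < y → HasDerivAt g (g₁ y) y) (v : Param p) :
    fderiv ℝ (fun τ => g (f τ x)) θ v = g₁ (f θ x) * fderiv ℝ (fun τ => f τ x) θ v := by
  rw [fderiv_comp_of_hasDerivAt hg (F := fun τ => f τ x)
    (h.thriceDifferentiableOn.differentiableAt θ hθ) (h.pos θ hθ)]
  rfl

theorem IsRegularPoint.fderiv_fderiv_comp (h : IsRegularPoint f U x) (hθ : θ ∈ U) {g g₁ g₂ : ℝ → ℝ}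
    (hg : ∀ y, 0 < y → HasDerivAt g (g₁ y) y) (hg₁ : ∀ y, 0 < y → HasDerivAt g₁ (g₂ y) y)
    (v w : Param p) :
    fderiv ℝ (fderiv ℝ fun τ => g (f τ x)) θ v w =
      g₂ (f θ x) * fderiv ℝ (fun τ => f τ x) θ v * fderiv ℝ (fun τ => f τ x) θ w +
        g₁ (f θ x) * fderiv ℝ (fderiv ℝ fun τ => f τ x) θ v w :=
  fderiv_fderiv_comp_apply (F := fun τ => f τ x) hg hg₁ h.isOpen hθ
    h.thriceDifferentiableOn.differentiableAt
    (h.thriceDifferentiableOn.differentiableAt_fderiv θ hθ) h.pos v w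

theorem hasDerivAt_rpow (s : ℝ) (y : ℝ) (hy : 0 < y) :
    HasDerivAt (fun y : ℝ => y ^ s) (s * y ^ (s - 1)) y :=
  Real.hasDerivAt_rpow_const (Or.inl hy.ne')

theorem hasDerivAt_const_mul_rpow (a s : ℝ) (y : ℝ) (hy : 0 < y) :
    HasDerivAt (fun y : ℝ => a * y ^ s) (a * (s * y ^ (s - 1))) y :=
  (hasDerivAt_rpow s y hy).const_mul a

theorem IsRegularPoint.score_eq (h : IsRegularPoint f U x) (hθ : θ ∈ U) (i : Fin p) :
    score f θ x i = (f θ x)⁻¹ * fderiv ℝ (fun τ => f τ x) θ (EuclideanSpace.single i 1) :=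
  h.fderiv_comp hθ (fun _ hy => Real.hasDerivAt_log hy.ne') _

theorem IsRegularPoint.fderiv_eq_score_mul (h : IsRegularPoint f U x) (hθ : θ ∈ U) (i : Fin p) :
    fderiv ℝ (fun τ => f τ x) θ (EuclideanSpace.single i 1) = score f θ x i * f θ x := by
  rw [h.score_eq hθ, mul_comm, mul_inv_cancel_left₀ (h.pos θ hθ).ne']

theorem IsRegularPoint.fderiv_rpow (h : IsRegularPoint f U x) (hθ : θ ∈ U) (s : ℝ) (i : Fin p) :
    fderiv ℝ (fun τ => f τ x ^ s) θ (EuclideanSpace.single i 1) =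
      s * (score f θ x i * f θ x ^ s) := by
  rw [h.fderiv_comp hθ (hasDerivAt_rpow s), h.fderiv_eq_score_mul hθ,
    show s * f θ x ^ (s - 1) * (score f θ x i * f θ x) =
      s * (score f θ x i * (f θ x ^ (s - 1) * f θ x)) by ring, ← Real.rpow_add_one (h.pos θ hθ).ne',
    sub_add_cancel]

/-- Off the common support every function of the density is locally constant in the parameter, so
nothing is asked of `g` at 0, where powers and logarithms may fail to be smooth. -/
theorem fderiv_comp_eq_zero_of_forall_eq_zero (hU : IsOpen U) (h : ∀ τ ∈ U, f τ x = 0) (hθ : θ ∈ U)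
    (g : ℝ → ℝ) : fderiv ℝ (fun τ => g (f τ x)) θ = 0 := by
  have : (fun τ => g (f τ x)) =ᶠ[𝓝 θ] fun _ => g 0 := by
    filter_upwards [hU.mem_nhds hθ] with τ hτ
    rw [h τ hτ]
  rw [this.fderiv_eq]
  simp

theorem fderiv_fderiv_comp_eq_zero_of_forall_eq_zero (hU : IsOpen U) (h : ∀ τ ∈ U, f τ x = 0)
    (hθ : θ ∈ U) (g : ℝ → ℝ) : fderiv ℝ (fderiv ℝ fun τ => g (f τ x)) θ = 0 := by
  have : (fderiv ℝ fun τ => g (f τ x)) =ᶠ[𝓝 θ] fun _ => 0 := by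
    filter_upwards [hU.mem_nhds hθ] with τ hτ
    exact fderiv_comp_eq_zero_of_forall_eq_zero hU h hτ g
  rw [this.fderiv_eq]
  simp

theorem score_eq_zero_of_forall_eq_zero (hU : IsOpen U) (h : ∀ τ ∈ U, f τ x = 0) (hθ : θ ∈ U)
    (i : Fin p) : score f θ x i = 0 := by
  rw [score, partialDeriv, fderiv_comp_eq_zero_of_forall_eq_zero hU h hθ]
  rfl

end RegularPoint

/-! ### Integration with respect to the model distribution. -/

section Law

variable {𝒳 : Type*} [MeasurableSpace 𝒳] {μ : Measure 𝒳} {p : ℕ} {Θ : Set (Param p)}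
  {f : Param p → 𝒳 → ℝ} {θ : Param p}

theorem IsParametricModel.measurable_apply (hf : IsParametricModel μ Θ f) (θ : Param p) :
    Measurable (f θ) := hf.measurable.of_uncurry_left

theorem IsParametricModel.integrable (hf : IsParametricModel μ Θ f) (hθ : θ ∈ Θ) :
    Integrable (f θ) μ := by
  by_contra h
  have := hf.integral_eq_one θ hθ
  rw [integral_undef h] at this
  exact zero_ne_one this

theorem IsParametricModel.ae_modelLaw_iff (hf : IsParametricModel μ Θ f) {q : 𝒳 → Prop} :
    (∀ᵐ x ∂modelLaw μ f θ, q x) ↔ ∀ᵐ x ∂μ, 0 < f θ x → q x := by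
  rw [modelLaw, ae_withDensity_iff (hf.measurable_apply θ).ennreal_ofReal]
  simp

theorem IsParametricModel.integrable_modelLaw_iff (hf : IsParametricModel μ Θ f) (hθ : θ ∈ Θ)
    {h : 𝒳 → ℝ} : Integrable h (modelLaw μ f θ) ↔ Integrable (fun x => h x * f θ x) μ := by
  rw [modelLaw, integrable_withDensity_iff (hf.measurable_apply θ).ennreal_ofReal (by simp)]
  simp only [ENNReal.toReal_ofReal (hf.nonneg θ hθ _)]

theorem IsParametricModel.integral_modelLaw (hf : IsParametricModel μ Θ f) (hθ : θ ∈ Θ)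
    (h : 𝒳 → ℝ) : ∫ x, h x ∂modelLaw μ f θ = ∫ x, h x * f θ x ∂μ := by
  rw [modelLaw, integral_withDensity_eq_integral_toReal_smul
    (hf.measurable_apply θ).ennreal_ofReal (by simp)]
  simp only [ENNReal.toReal_ofReal (hf.nonneg θ hθ _), smul_eq_mul, mul_comm]

theorem IsParametricModel.isProbabilityMeasure (hf : IsParametricModel μ Θ f) (hθ : θ ∈ Θ) :
    IsProbabilityMeasure (modelLaw μ f θ) := by
  constructor
  rw [modelLaw, withDensity_apply _ .univ, setLIntegral_univ,
    ← ofReal_integral_eq_lintegral_ofReal (hf.integrable hθ) (ae_of_all _ (hf.nonneg θ hθ)),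
    hf.integral_eq_one θ hθ, ENNReal.ofReal_one]

end Law

/-! ### First derivative of the objective: mean and covariance. -/

section Score

variable {𝒳 : Type*} [MeasurableSpace 𝒳] {μ : Measure 𝒳} {p : ℕ} {Θ U : Set (Param p)}
  {f : Param p → 𝒳 → ℝ} {β : ℝ} {θ₀ θ : Param p} {x : 𝒳}

/-- Since the support is common, positivity at θ₀ decides positivity on all of U; this dichotomy
drives the almost everywhere identities for derivatives. -/
theorem LehmannBasu.ae_isRegularPoint_or (hLB : LehmannBasu μ Θ f β θ₀ U)
    (hf : IsParametricModel μ Θ f) :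
    ∀ᵐ x ∂μ, IsRegularPoint f U x ∨ ∀ θ ∈ U, f θ x = 0 := by
  filter_upwards [hLB.smooth] with x hx
  by_cases h : 0 < f θ₀ x
  · refine Or.inl ⟨hLB.isOpen, fun θ hθ => ?_, hx⟩
    have := hf.common_support θ₀ (hLB.subset hLB.mem) θ (hLB.subset hθ)
    exact this.subset h
  · refine Or.inr fun θ hθ => ?_
    have := hf.common_support θ (hLB.subset hθ) θ₀ (hLB.subset hLB.mem)
    exact le_antisymm (not_lt.1 fun h' => h (this.subset h')) (hf.nonneg θ (hLB.subset hθ) x)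

theorem LehmannBasu.ae_isRegularPoint (hLB : LehmannBasu μ Θ f β θ₀ U)
    (hf : IsParametricModel μ Θ f) : ∀ᵐ x ∂modelLaw μ f θ₀, IsRegularPoint f U x := by
  rw [hf.ae_modelLaw_iff]
  filter_upwards [hLB.ae_isRegularPoint_or hf] with x hx hpos
  exact hx.resolve_right fun h => hpos.ne' (h θ₀ hLB.mem)

theorem LehmannBasu.score_mul_rpow_ae_eq (hLB : LehmannBasu μ Θ f β θ₀ U)
    (hf : IsParametricModel μ Θ f) (hθ : θ ∈ U) (i : Fin p) :
    (fun x => fderiv ℝ (fun τ => f τ x ^ (1 + β)) θ (EuclideanSpace.single i 1)) =ᵐ[μ]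
      fun x => (1 + β) * (score f θ x i * f θ x ^ (1 + β)) := by
  filter_upwards [hLB.ae_isRegularPoint_or hf] with x hx
  rcases hx with hx | hx
  · exact hx.fderiv_rpow hθ _ i
  · rw [fderiv_comp_eq_zero_of_forall_eq_zero hLB.isOpen hx hθ (fun y => y ^ (1 + β)),
      score_eq_zero_of_forall_eq_zero hLB.isOpen hx hθ]
    simp

theorem LehmannBasu.integrable_score_mul_rpow (hLB : LehmannBasu μ Θ f β θ₀ U)
    (hf : IsParametricModel μ Θ f) (hβ : 0 ≤ β) (hθ : θ ∈ U) (i : Fin p) :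
    Integrable (fun x => score f θ x i * f θ x ^ (1 + β)) μ := by
  have h := (hLB.diff_power.integrable_fderiv (by norm_num) hθ (EuclideanSpace.single i 1)).congr
    (hLB.score_mul_rpow_ae_eq hf hθ i)
  have hc : 1 + β ≠ 0 := by positivity
  simpa [hc] using h.const_mul (1 + β)⁻¹

theorem LehmannBasu.fderiv_integral_rpow (hLB : LehmannBasu μ Θ f β θ₀ U)
    (hf : IsParametricModel μ Θ f) (hθ : θ ∈ U) (i : Fin p) :
    fderiv ℝ (fun τ => ∫ x, f τ x ^ (1 + β) ∂μ) θ (EuclideanSpace.single i 1) =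
      (1 + β) * xiVec μ f β θ i := by
  rw [hLB.diff_power.fderiv_apply (by norm_num) hθ,
    integral_congr_ae (hLB.score_mul_rpow_ae_eq hf hθ i), integral_const_mul]
  rfl

theorem LehmannBasu.integral_rpow_eventuallyEq_one (hLB : LehmannBasu μ Θ f β θ₀ U)
    (hf : IsParametricModel μ Θ f) (hβ : β = 0) (hθ : θ ∈ U) :
    (fun τ => ∫ x, f τ x ^ (1 + β) ∂μ) =ᶠ[𝓝 θ] fun _ => 1 := by
  filter_upwards [hLB.isOpen.mem_nhds hθ] with τ hτ
  simpa [hβ] using hf.integral_eq_one τ (hLB.subset hτ)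

/-- For β = 0 the integral is the total mass 1, constant in θ, so the score has mean zero. -/
theorem LehmannBasu.xiVec_eq_zero (hLB : LehmannBasu μ Θ f β θ₀ U)
    (hf : IsParametricModel μ Θ f) (hβ : β = 0) (hθ : θ ∈ U) (i : Fin p) :
    xiVec μ f β θ i = 0 := by
  have h := hLB.fderiv_integral_rpow hf hθ i
  rw [(hLB.integral_rpow_eventuallyEq_one hf hβ hθ).fderiv_eq] at h
  simpa [hβ] using h.symm

/-- The objective function is an integral minus a smooth function of the density. -/
theorem objective_of_ne_zero (hβ : β ≠ 0) :
    (fun θ => objective μ f β θ x) =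
      fun θ => ∫ y, f θ y ^ (1 + β) ∂μ - (1 + 1 / β) * f θ x ^ β := by
  ext θ
  rw [objective, if_neg hβ]

theorem objective_of_eq_zero (hβ : β = 0) :
    (fun θ => objective μ f β θ x) = fun θ => -Real.log (f θ x) := by
  ext θ
  rw [objective, if_pos hβ]

omit [MeasurableSpace 𝒳] in
theorem IsRegularPoint.thriceDifferentiableOn_rpow (h : IsRegularPoint f U x) (s : ℝ) :
    ThriceDifferentiableOn (fun θ => f θ x ^ s) U :=
  ContDiffOn.thriceDifferentiableOn h.isOpen
    (h.contDiffOn.rpow_const_of_ne fun θ hθ => (h.pos θ hθ).ne')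

theorem IsRegularPoint.thriceDifferentiableOn_objective (h : IsRegularPoint f U x)
    (hLB : LehmannBasu μ Θ f β θ₀ U) :
    ThriceDifferentiableOn (fun θ => objective μ f β θ x) U := by
  rcases eq_or_ne β 0 with hβ | hβ
  · rw [objective_of_eq_zero hβ]
    exact ContDiffOn.thriceDifferentiableOn h.isOpen
      (h.contDiffOn.log fun θ hθ => (h.pos θ hθ).ne').neg
  · rw [objective_of_ne_zero hβ]
    exact hLB.diff_power.thriceDifferentiableOn.sub_const_mul h.isOpen
      (h.thriceDifferentiableOn_rpow β) _

/-- One formula serves all β ≥ 0, because ξ vanishes in the likelihood case β = 0. -/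
theorem IsRegularPoint.fderiv_objective (h : IsRegularPoint f U x)
    (hLB : LehmannBasu μ Θ f β θ₀ U) (hf : IsParametricModel μ Θ f) (hθ : θ ∈ U)
    (i : Fin p) :
    fderiv ℝ (fun θ => objective μ f β θ x) θ (EuclideanSpace.single i 1) =
      (1 + β) * (xiVec μ f β θ i - score f θ x i * f θ x ^ β) := by
  rcases eq_or_ne β 0 with h0 | h0
  · rw [objective_of_eq_zero h0, hLB.xiVec_eq_zero hf h0 hθ, fderiv_fun_neg]
    simp [h0, score, partialDeriv]
  · rw [objective_of_ne_zero h0, hLB.diff_power.thriceDifferentiableOn.fderiv_sub_const_mul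
      (h.thriceDifferentiableOn_rpow β) _ hθ]
    simp only [_root_.sub_apply, _root_.smul_apply, smul_eq_mul]
    rw [hLB.fderiv_integral_rpow hf hθ, h.fderiv_rpow hθ]
    field_simp
    ring

theorem LehmannBasu.integrable_score_rpow (hLB : LehmannBasu μ Θ f β θ₀ U)
    (hf : IsParametricModel μ Θ f) (hβ : 0 ≤ β) (i : Fin p) :
    Integrable (fun x => score f θ₀ x i * f θ₀ x ^ β) (modelLaw μ f θ₀) := by
  have hθ := hLB.subset hLB.mem
  rw [hf.integrable_modelLaw_iff hθ]
  refine (hLB.integrable_score_mul_rpow hf hβ hLB.mem i).congr (ae_of_all _ fun x => ?_)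
  simp only [mul_assoc]
  rw [add_comm, Real.rpow_add_one' (hf.nonneg _ hθ x) (by positivity)]

theorem LehmannBasu.integral_score_rpow (hLB : LehmannBasu μ Θ f β θ₀ U)
    (hf : IsParametricModel μ Θ f) (hβ : 0 ≤ β) (i : Fin p) :
    ∫ x, score f θ₀ x i * f θ₀ x ^ β ∂modelLaw μ f θ₀ = xiVec μ f β θ₀ i := by
  have hθ := hLB.subset hLB.mem
  rw [hf.integral_modelLaw hθ]
  refine integral_congr_ae (ae_of_all _ fun x => ?_)
  simp only [mul_assoc]
  rw [add_comm, Real.rpow_add_one' (hf.nonneg _ hθ x) (by positivity)]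

theorem mul_rpow_mul_mul_rpow_mul {y : ℝ} (hy : 0 ≤ y) (hβ : 0 ≤ β) (a b : ℝ) :
    a * y ^ β * (b * y ^ β) * y = a * b * y ^ (1 + 2 * β) := by
  rw [add_comm, Real.rpow_add_one' hy (by positivity), two_mul,
    Real.rpow_add_of_nonneg hy hβ hβ]
  ring

theorem LehmannBasu.memLp_score_rpow (hLB : LehmannBasu μ Θ f β θ₀ U)
    (hf : IsParametricModel μ Θ f) (hβ : 0 ≤ β) (i : Fin p) :
    MemLp (fun x => score f θ₀ x i * f θ₀ x ^ β) 2 (modelLaw μ f θ₀) := by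
  have hθ := hLB.subset hLB.mem
  rw [memLp_two_iff_integrable_sq (hLB.integrable_score_rpow hf hβ i).1,
    hf.integrable_modelLaw_iff hθ]
  refine (hLB.finite_kMat i).congr (ae_of_all _ fun x => ?_)
  simp only [pow_two]
  rw [mul_rpow_mul_mul_rpow_mul (hf.nonneg _ hθ x) hβ]

theorem LehmannBasu.integral_score_rpow_mul (hLB : LehmannBasu μ Θ f β θ₀ U)
    (hf : IsParametricModel μ Θ f) (hβ : 0 ≤ β) (i j : Fin p) :
    ∫ x, (score f θ₀ x i * f θ₀ x ^ β) * (score f θ₀ x j * f θ₀ x ^ β) ∂modelLaw μ f θ₀ =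
      ∫ x, score f θ₀ x i * score f θ₀ x j * f θ₀ x ^ (1 + 2 * β) ∂μ := by
  have hθ := hLB.subset hLB.mem
  rw [hf.integral_modelLaw hθ]
  refine integral_congr_ae (ae_of_all _ fun x => ?_)
  simp only []
  rw [mul_rpow_mul_mul_rpow_mul (hf.nonneg _ hθ x) hβ]

/-- The gradient of the objective function at the true parameter. -/
noncomputable def objectiveGrad (μ : Measure 𝒳) (f : Param p → 𝒳 → ℝ) (β : ℝ) (θ₀ : Param p)
    (x : 𝒳) : Param p :=
  WithLp.toLp 2 fun i => (1 + β) * (xiVec μ f β θ₀ i - score f θ₀ x i * f θ₀ x ^ β)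

theorem LehmannBasu.memLp_objectiveGrad (hLB : LehmannBasu μ Θ f β θ₀ U)
    (hf : IsParametricModel μ Θ f) (hβ : 0 ≤ β) (i : Fin p) :
    MemLp (fun x => objectiveGrad μ f β θ₀ x i) 2 (modelLaw μ f θ₀) := by
  have := hf.isProbabilityMeasure (hLB.subset hLB.mem)
  exact ((memLp_const _).sub (hLB.memLp_score_rpow hf hβ i)).const_mul (1 + β)

theorem LehmannBasu.aemeasurable_objectiveGrad (hLB : LehmannBasu μ Θ f β θ₀ U)
    (hf : IsParametricModel μ Θ f) (hβ : 0 ≤ β) :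
    AEMeasurable (objectiveGrad μ f β θ₀) (modelLaw μ f θ₀) := by
  have : AEMeasurable (fun x i => objectiveGrad μ f β θ₀ x i) (modelLaw μ f θ₀) :=
    aemeasurable_pi_lambda _ fun i => (hLB.memLp_objectiveGrad hf hβ i).1.aemeasurable
  exact (WithLp.measurable_toLp 2 (Fin p → ℝ)).comp_aemeasurable this

theorem LehmannBasu.integral_objectiveGrad (hLB : LehmannBasu μ Θ f β θ₀ U)
    (hf : IsParametricModel μ Θ f) (hβ : 0 ≤ β) (i : Fin p) :
    ∫ x, objectiveGrad μ f β θ₀ x i ∂modelLaw μ f θ₀ = 0 := by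
  have := hf.isProbabilityMeasure (hLB.subset hLB.mem)
  simp only [objectiveGrad]
  rw [integral_const_mul, integral_sub (integrable_const _) (hLB.integrable_score_rpow hf hβ i),
    hLB.integral_score_rpow hf hβ]
  simp

theorem LehmannBasu.integral_objectiveGrad_mul (hLB : LehmannBasu μ Θ f β θ₀ U)
    (hf : IsParametricModel μ Θ f) (hβ : 0 ≤ β) (i j : Fin p) :
    ∫ x, objectiveGrad μ f β θ₀ x i * objectiveGrad μ f β θ₀ x j ∂modelLaw μ f θ₀ =
      (1 + β) ^ 2 * kMat μ f β θ₀ i j := by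
  have := hf.isProbabilityMeasure (hLB.subset hLB.mem)
  set s : Fin p → 𝒳 → ℝ := fun i x => score f θ₀ x i * f θ₀ x ^ β with hs
  have hint := fun i => hLB.integrable_score_rpow hf hβ i
  have hprod : Integrable (fun x => s i x * s j x) (modelLaw μ f θ₀) :=
    (hLB.memLp_score_rpow hf hβ i).integrable_mul (hLB.memLp_score_rpow hf hβ j)
  have he : ∀ x, objectiveGrad μ f β θ₀ x i * objectiveGrad μ f β θ₀ x j =
      (1 + β) ^ 2 * (xiVec μ f β θ₀ i * xiVec μ f β θ₀ j - xiVec μ f β θ₀ i * s j x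
        - xiVec μ f β θ₀ j * s i x + s i x * s j x) := fun x => by
    simp only [objectiveGrad, hs]; ring
  simp only [he]
  have h1 : Integrable (fun x => xiVec μ f β θ₀ i * s j x) (modelLaw μ f θ₀) := (hint j).const_mul _
  have h2 : Integrable (fun x => xiVec μ f β θ₀ j * s i x) (modelLaw μ f θ₀) := (hint i).const_mul _
  have h3 : Integrable (fun x => xiVec μ f β θ₀ i * xiVec μ f β θ₀ j - xiVec μ f β θ₀ i * s j x)
      (modelLaw μ f θ₀) := (integrable_const _).sub h1
  have h4 : Integrable (fun x => xiVec μ f β θ₀ i * xiVec μ f β θ₀ j - xiVec μ f β θ₀ i * s j x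
      - xiVec μ f β θ₀ j * s i x) (modelLaw μ f θ₀) := h3.sub h2
  rw [integral_const_mul, integral_add h4 hprod, integral_sub h3 h2,
    integral_sub (integrable_const _) h1,
    integral_const_mul (xiVec μ f β θ₀ i) (s j), integral_const_mul (xiVec μ f β θ₀ j) (s i),
    hLB.integral_score_rpow_mul hf hβ,
    hLB.integral_score_rpow hf hβ, hLB.integral_score_rpow hf hβ]
  simp only [integral_const, probReal_univ, one_smul, kMat, Matrix.of_apply]
  ring

/-- (1+β)²K is the second moment matrix of the gradient, so its quadratic form is the mean of a
square. -/
theorem LehmannBasu.posSemidef_kMat (hLB : LehmannBasu μ Θ f β θ₀ U)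
    (hf : IsParametricModel μ Θ f) (hβ : 0 ≤ β) : (kMat μ f β θ₀).PosSemidef := by
  have hc : 0 < (1 + β) ^ 2 := by positivity
  refine Matrix.PosSemidef.of_dotProduct_mulVec_nonneg ?_ fun t => ?_
  · ext i j
    simp only [Matrix.conjTranspose_apply, star_trivial, kMat, Matrix.of_apply]
    congr 1
    · simp only [mul_comm (score f θ₀ _ j)]
    · ring
  · refine nonneg_of_mul_nonneg_right (a := (1 + β) ^ 2) ?_ hc
    have hi : ∀ i j, Integrable (fun x => (t i * t j) * (objectiveGrad μ f β θ₀ x i *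
        objectiveGrad μ f β θ₀ x j)) (modelLaw μ f θ₀) := fun i j =>
      ((hLB.memLp_objectiveGrad hf hβ i).integrable_mul
        (hLB.memLp_objectiveGrad hf hβ j)).const_mul _
    have : (1 + β) ^ 2 * (star t ⬝ᵥ kMat μ f β θ₀ *ᵥ t) =
        ∫ x, (∑ i, t i * objectiveGrad μ f β θ₀ x i) ^ 2 ∂modelLaw μ f θ₀ := by
      have he : ∀ x, (∑ i, t i * objectiveGrad μ f β θ₀ x i) ^ 2 = ∑ i, ∑ j,
          (t i * t j) * (objectiveGrad μ f β θ₀ x i * objectiveGrad μ f β θ₀ x j) := fun x => by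
        rw [pow_two, Finset.sum_mul_sum]
        exact Finset.sum_congr rfl fun i _ => Finset.sum_congr rfl fun j _ => by ring
      simp only [he]
      rw [integral_finsetSum _ fun i _ => integrable_finsetSum _ fun j _ => hi i j]
      simp only [dotProduct, mulVec, Finset.mul_sum, star_trivial]
      refine Finset.sum_congr rfl fun i _ => ?_
      rw [integral_finsetSum _ fun j _ => hi i j]
      refine Finset.sum_congr rfl fun j _ => ?_
      rw [integral_const_mul, hLB.integral_objectiveGrad_mul hf hβ]
      ring
    rw [this]
    exact integral_nonneg fun x => sq_nonneg _

end Score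

/-! ### Mean of the second derivative of the objective. -/

section Hessian

variable {𝒳 : Type*} [MeasurableSpace 𝒳] {μ : Measure 𝒳} {p : ℕ} {Θ U : Set (Param p)}
  {f : Param p → 𝒳 → ℝ} {β γ : ℝ} {θ₀ θ τ : Param p} {x : 𝒳}

omit [MeasurableSpace 𝒳] in
theorem IsRegularPoint.fderiv_fderiv_rpow (h : IsRegularPoint f U x) (hθ : θ ∈ U) (s : ℝ)
    (v w : Param p) :
    fderiv ℝ (fderiv ℝ fun τ => f τ x ^ s) θ v w =
      s * ((s - 1) * f θ x ^ (s - 1 - 1)) * fderiv ℝ (fun τ => f τ x) θ v *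
        fderiv ℝ (fun τ => f τ x) θ w +
      s * f θ x ^ (s - 1) * fderiv ℝ (fderiv ℝ fun τ => f τ x) θ v w :=
  h.fderiv_fderiv_comp hθ (hasDerivAt_rpow s) (hasDerivAt_const_mul_rpow s (s - 1)) v w

set_option maxSynthPendingDepth 5 in
theorem fderiv_fderiv_mul_const (F : Param p → ℝ) (a : ℝ) (θ : Param p) :
    fderiv ℝ (fderiv ℝ fun τ => F τ * a) θ = a • fderiv ℝ (fderiv ℝ F) θ := by
  have h1 : (fun τ => F τ * a) = a • F := by
    ext τ; simp [mul_comm]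
  have h2 : fderiv ℝ (a • F) = a • fderiv ℝ F := by
    ext1 τ
    rw [fderiv_const_smul_field]
  rw [h1, h2, fderiv_const_smul_field]
  rfl

/-- The second derivative of the objective function at the true parameter, by coordinates. -/
noncomputable def objectiveHess (μ : Measure 𝒳) (f : Param p → 𝒳 → ℝ) (β : ℝ) (θ₀ : Param p)
    (i j : Fin p) (x : 𝒳) : ℝ :=
  fderiv ℝ (fderiv ℝ fun θ => objective μ f β θ x) θ₀ (EuclideanSpace.single i 1)
    (EuclideanSpace.single j 1)

/-- Multiplied by f_θ₀ and integrated, the Hessian becomes the integral of ∂²f^{1+β} - (1+1/β) f_θ₀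
∂²f^β. At θ₀ the terms in ∂²f cancel and (1+β) u uᵀ f^{1+β} remains. -/
theorem LehmannBasu.objectiveHess_of_ne_zero (hLB : LehmannBasu μ Θ f β θ₀ U)
    (hf : IsParametricModel μ Θ f) (hβ0 : 0 ≤ β) (hβ : β ≠ 0) (i j : Fin p) :
    Integrable (objectiveHess μ f β θ₀ i j) (modelLaw μ f θ₀) ∧
    ∫ x, objectiveHess μ f β θ₀ i j x ∂modelLaw μ f θ₀ = (1 + β) * jMat μ f β θ₀ i j := by
  have hθ := hLB.subset hLB.mem
  set e : Fin p → Param p := fun i => EuclideanSpace.single i 1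
  set D : ℝ := fderiv ℝ (fderiv ℝ fun τ => ∫ x, f τ x ^ (1 + β) ∂μ) θ₀ (e i) (e j) with hD
  set c : 𝒳 → ℝ := fun x => fderiv ℝ (fderiv ℝ fun τ => f τ x ^ β * f θ₀ x) θ₀ (e i) (e j) with hc
  set b : 𝒳 → ℝ := fun x => fderiv ℝ (fderiv ℝ fun τ => f τ x ^ (1 + β)) θ₀ (e i) (e j) with hb
  have hcint : Integrable c μ := hLB.diff_cross.integrable_fderiv_fderiv (by norm_num) hLB.mem _ _
  have hbint : Integrable b μ := hLB.diff_power.integrable_fderiv_fderiv (by norm_num) hLB.mem _ _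
  have hDint : D = ∫ x, b x ∂μ := hLB.diff_power.fderiv_fderiv_apply (by norm_num) hLB.mem _ _
  have heq : (fun x => objectiveHess μ f β θ₀ i j x * f θ₀ x) =ᵐ[μ]
      fun x => D * f θ₀ x - (1 + 1 / β) * c x := by
    filter_upwards [hLB.ae_isRegularPoint_or hf] with x hx
    rcases hx with hx | hx
    · rw [objectiveHess, objective_of_ne_zero hβ,
        (hLB.diff_power.thriceDifferentiableOn.hasFDerivAt_fderiv_sub_const_mul hLB.isOpen
          (hx.thriceDifferentiableOn_rpow β) _ hLB.mem).fderiv, hc]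
      simp only [fderiv_fderiv_mul_const]
      simp only [_root_.sub_apply, _root_.smul_apply, smul_eq_mul]
      rw [hD]
      ring
    · simp only [hc, hx θ₀ hLB.mem, mul_zero]
      simp
  have hDf : Integrable (fun x => D * f θ₀ x) μ := (hf.integrable hθ).const_mul D
  have hcc : Integrable (fun x => (1 + 1 / β) * c x) μ := hcint.const_mul _
  rw [hf.integrable_modelLaw_iff hθ, hf.integral_modelLaw hθ]
  refine ⟨(hDf.sub hcc).congr heq.symm, ?_⟩
  rw [integral_congr_ae heq, integral_sub hDf hcc, integral_const_mul, hf.integral_eq_one _ hθ,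
    mul_one, hDint, ← integral_sub hbint hcc, jMat, Matrix.of_apply, ← integral_const_mul]
  refine integral_congr_ae ?_
  filter_upwards [hLB.ae_isRegularPoint_or hf] with x hx
  rcases hx with hx | hx
  · have hpos := hx.pos θ₀ hLB.mem
    simp only [hb, hc, fderiv_fderiv_mul_const]
    simp only [_root_.smul_apply, smul_eq_mul]
    rw [hx.fderiv_fderiv_rpow hLB.mem, hx.fderiv_fderiv_rpow hLB.mem,
      hx.fderiv_eq_score_mul hLB.mem, hx.fderiv_eq_score_mul hLB.mem,
      show 1 + β - 1 - 1 = β - 1 by ring, show 1 + β - 1 = β by ring,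
      show f θ₀ x ^ (1 + β) = f θ₀ x * f θ₀ x ^ β by rw [Real.rpow_add hpos, Real.rpow_one],
      show f θ₀ x ^ (β - 1) = f θ₀ x ^ β / f θ₀ x by rw [Real.rpow_sub hpos, Real.rpow_one],
      show f θ₀ x ^ (β - 1 - 1) = f θ₀ x ^ β / f θ₀ x / f θ₀ x by
        rw [Real.rpow_sub hpos, Real.rpow_sub hpos, Real.rpow_one]]
    field_simp
    ring
  · simp only [hb, hc, fderiv_fderiv_mul_const, hx θ₀ hLB.mem,
      fderiv_fderiv_comp_eq_zero_of_forall_eq_zero hLB.isOpen hx hLB.mem (fun y => y ^ (1 + β))]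
    simp [Real.zero_rpow (show 1 + β ≠ 0 by positivity)]

/-- The information identity: -f ∂²log f = u uᵀ f - ∂²f, and ∂²f integrates to zero because the
total mass is constant. -/
theorem LehmannBasu.objectiveHess_of_eq_zero (hLB : LehmannBasu μ Θ f β θ₀ U)
    (hf : IsParametricModel μ Θ f) (hβ : β = 0) (i j : Fin p) :
    Integrable (objectiveHess μ f β θ₀ i j) (modelLaw μ f θ₀) ∧
    ∫ x, objectiveHess μ f β θ₀ i j x ∂modelLaw μ f θ₀ = (1 + β) * jMat μ f β θ₀ i j := by
  have hθ := hLB.subset hLB.mem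
  set e : Fin p → Param p := fun i => EuclideanSpace.single i 1
  set b : 𝒳 → ℝ := fun x => fderiv ℝ (fderiv ℝ fun τ => f τ x ^ (1 + β)) θ₀ (e i) (e j) with hb
  have hbint : Integrable b μ := hLB.diff_power.integrable_fderiv_fderiv (by norm_num) hLB.mem _ _
  have hb0 : ∫ x, b x ∂μ = 0 := by
    rw [← hLB.diff_power.fderiv_fderiv_apply (by norm_num) hLB.mem]
    have : (fderiv ℝ fun τ => ∫ x, f τ x ^ (1 + β) ∂μ) =ᶠ[𝓝 θ₀] fun _ => 0 := by
      filter_upwards [hLB.isOpen.mem_nhds hLB.mem] with τ hτ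
      rw [(hLB.integral_rpow_eventuallyEq_one hf hβ hτ).fderiv_eq]
      simp
    rw [this.fderiv_eq]
    simp
  set a : 𝒳 → ℝ := fun x => score f θ₀ x i * score f θ₀ x j * f θ₀ x ^ (1 + β) with ha
  -- For β = 0 the integrands of J and K coincide, so the moment condition on K gives integrability.
  have haint : Integrable a μ := by
    have h1 : Integrable (fun x => (score f θ₀ x i * f θ₀ x ^ β) * (score f θ₀ x j * f θ₀ x ^ β))
        (modelLaw μ f θ₀) :=
      (hLB.memLp_score_rpow hf hβ.ge i).integrable_mul (hLB.memLp_score_rpow hf hβ.ge j)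
    rw [hf.integrable_modelLaw_iff hθ] at h1
    refine h1.congr (ae_of_all _ fun x => ?_)
    simp [ha, hβ]
  have heq : (fun x => objectiveHess μ f β θ₀ i j x * f θ₀ x) =ᵐ[μ] fun x => a x - b x := by
    filter_upwards [hLB.ae_isRegularPoint_or hf] with x hx
    rcases hx with hx | hx
    · have hpos := hx.pos θ₀ hLB.mem
      rw [objectiveHess, objective_of_eq_zero hβ,
        hx.fderiv_fderiv_comp hLB.mem (g := fun y => -Real.log y) (g₁ := fun y => -y⁻¹)
          (g₂ := fun y => (y ^ 2)⁻¹) (fun y hy => (Real.hasDerivAt_log hy.ne').neg)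
          (fun y hy => by simpa using (hasDerivAt_inv hy.ne').fun_neg)]
      simp only [ha, hb, hβ, add_zero, Real.rpow_one]
      rw [hx.fderiv_eq_score_mul hLB.mem, hx.fderiv_eq_score_mul hLB.mem]
      field_simp
      ring
    · simp only [hb, ha, hx θ₀ hLB.mem,
        fderiv_fderiv_comp_eq_zero_of_forall_eq_zero hLB.isOpen hx hLB.mem (fun y => y ^ (1 + β))]
      simp [hβ]
  rw [hf.integrable_modelLaw_iff hθ, hf.integral_modelLaw hθ]
  refine ⟨(haint.sub hbint).congr heq.symm, ?_⟩
  rw [integral_congr_ae heq, integral_sub haint hbint, hb0, sub_zero, hβ]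
  simp [jMat, ha, hβ]

/-- The second derivative of the objective function has mean `(1 + β) J_β`. -/
theorem LehmannBasu.integral_objectiveHess (hLB : LehmannBasu μ Θ f β θ₀ U)
    (hf : IsParametricModel μ Θ f) (hβ : 0 ≤ β) (i j : Fin p) :
    Integrable (objectiveHess μ f β θ₀ i j) (modelLaw μ f θ₀) ∧
    ∫ x, objectiveHess μ f β θ₀ i j x ∂modelLaw μ f θ₀ = (1 + β) * jMat μ f β θ₀ i j := by
  rcases eq_or_ne β 0 with h | h
  · exact hLB.objectiveHess_of_eq_zero hf h i j
  · exact hLB.objectiveHess_of_ne_zero hf hβ h i j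

end Hessian

/-! ### The divergence and its first two derivatives on the diagonal. -/

section Divergence

variable {𝒳 : Type*} [MeasurableSpace 𝒳] {μ : Measure 𝒳} {p : ℕ} {Θ U : Set (Param p)}
  {f : Param p → 𝒳 → ℝ} {β γ : ℝ} {θ₀ θ τ : Param p} {x : 𝒳}

/-- The derivative of the divergence integrand in its first argument. -/
noncomputable def dpdIntegrandDeriv (γ y h : ℝ) : ℝ :=
  if γ = 0 then Real.log (h / y) + 1 else (1 + 1 / γ) * (h ^ γ - y ^ γ)

theorem hasDerivAt_dpdIntegrand {y : ℝ} (hy : 0 < y) (h : ℝ) (hh : 0 < h) :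
    HasDerivAt (fun h => dpdIntegrand γ h y) (dpdIntegrandDeriv γ y h) h := by
  rcases eq_or_ne γ 0 with h0 | h0
  · simp only [dpdIntegrand, dpdIntegrandDeriv, if_pos h0]
    have h1 : HasDerivAt (fun h : ℝ => h / y) (1 / y) h := (hasDerivAt_id h).div_const y
    have h2 := h1.log (div_pos hh hy).ne'
    have h3 := (hasDerivAt_id h).mul h2
    convert! h3 using 1
    simp
    field_simp
  · simp only [dpdIntegrand, dpdIntegrandDeriv, if_neg h0]
    have h1 : HasDerivAt (fun h : ℝ => (1 + 1 / γ) * y ^ γ * h) ((1 + 1 / γ) * y ^ γ) h := by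
      simpa using (hasDerivAt_id h).const_mul ((1 + 1 / γ) * y ^ γ)
    have h2 := (hasDerivAt_rpow (1 + γ) h hh).const_mul (1 / γ)
    convert! (h1.const_sub (y ^ (1 + γ))).add h2 using 1
    rw [show 1 + γ - 1 = γ by ring]
    field_simp
    ring

/-- The second derivative in the first density does not involve the second one, and γ = 0 needs no
separate formula; it is the weight in A_γ. -/
theorem hasDerivAt_dpdIntegrandDeriv {y : ℝ} (hy : 0 < y) (h : ℝ) (hh : 0 < h) :
    HasDerivAt (dpdIntegrandDeriv γ y) ((1 + γ) * h ^ (γ - 1)) h := by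
  unfold dpdIntegrandDeriv
  rcases eq_or_ne γ 0 with h0 | h0
  · simp only [if_pos h0]
    have h1 : HasDerivAt (fun h : ℝ => h / y) (1 / y) h := (hasDerivAt_id h).div_const y
    have h2 := (h1.log (div_pos hh hy).ne').add_const 1
    convert! h2 using 1
    rw [h0, zero_sub, Real.rpow_neg_one]
    field_simp
    ring
  · simp only [if_neg h0]
    convert! ((hasDerivAt_rpow γ h hh).sub_const (y ^ γ)).const_mul (1 + 1 / γ) using 1
    field_simp
    ring

theorem dpdIntegrand_self (hγ : 0 ≤ γ) {y : ℝ} (hy : 0 ≤ y) : dpdIntegrand γ y y = 0 := by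
  rcases eq_or_ne γ 0 with h0 | h0
  · rcases eq_or_ne y 0 with hy0 | hy0
    · simp [dpdIntegrand, h0, hy0]
    · simp [dpdIntegrand, h0, hy0]
  · rw [dpdIntegrand, if_neg h0, mul_assoc, ← Real.rpow_add_one' hy (by positivity), add_comm γ]
    ring

theorem dpd_self (hf : IsParametricModel μ Θ f) (hγ : 0 ≤ γ) (hθ : θ ∈ Θ) :
    dpd μ γ (f θ) (f θ) = 0 := by
  simp [dpd, dpdIntegrand_self hγ (hf.nonneg θ hθ _)]

/-- For γ = 0 the integrand h log(h/f) has slope 1, not 0, at h = f; conservation of mass removes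
that contribution after integration. -/
theorem DivergenceRegular.integral_fderiv_rpow_eq_zero (hreg : DivergenceRegular μ f γ U)
    (hLB : LehmannBasu μ Θ f β θ₀ U) (hf : IsParametricModel μ Θ f) (hγ : γ = 0) (hτ : τ ∈ U)
    (v : Param p) :
    ∫ x, fderiv ℝ (fun θ => f θ x) τ v ∂μ = 0 := by
  have h := hreg.diff_power.fderiv_apply (by norm_num) hτ v
  have h1 : (fun θ => ∫ x, f θ x ^ (1 + γ) ∂μ) =ᶠ[𝓝 τ] fun _ => 1 := by
    filter_upwards [hLB.isOpen.mem_nhds hτ] with θ hθ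
    simpa [hγ] using hf.integral_eq_one θ (hLB.subset hθ)
  rw [h1.fderiv_eq] at h
  simpa [hγ] using h.symm

theorem DivergenceRegular.integral_fderiv_fderiv_rpow_eq_zero (hreg : DivergenceRegular μ f γ U)
    (hLB : LehmannBasu μ Θ f β θ₀ U) (hf : IsParametricModel μ Θ f) (hγ : γ = 0) (hτ : τ ∈ U)
    (v w : Param p) :
    Integrable (fun x => fderiv ℝ (fderiv ℝ fun θ => f θ x) τ v w) μ ∧
    ∫ x, fderiv ℝ (fderiv ℝ fun θ => f θ x) τ v w ∂μ = 0 := by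
  have hi := hreg.diff_power.integrable_fderiv_fderiv le_rfl hτ v w
  have h := hreg.diff_power.fderiv_fderiv_apply le_rfl hτ v w
  have h1 : (fderiv ℝ fun θ => ∫ x, f θ x ^ (1 + γ) ∂μ) =ᶠ[𝓝 τ] fun _ => 0 := by
    filter_upwards [hLB.isOpen.mem_nhds hτ] with τ' hτ'
    have h2 : (fun θ => ∫ x, f θ x ^ (1 + γ) ∂μ) =ᶠ[𝓝 τ'] fun _ => 1 := by
      filter_upwards [hLB.isOpen.mem_nhds hτ'] with θ hθ
      simpa [hγ] using hf.integral_eq_one θ (hLB.subset hθ)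
    rw [h2.fderiv_eq]
    simp
  rw [h1.fderiv_eq] at h
  refine ⟨by simpa [hγ] using hi, by simpa [hγ] using h.symm⟩

/-- The divergence `d_γ(f_θ, f_τ)` is stationary in `θ` at `θ = τ`. -/
theorem DivergenceRegular.fderiv_dpd_self (hreg : DivergenceRegular μ f γ U)
    (hLB : LehmannBasu μ Θ f β θ₀ U) (hf : IsParametricModel μ Θ f) (hτ : τ ∈ U) :
    fderiv ℝ (fun θ => dpd μ γ (f θ) (f τ)) τ = 0 := by
  ext1 v
  have h := (hreg.diff_dpd τ hτ).fderiv_apply (by norm_num) hτ v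
  refine h.trans ?_
  -- The indicator is the slope of the integrand on the diagonal: 1 for γ = 0 and 0 otherwise.
  have heq : (fun x => fderiv ℝ (fun θ => dpdIntegrand γ (f θ x) (f τ x)) τ v) =ᵐ[μ]
      fun x => (if γ = 0 then 1 else 0) * fderiv ℝ (fun θ => f θ x) τ v := by
    filter_upwards [hLB.ae_isRegularPoint_or hf] with x hx
    rcases hx with hx | hx
    · have hpos := hx.pos τ hτ
      rw [hx.fderiv_comp hτ (hasDerivAt_dpdIntegrand hpos), dpdIntegrandDeriv]
      split_ifs
      · simp [hpos.ne']
      · simp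
    · rw [fderiv_comp_eq_zero_of_forall_eq_zero hLB.isOpen hx hτ
          (fun y => dpdIntegrand γ y (f τ x)),
        fderiv_comp_eq_zero_of_forall_eq_zero hLB.isOpen hx hτ (fun y => y)]
      simp
  rw [integral_congr_ae heq]
  split_ifs with h0
  · simpa using hreg.integral_fderiv_rpow_eq_zero hLB hf h0 hτ v
  · simp

/-- The second derivative of `d_γ(f_θ, f_τ)` in `θ` at `θ = τ = θ₀` is `A_γ(θ₀)`. -/
theorem DivergenceRegular.fderiv_fderiv_dpd_self (hreg : DivergenceRegular μ f γ U)
    (hLB : LehmannBasu μ Θ f β θ₀ U) (hf : IsParametricModel μ Θ f) (i j : Fin p) :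
    fderiv ℝ (fderiv ℝ fun θ => dpd μ γ (f θ) (f θ₀)) θ₀ (EuclideanSpace.single i 1)
      (EuclideanSpace.single j 1) = aMat μ f γ θ₀ i j := by
  set v : Param p := EuclideanSpace.single i 1
  set w : Param p := EuclideanSpace.single j 1
  have hU := hLB.mem
  have h := (hreg.diff_dpd θ₀ hU).fderiv_fderiv_apply le_rfl hU v w
  have hint := (hreg.diff_dpd θ₀ hU).integrable_fderiv_fderiv le_rfl hU v w
  refine h.trans ?_
  set a : 𝒳 → ℝ := fun x => (1 + γ) * (f θ₀ x ^ (γ - 1) * partialDeriv (fun τ => f τ x) θ₀ j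
    * partialDeriv (fun τ => f τ x) θ₀ i) with ha
  -- The slope times ∂²f: it is present only for γ = 0, where it integrates to zero.
  set b : 𝒳 → ℝ := fun x => (if γ = 0 then 1 else 0) * fderiv ℝ (fderiv ℝ fun θ => f θ x) θ₀ v w
    with hb
  have heq : (fun x => fderiv ℝ (fderiv ℝ fun θ => dpdIntegrand γ (f θ x) (f θ₀ x)) θ₀ v w) =ᵐ[μ]
      fun x => a x + b x := by
    filter_upwards [hLB.ae_isRegularPoint_or hf] with x hx
    rcases hx with hx | hx
    · have hpos := hx.pos θ₀ hU
      rw [hx.fderiv_fderiv_comp hU (hasDerivAt_dpdIntegrand hpos)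
        (hasDerivAt_dpdIntegrandDeriv hpos)]
      simp only [ha, hb, partialDeriv, dpdIntegrandDeriv]
      congr 1
      · ring
      · congr 1
        split_ifs
        · simp [hpos.ne']
        · simp
    · simp only [ha, hb, partialDeriv]
      rw [fderiv_fderiv_comp_eq_zero_of_forall_eq_zero hLB.isOpen hx hU
          (fun y => dpdIntegrand γ y (f θ₀ x)),
        fderiv_fderiv_comp_eq_zero_of_forall_eq_zero hLB.isOpen hx hU (fun y => y),
        fderiv_comp_eq_zero_of_forall_eq_zero hLB.isOpen hx hU (fun y => y)]
      simp
  have hbint : Integrable b μ ∧ ∫ x, b x ∂μ = 0 := by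
    by_cases h0 : γ = 0
    · simpa [hb, h0] using hreg.integral_fderiv_fderiv_rpow_eq_zero hLB hf h0 hU v w
    · simp [hb, h0]
  -- No moment condition on A is assumed: integrability is inherited from the second derivative of
  -- the divergence integrand.
  have haint : Integrable a μ := by
    refine ((hint.congr heq).sub hbint.1).congr (ae_of_all _ fun x => ?_)
    simp
  rw [integral_congr_ae heq, integral_add haint hbint.1, hbint.2, add_zero, aMat, Matrix.of_apply,
    ← integral_const_mul]

theorem transpose_aMat : (aMat μ f γ θ)ᵀ = aMat μ f γ θ := by
  ext i j
  simp only [Matrix.transpose_apply, aMat, Matrix.of_apply, mul_right_comm _ (partialDeriv _ θ i)]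

end Divergence

/-! ### Taylor estimates from the mean value inequality. -/

section Taylor

variable {E F : Type*} [NormedAddCommGroup E] [NormedSpace ℝ E] [NormedAddCommGroup F]
  [NormedSpace ℝ F]

-- The mean value inequality twice: the first derivative varies by at most Mρ on the ball, which
-- bounds the linearization error of `g`.
set_option maxSynthPendingDepth 5 in
theorem norm_sub_sub_fderiv_le_of_norm_fderiv_fderiv_le {g : E → F} {θ₀ : E} {ρ M : ℝ}
    (hg : ∀ θ ∈ Metric.ball θ₀ ρ, DifferentiableAt ℝ g θ)
    (hg₁ : ∀ θ ∈ Metric.ball θ₀ ρ, DifferentiableAt ℝ (fderiv ℝ g) θ)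
    (hM : ∀ θ ∈ Metric.ball θ₀ ρ, ‖fderiv ℝ (fderiv ℝ g) θ‖ ≤ M) {θ : E}
    (hθ : θ ∈ Metric.ball θ₀ ρ) :
    ‖g θ - g θ₀ - fderiv ℝ g θ₀ (θ - θ₀)‖ ≤ M * ρ * ‖θ - θ₀‖ := by
  have hρ0 : 0 < ρ := Metric.pos_of_mem_ball hθ
  have h0 : θ₀ ∈ Metric.ball θ₀ ρ := Metric.mem_ball_self hρ0
  have hM0 : 0 ≤ M := (norm_nonneg _).trans (hM θ₀ h0)
  have hconv := convex_ball θ₀ ρ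
  refine hconv.norm_image_sub_le_of_norm_fderiv_le' (𝕜 := ℝ) hg (fun τ hτ => ?_) h0 hθ
  refine (hconv.norm_image_sub_le_of_norm_fderiv_le (𝕜 := ℝ) hg₁ hM h0 hτ).trans
    (mul_le_mul_of_nonneg_left ?_ hM0)
  rw [← dist_eq_norm]
  exact (Metric.mem_ball.1 hτ).le

set_option maxSynthPendingDepth 5 in
theorem norm_fderiv_sub_le_of_norm_iteratedFDeriv_le {φ : E → ℝ} {U : Set E}
    (hφ : ThriceDifferentiableOn φ U) {θ₀ : E} {ρ : ℝ} (hρ : Metric.ball θ₀ ρ ⊆ U) {M : ℝ}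
    (hM : ∀ θ ∈ U, ‖iteratedFDeriv ℝ 3 φ θ‖ ≤ M) {θ : E} (hθ : θ ∈ Metric.ball θ₀ ρ) :
    ‖fderiv ℝ φ θ - fderiv ℝ φ θ₀ - fderiv ℝ (fderiv ℝ φ) θ₀ (θ - θ₀)‖ ≤ M * ρ * ‖θ - θ₀‖ :=
  norm_sub_sub_fderiv_le_of_norm_fderiv_fderiv_le
    (fun τ hτ => hφ.differentiableAt_fderiv τ (hρ hτ))
    (fun τ hτ => hφ.differentiableAt_fderiv_fderiv τ (hρ hτ))
    (fun τ hτ => (norm_fderiv_fderiv_fderiv φ τ).trans_le (hM τ (hρ hτ))) hθ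

/-- A second order Taylor estimate from a first order expansion of the derivative. -/
theorem abs_sub_le_of_norm_fderiv_sub_le {φ : E → ℝ} {θ₀ : E} {ρ ε : ℝ}
    (hφ : ∀ θ ∈ Metric.ball θ₀ ρ, DifferentiableAt ℝ φ θ) {z : E →L[ℝ] ℝ} {J : E →L[ℝ] E →L[ℝ] ℝ}
    (hJ : ∀ v w, J v w = J w v) (hε : 0 ≤ ε)
    (h : ∀ θ ∈ Metric.ball θ₀ ρ, ‖fderiv ℝ φ θ - (z + J (θ - θ₀))‖ ≤ ε * ‖θ - θ₀‖)
    {θ : E} (hθ : θ ∈ Metric.ball θ₀ ρ) :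
    |φ θ - φ θ₀ - (z (θ - θ₀) + 1 / 2 * J (θ - θ₀) (θ - θ₀))| ≤ ε * ‖θ - θ₀‖ ^ 2 := by
  -- On the closed ball of radius ‖θ-θ₀‖ the derivative of the remainder is at most ε‖θ-θ₀‖; the
  -- mean value inequality contributes the second factor.
  have hsub : Metric.closedBall θ₀ ‖θ - θ₀‖ ⊆ Metric.ball θ₀ ρ :=
    Metric.closedBall_subset_ball (by rwa [← dist_eq_norm])
  set ψ : E → ℝ := fun τ => φ τ - (z (τ - θ₀) + 1 / 2 * J (τ - θ₀) (τ - θ₀)) with hψ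
  have hder : ∀ τ ∈ Metric.closedBall θ₀ ‖θ - θ₀‖,
      HasFDerivWithinAt ψ (fderiv ℝ φ τ - (z + J (τ - θ₀))) (Metric.closedBall θ₀ ‖θ - θ₀‖) τ := by
    intro τ hτ
    have hid : HasFDerivAt (fun τ : E => τ - θ₀) (ContinuousLinearMap.id ℝ E) τ :=
      (hasFDerivAt_id τ).sub_const θ₀
    have hz : HasFDerivAt (fun τ : E => z (τ - θ₀)) z τ := z.hasFDerivAt.comp τ hid
    have hJ1 : HasFDerivAt (fun τ : E => J (τ - θ₀)) J τ := J.hasFDerivAt.comp τ hid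
    have hJ2 := (hJ1.clm_apply hid).const_mul (1 / 2)
    have := (hφ τ (hsub hτ)).hasFDerivAt.sub (hz.add hJ2)
    refine (this.congr_fderiv ?_).hasFDerivWithinAt
    ext v
    simp only [_root_.sub_apply, _root_.add_apply, _root_.smul_apply, smul_eq_mul,
      ContinuousLinearMap.comp_apply, ContinuousLinearMap.flip_apply, ContinuousLinearMap.id_apply]
    rw [hJ v]
    ring
  have hmv := (convex_closedBall θ₀ ‖θ - θ₀‖).norm_image_sub_le_of_norm_hasFDerivWithin_le
    (C := ε * ‖θ - θ₀‖) hder (fun τ hτ => (h τ (hsub hτ)).trans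
      (mul_le_mul_of_nonneg_left (by rw [← dist_eq_norm]; exact hτ) hε))
    (Metric.mem_closedBall_self (norm_nonneg _))
    (Metric.mem_closedBall.2 (dist_eq_norm θ θ₀).le)
  have e : ψ θ - ψ θ₀ = φ θ - φ θ₀ - (z (θ - θ₀) + 1 / 2 * J (θ - θ₀) (θ - θ₀)) := by
    simp only [hψ, sub_self, map_zero, mul_zero, add_zero, sub_zero]
    ring
  rw [← e, ← Real.norm_eq_abs, pow_two, ← mul_assoc]
  exact hmv

end Taylor

/-! ### Matrices as operators and bilinear forms. -/

section BilinearForms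

variable {p : ℕ}

/-- The continuous linear operator of a square matrix. -/
noncomputable abbrev matOp (M : Matrix (Fin p) (Fin p) ℝ) : Param p →L[ℝ] Param p :=
  Matrix.toEuclideanCLM (𝕜 := ℝ) M

theorem matOp_apply (M : Matrix (Fin p) (Fin p) ℝ) (v : Param p) :
    matOp M v = WithLp.toLp 2 (M *ᵥ v.ofLp) := rfl

theorem inner_matOp (M : Matrix (Fin p) (Fin p) ℝ) (v w : Param p) :
    inner ℝ (matOp M v) w = w.ofLp ⬝ᵥ M *ᵥ v.ofLp := by
  rw [EuclideanSpace.inner_eq_star_dotProduct, matOp_apply]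
  simp

theorem inner_matOp_comm {M : Matrix (Fin p) (Fin p) ℝ} (hM : Mᵀ = M) (v w : Param p) :
    inner ℝ (matOp M v) w = inner ℝ (matOp M w) v := by
  rw [inner_matOp, inner_matOp, Matrix.dotProduct_mulVec, ← Matrix.mulVec_transpose, hM,
    dotProduct_comm]

/-- The bilinear form of a square matrix. -/
noncomputable def matForm (M : Matrix (Fin p) (Fin p) ℝ) : Param p →L[ℝ] Param p →L[ℝ] ℝ :=
  (innerSL ℝ).comp (matOp M)

theorem matForm_apply (M : Matrix (Fin p) (Fin p) ℝ) (v w : Param p) :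
    matForm M v w = inner ℝ (matOp M v) w := rfl

theorem matForm_single (M : Matrix (Fin p) (Fin p) ℝ) (i j : Fin p) :
    matForm M (EuclideanSpace.single i 1) (EuclideanSpace.single j 1) = M j i := by
  rw [matForm_apply, inner_matOp]
  simp

theorem bilinear_apply_eq_sum (T : Param p →L[ℝ] Param p →L[ℝ] ℝ) (v w : Param p) :
    T v w = ∑ i, ∑ j, T (EuclideanSpace.single i 1) (EuclideanSpace.single j 1) * (v i * w j) := by
  have hv : ∀ v : Param p, v = ∑ i, v i • EuclideanSpace.single i (1 : ℝ) := fun v => by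
    ext k
    simp [Finset.sum_apply, Pi.single_apply]
  conv_lhs => rw [hv v, hv w]
  simp only [map_sum, map_smul, _root_.sum_apply, _root_.smul_apply, smul_eq_mul,
    Finset.mul_sum]
  rw [Finset.sum_comm]
  exact Finset.sum_congr rfl fun i _ => Finset.sum_congr rfl fun j _ => by ring

-- A bilinear form is a finite combination of fixed rank-one forms with its matrix entries as
-- coefficients, so entrywise convergence is convergence in norm.
set_option maxSynthPendingDepth 5 in
theorem tendsto_bilinear_of_tendsto_single {ι : Type*} {l : Filter ι} {T : ι → Param p →L[ℝ] Param p →L[ℝ] ℝ}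
    {T₀ : Param p →L[ℝ] Param p →L[ℝ] ℝ}
    (h : ∀ i j, Tendsto (fun q => T q (EuclideanSpace.single i 1) (EuclideanSpace.single j 1)) l
      (𝓝 (T₀ (EuclideanSpace.single i 1) (EuclideanSpace.single j 1)))) :
    Tendsto T l (𝓝 T₀) := by
  let e : Fin p → Fin p → Param p →L[ℝ] Param p →L[ℝ] ℝ := fun i j =>
    (EuclideanSpace.proj i : Param p →L[ℝ] ℝ).smulRight (EuclideanSpace.proj j : Param p →L[ℝ] ℝ)
  have he : ∀ S : Param p →L[ℝ] Param p →L[ℝ] ℝ, S = ∑ i, ∑ j,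
      S (EuclideanSpace.single i 1) (EuclideanSpace.single j 1) • e i j := fun S => by
    ext v w
    rw [bilinear_apply_eq_sum S v w]
    simp [e, _root_.sum_apply]
  rw [he T₀, show T = fun q => ∑ i, ∑ j,
    T q (EuclideanSpace.single i 1) (EuclideanSpace.single j 1) • e i j from funext fun q => he _]
  exact tendsto_finsetSum _ fun i _ => tendsto_finsetSum _ fun j _ => (h i j).smul_const _

end BilinearForms

/-! ### Differentiability and critical points of the empirical objective. -/

section EmpiricalObjective

variable {𝒳 : Type*} [MeasurableSpace 𝒳] {μ : Measure 𝒳} {p : ℕ} {Θ U : Set (Param p)}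
  {f : Param p → 𝒳 → ℝ} {β : ℝ} {θ₀ θ : Param p}

theorem clm_ext_single {F : Type*} [NormedAddCommGroup F] [NormedSpace ℝ F]
    {a b : Param p →L[ℝ] F}
    (h : ∀ i, a (EuclideanSpace.single i 1) = b (EuclideanSpace.single i 1)) : a = b := by
  ext v
  have hv : v = ∑ i, v i • EuclideanSpace.single i (1 : ℝ) := by
    ext k
    simp [Finset.sum_apply, Pi.single_apply]
  rw [hv]
  simp only [map_sum, map_smul, h]

theorem IsRegularPoint.fderiv_objective_eq_innerSL {x : 𝒳} (h : IsRegularPoint f U x)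
    (hLB : LehmannBasu μ Θ f β θ₀ U) (hf : IsParametricModel μ Θ f) :
    fderiv ℝ (fun θ => objective μ f β θ x) θ₀ = innerSL ℝ (objectiveGrad μ f β θ₀ x) := by
  refine clm_ext_single fun i => ?_
  rw [h.fderiv_objective hLB hf hLB.mem]
  simp [objectiveGrad, EuclideanSpace.inner_single_right]

variable {n : ℕ} {x : Fin n → 𝒳}

theorem hasFDerivAt_empObjective (hLB : LehmannBasu μ Θ f β θ₀ U)
    (hx : ∀ i, IsRegularPoint f U (x i)) (hθ : θ ∈ U) :
    HasFDerivAt (empObjective μ f β x)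
      ((n : ℝ)⁻¹ • ∑ i, fderiv ℝ (fun θ => objective μ f β θ (x i)) θ) θ :=
  (HasFDerivAt.fun_sum fun i _ =>
    (((hx i).thriceDifferentiableOn_objective hLB).differentiableAt θ hθ).hasFDerivAt).const_mul _

theorem hasFDerivAt_fderiv_empObjective (hLB : LehmannBasu μ Θ f β θ₀ U)
    (hx : ∀ i, IsRegularPoint f U (x i)) (hθ : θ ∈ U) :
    HasFDerivAt (fderiv ℝ (empObjective μ f β x))
      ((n : ℝ)⁻¹ • ∑ i, fderiv ℝ (fderiv ℝ fun θ => objective μ f β θ (x i)) θ) θ := by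
  have heq : fderiv ℝ (empObjective μ f β x) =ᶠ[𝓝 θ]
      fun θ => (n : ℝ)⁻¹ • ∑ i, fderiv ℝ (fun θ => objective μ f β θ (x i)) θ := by
    filter_upwards [hLB.isOpen.mem_nhds hθ] with τ hτ
      using (hasFDerivAt_empObjective hLB hx hτ).fderiv
  refine HasFDerivAt.congr_of_eventuallyEq ?_ heq
  exact (HasFDerivAt.fun_sum fun i _ =>
    (((hx i).thriceDifferentiableOn_objective hLB).differentiableAt_fderiv
      θ hθ).hasFDerivAt).const_smul (n : ℝ)⁻¹

/-- Strictness, needed for Lagrange multipliers, follows from continuity of the derivative, which is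
itself differentiable. -/
theorem hasStrictFDerivAt_empObjective (hLB : LehmannBasu μ Θ f β θ₀ U)
    (hx : ∀ i, IsRegularPoint f U (x i)) (hθ : θ ∈ U) :
    HasStrictFDerivAt (empObjective μ f β x) (fderiv ℝ (empObjective μ f β x) θ) θ := by
  refine hasStrictFDerivAt_of_hasFDerivAt_of_continuousAt ?_
    (hasFDerivAt_fderiv_empObjective hLB hx hθ).continuousAt
  filter_upwards [hLB.isOpen.mem_nhds hθ] with τ hτ
  exact (hasFDerivAt_empObjective hLB hx hτ).differentiableAt.hasFDerivAt

theorem fderiv_empObjective_single (hLB : LehmannBasu μ Θ f β θ₀ U)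
    (hf : IsParametricModel μ Θ f) (hx : ∀ i, IsRegularPoint f U (x i)) (hn : n ≠ 0) (hθ : θ ∈ U)
    (j : Fin p) :
    fderiv ℝ (empObjective μ f β x) θ (EuclideanSpace.single j 1) =
      -(1 + β) * ((n : ℝ)⁻¹ * ∑ i, score f θ (x i) j * f θ (x i) ^ β - xiVec μ f β θ j) := by
  rw [(hasFDerivAt_empObjective hLB hx hθ).fderiv]
  simp only [_root_.smul_apply, _root_.sum_apply, smul_eq_mul]
  rw [Finset.sum_congr rfl fun i _ => (hx i).fderiv_objective hLB hf hθ j, ← Finset.mul_sum,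
    Finset.sum_sub_distrib]
  have hn' : (n : ℝ) ≠ 0 := Nat.cast_ne_zero.2 hn
  simp only [Finset.sum_const, Finset.card_univ, Fintype.card_fin, nsmul_eq_mul]
  field_simp
  ring

/-- The roots of the estimating equation are the critical points of the empirical objective
function. -/
theorem isEstimatingRoot_iff_fderiv_eq_zero (hLB : LehmannBasu μ Θ f β θ₀ U)
    (hf : IsParametricModel μ Θ f) (hβ : 0 ≤ β) (hx : ∀ i, IsRegularPoint f U (x i)) (hn : n ≠ 0)
    (hθ : θ ∈ U) : IsEstimatingRoot μ Θ f β x θ ↔ fderiv ℝ (empObjective μ f β x) θ = 0 := by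
  have hc : -(1 + β) ≠ 0 := by
    have : 0 < 1 + β := by positivity
    exact neg_ne_zero.2 this.ne'
  constructor
  · rintro ⟨-, h⟩
    refine clm_ext_single fun j => ?_
    rw [fderiv_empObjective_single hLB hf hx hn hθ]
    have := h j
    rw [_root_.zero_apply]
    exact mul_eq_zero_of_right _ this
  · refine fun h => ⟨hLB.subset hθ, fun j => ?_⟩
    have h1 := fderiv_empObjective_single hLB hf hx hn hθ j
    rw [h, _root_.zero_apply] at h1
    exact (mul_eq_zero.1 h1.symm).resolve_left hc

end EmpiricalObjective

/-! ### Stochastic expansion of the gradient near the true parameter. -/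

section Expansion

variable {𝒳 Ω : Type*} [MeasurableSpace 𝒳] {μ : Measure 𝒳} {p : ℕ} {Θ U : Set (Param p)}
  {f : Param p → 𝒳 → ℝ} {β : ℝ} {θ₀ θ : Param p}
  [MeasurableSpace Ω] {P : Measure Ω} {X : ℕ → Ω → 𝒳}

theorem IsRandomSample.eventually_isRegularPoint (hX : IsRandomSample P X (modelLaw μ f θ₀))
    (hLB : LehmannBasu μ Θ f β θ₀ U) (hf : IsParametricModel μ Θ f) :
    ∀ᶠ q in probFilter P, ∀ i, IsRegularPoint f U (sample X q.1 q.2 i) := by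
  refine eventually_probFilter_of_ae ?_
  filter_upwards [hX.ae_forall (hLB.ae_isRegularPoint hf)] with ω hω n i using hω i

/-- The mean of the second derivatives converges to `(1 + β) J_β`. -/
theorem IsRandomSample.tendsto_mean_hess [IsProbabilityMeasure P]
    (hX : IsRandomSample P X (modelLaw μ f θ₀)) (hLB : LehmannBasu μ Θ f β θ₀ U)
    (hf : IsParametricModel μ Θ f) (hβ : 0 ≤ β) :
    Tendsto (fun q : ℕ × Ω => (q.1 : ℝ)⁻¹ • ∑ i,
      fderiv ℝ (fderiv ℝ fun θ => objective μ f β θ (sample X q.1 q.2 i)) θ₀) (probFilter P)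
      (𝓝 (matForm ((1 + β) • jMat μ f β θ₀))) := by
  refine tendsto_bilinear_of_tendsto_single fun i j => ?_
  have hsymm : (jMat μ f β θ₀) j i = jMat μ f β θ₀ i j := by
    simp only [jMat, Matrix.of_apply, mul_comm (score f θ₀ _ j)]
  rw [matForm_single, Matrix.smul_apply, smul_eq_mul, hsymm,
    ← (hLB.integral_objectiveHess hf hβ i j).2]
  have h := hX.tendsto_mean (hLB.integral_objectiveHess hf hβ i j).1
  refine h.congr fun q => ?_
  simp only [_root_.smul_apply, _root_.sum_apply, smul_eq_mul]
  rfl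

set_option maxSynthPendingDepth 5 in
/-- The expansion of the derivative of the empirical objective function at the true parameter,
uniformly on a neighbourhood and with probability tending to one. -/
theorem IsRandomSample.exists_ball_norm_fderiv_empObjective_sub_le [IsProbabilityMeasure P]
    (hX : IsRandomSample P X (modelLaw μ f θ₀)) (hLB : LehmannBasu μ Θ f β θ₀ U)
    (hf : IsParametricModel μ Θ f) (hβ : 0 ≤ β) {ε : ℝ} (hε : 0 < ε) :
    ∃ ρ > 0, Metric.ball θ₀ ρ ⊆ U ∧ ∀ᶠ q in probFilter P, ∀ θ ∈ Metric.ball θ₀ ρ,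
      ‖fderiv ℝ (empObjective μ f β (sample X q.1 q.2)) θ -
        (innerSL ℝ (sampleMean X (objectiveGrad μ f β θ₀) q) +
          matForm ((1 + β) • jMat μ f β θ₀) (θ - θ₀))‖ ≤ ε * ‖θ - θ₀‖ := by
  obtain ⟨M, hMint, hM⟩ := hLB.dominated
  have hθ₀ := hLB.subset hLB.mem
  have hMint' : Integrable M (modelLaw μ f θ₀) := (hf.integrable_modelLaw_iff hθ₀).2 hMint
  -- Strictly above the mean of M, so by the law of large numbers the sample mean of M stays below
  -- it with probability tending to one.
  set C : ℝ := |∫ x, M x ∂modelLaw μ f θ₀| + 1 with hC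
  have hCpos : 0 < C := by positivity
  have hMev : ∀ᶠ q in probFilter P, (q.1 : ℝ)⁻¹ * ∑ i, M (sample X q.1 q.2 i) ≤ C := by
    have h := (hX.tendsto_mean hMint').eventually (gt_mem_nhds
      (show ∫ x, M x ∂modelLaw μ f θ₀ < C from (le_abs_self _).trans_lt (lt_add_one _)))
    exact h.mono fun q hq => hq.le
  have hdom : ∀ᶠ q in probFilter P, ∀ i, ∀ θ ∈ U,
      ‖iteratedFDeriv ℝ 3 (fun τ => objective μ f β τ (sample X q.1 q.2 i)) θ‖
        ≤ M (sample X q.1 q.2 i) := by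
    refine eventually_probFilter_of_ae ?_
    filter_upwards [hX.ae_forall (hf.ae_modelLaw_iff.2 hM)] with ω hω n i using hω i
  obtain ⟨r, hr, hrU⟩ := Metric.isOpen_iff.1 hLB.isOpen θ₀ hLB.mem
  -- Half of ε pays for the Taylor remainder Cρ, the other half for the deviation of the mean
  -- Hessian from (1+β)J.
  set ρ : ℝ := min r (ε / (2 * C)) with hρ
  have hρpos : 0 < ρ := lt_min hr (by positivity)
  have hρU : Metric.ball θ₀ ρ ⊆ U := (Metric.ball_subset_ball (min_le_left _ _)).trans hrU
  have hρC : C * ρ ≤ ε / 2 := by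
    calc C * ρ ≤ C * (ε / (2 * C)) := mul_le_mul_of_nonneg_left (min_le_right _ _) hCpos.le
      _ = ε / 2 := by field_simp
  have hball : Metric.ball (matForm ((1 + β) • jMat μ f β θ₀)) (ε / 2) ∈
      𝓝 (matForm ((1 + β) • jMat μ f β θ₀)) := Metric.ball_mem_nhds _ (half_pos hε)
  have hhess := (hX.tendsto_mean_hess hLB hf hβ).eventually hball
  refine ⟨ρ, hρpos, hρU, ?_⟩
  filter_upwards [hMev, hdom, hhess, hX.eventually_isRegularPoint hLB hf] with q h1 h2 h3 h4 θ hθ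
  set x := sample X q.1 q.2
  set D := (q.1 : ℝ)⁻¹ • ∑ i, fderiv ℝ (fderiv ℝ fun θ => objective μ f β θ (x i)) θ₀ with hD
  have hz : innerSL ℝ (sampleMean X (objectiveGrad μ f β θ₀) q) =
      (q.1 : ℝ)⁻¹ • ∑ i, fderiv ℝ (fun θ => objective μ f β θ (x i)) θ₀ := by
    rw [sampleMean, map_smul, map_sum]
    congr 1
    exact Finset.sum_congr rfl fun i _ => ((h4 i).fderiv_objective_eq_innerSL hLB hf).symm
  have hfirst : ‖fderiv ℝ (empObjective μ f β x) θ -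
      innerSL ℝ (sampleMean X (objectiveGrad μ f β θ₀) q) - D (θ - θ₀)‖ ≤ ε / 2 * ‖θ - θ₀‖ := by
    rw [(hasFDerivAt_empObjective hLB h4 (hρU hθ)).fderiv, hz, hD]
    simp only [_root_.smul_apply, _root_.sum_apply]
    rw [← smul_sub, ← smul_sub, ← Finset.sum_sub_distrib, ← Finset.sum_sub_distrib, norm_smul,
      Real.norm_of_nonneg (by positivity)]
    calc (q.1 : ℝ)⁻¹ * ‖∑ i, (fderiv ℝ (fun θ => objective μ f β θ (x i)) θ -
          fderiv ℝ (fun θ => objective μ f β θ (x i)) θ₀ -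
          fderiv ℝ (fderiv ℝ fun θ => objective μ f β θ (x i)) θ₀ (θ - θ₀))‖
        ≤ (q.1 : ℝ)⁻¹ * ∑ i, M (x i) * ρ * ‖θ - θ₀‖ := by
          refine mul_le_mul_of_nonneg_left (norm_sum_le_of_le _ fun i _ => ?_) (by positivity)
          exact norm_fderiv_sub_le_of_norm_iteratedFDeriv_le
            ((h4 i).thriceDifferentiableOn_objective hLB) hρU (h2 i) hθ
      _ = ((q.1 : ℝ)⁻¹ * ∑ i, M (x i)) * ρ * ‖θ - θ₀‖ := by
          rw [← Finset.sum_mul, ← Finset.sum_mul]; ring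
      _ ≤ C * ρ * ‖θ - θ₀‖ := by gcongr
      _ ≤ ε / 2 * ‖θ - θ₀‖ := by gcongr
  have hsecond : ‖D (θ - θ₀) - matForm ((1 + β) • jMat μ f β θ₀) (θ - θ₀)‖ ≤
      ε / 2 * ‖θ - θ₀‖ := by
    rw [← _root_.sub_apply]
    refine (ContinuousLinearMap.le_opNorm _ _).trans (mul_le_mul_of_nonneg_right ?_ (norm_nonneg _))
    rw [← dist_eq_norm]
    exact h3.le
  calc _ = ‖(fderiv ℝ (empObjective μ f β x) θ -
        innerSL ℝ (sampleMean X (objectiveGrad μ f β θ₀) q) - D (θ - θ₀)) +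
        (D (θ - θ₀) - matForm ((1 + β) • jMat μ f β θ₀) (θ - θ₀))‖ := by congr 1; abel
    _ ≤ ε / 2 * ‖θ - θ₀‖ + ε / 2 * ‖θ - θ₀‖ := (norm_add_le _ _).trans (add_le_add hfirst hsecond)
    _ = ε * ‖θ - θ₀‖ := by ring

end Expansion

/-! ### Existence of both estimators. -/

section Existence

variable {𝒳 Ω : Type*} [MeasurableSpace 𝒳] {μ : Measure 𝒳} {p r : ℕ} {Θ U : Set (Param p)}
  {f : Param p → 𝒳 → ℝ} {g : Param p → Param r} {β : ℝ} {θ₀ θ : Param p}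
  [MeasurableSpace Ω] {P : Measure Ω} {X : ℕ → Ω → 𝒳}

theorem exists_pos_mul_sq_le_inner_matOp {M : Matrix (Fin p) (Fin p) ℝ} (hM : M.PosDef) :
    ∃ κ > 0, ∀ v : Param p, κ * ‖v‖ ^ 2 ≤ inner ℝ (matOp M v) v := by
  -- The unit sphere is empty exactly in dimension zero; otherwise the constant is the minimum of
  -- the form over the sphere.
  rcases (Metric.sphere (0 : Param p) 1).eq_empty_or_nonempty with hs | hs
  · refine ⟨1, one_pos, fun v => ?_⟩
    have hv : v = 0 := by
      by_contra h
      have : (‖v‖⁻¹ • v) ∈ Metric.sphere (0 : Param p) 1 := by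
        simp [norm_smul, h]
      simp [hs] at this
    simp [hv]
  · have hc : Continuous fun v : Param p => inner ℝ (matOp M v) v := by fun_prop
    obtain ⟨u, hu, hmin⟩ := (isCompact_sphere (0 : Param p) 1).exists_isMinOn hs hc.continuousOn
    have hu0 : u ≠ 0 := by
      rintro rfl
      simp at hu
    refine ⟨inner ℝ (matOp M u) u, ?_, fun v => ?_⟩
    · rw [inner_matOp]
      have := hM.dotProduct_mulVec_pos (x := u.ofLp) (fun h => hu0 (by ext i; simp [h]))
      simpa using this
    · rcases eq_or_ne v 0 with rfl | hv
      · simp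
      have hv' : ‖v‖ ≠ 0 := norm_ne_zero_iff.2 hv
      have hmem : (‖v‖⁻¹ • v) ∈ Metric.sphere (0 : Param p) 1 := by
        simp [norm_smul, hv]
      have h := hmin hmem
      simp only [Set.mem_ofPred_eq, map_smul, inner_smul_left, inner_smul_right, conj_trivial] at h
      calc _ ≤ (‖v‖⁻¹ * (‖v‖⁻¹ * inner ℝ (matOp M v) v)) * ‖v‖ ^ 2 := by gcongr
        _ = _ := by field_simp

theorem LehmannBasu.transpose_jMat : (jMat μ f β θ₀)ᵀ = jMat μ f β θ₀ := by
  ext i j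
  simp only [jMat, Matrix.transpose_apply, Matrix.of_apply, mul_comm (score f θ₀ _ j)]

theorem IsRandomSample.tendsto_sampleMean_objectiveGrad [IsProbabilityMeasure P]
    (hX : IsRandomSample P X (modelLaw μ f θ₀)) (hLB : LehmannBasu μ Θ f β θ₀ U)
    (hf : IsParametricModel μ Θ f) (hβ : 0 ≤ β) :
    Tendsto (sampleMean X (objectiveGrad μ f β θ₀)) (probFilter P) (𝓝 0) := by
  have := hf.isProbabilityMeasure (hLB.subset hLB.mem)
  have h : Tendsto (fun q i => sampleMean X (objectiveGrad μ f β θ₀) q i) (probFilter P)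
      (𝓝 0) := by
    refine tendsto_pi_nhds.2 fun i => ?_
    have hi := hX.tendsto_mean ((hLB.memLp_objectiveGrad hf hβ i).integrable one_le_two)
    rw [hLB.integral_objectiveGrad hf hβ] at hi
    refine hi.congr fun q => ?_
    simp [sampleMean, Finset.sum_apply]
  exact ((PiLp.continuous_toLp 2 (fun _ : Fin p => ℝ)).tendsto 0).comp h

/-- With probability tending to one, points near the true parameter at which the empirical
objective function is at most its value at the true parameter are at a distance of the order of
the mean gradient. -/
theorem IsRandomSample.exists_ball_norm_sub_le_of_empObjective_le [IsProbabilityMeasure P]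
    (hX : IsRandomSample P X (modelLaw μ f θ₀)) (hLB : LehmannBasu μ Θ f β θ₀ U)
    (hf : IsParametricModel μ Θ f) (hβ : 0 ≤ β) :
    ∃ C, ∃ ρ > 0, Metric.ball θ₀ ρ ⊆ U ∧ ∀ᶠ q in probFilter P, ∀ θ ∈ Metric.ball θ₀ ρ,
      empObjective μ f β (sample X q.1 q.2) θ ≤ empObjective μ f β (sample X q.1 q.2) θ₀ →
      ‖θ - θ₀‖ ≤ C * ‖sampleMean X (objectiveGrad μ f β θ₀) q‖ := by
  have hc : 0 < 1 + β := by positivity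
  obtain ⟨κ, hκ, hκJ⟩ := exists_pos_mul_sq_le_inner_matOp hLB.posDef
  -- The quadratic term is at least 2ε‖δ‖² and the remainder at most ε‖δ‖². A nonpositive increment
  -- thus forces ε‖δ‖² ≤ ‖z‖‖δ‖.
  set ε : ℝ := (1 + β) * κ / 4 with hε
  have hεpos : 0 < ε := by positivity
  obtain ⟨ρ, hρ, hρU, hev⟩ := hX.exists_ball_norm_fderiv_empObjective_sub_le hLB hf hβ hεpos
  refine ⟨ε⁻¹, ρ, hρ, hρU, ?_⟩
  filter_upwards [hev, hX.eventually_isRegularPoint hLB hf] with q hq hreg θ hθ hle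
  set z := sampleMean X (objectiveGrad μ f β θ₀) q
  have hsymm : ∀ v w, matForm ((1 + β) • jMat μ f β θ₀) v w =
      matForm ((1 + β) • jMat μ f β θ₀) w v := fun v w => by
    rw [matForm_apply, matForm_apply, inner_matOp_comm]
    rw [Matrix.transpose_smul, LehmannBasu.transpose_jMat]
  have h := abs_sub_le_of_norm_fderiv_sub_le
    (fun τ hτ => (hasFDerivAt_empObjective hLB hreg (hρU hτ)).differentiableAt) hsymm hεpos.le hq hθ
  set δ := θ - θ₀ with hδ
  have hJδ : 4 * ε * ‖δ‖ ^ 2 ≤ matForm ((1 + β) • jMat μ f β θ₀) δ δ := by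
    have hκδ := mul_le_mul_of_nonneg_left (hκJ δ) hc.le
    rw [inner_matOp] at hκδ
    rw [matForm_apply, inner_matOp, Matrix.smul_mulVec, dotProduct_smul, smul_eq_mul]
    calc 4 * ε * ‖δ‖ ^ 2 = (1 + β) * (κ * ‖δ‖ ^ 2) := by rw [hε]; ring
      _ ≤ _ := hκδ
  have hz : |innerSL ℝ z δ| ≤ ‖z‖ * ‖δ‖ := abs_real_inner_le_norm z δ
  have h1 := (abs_le.1 h).1
  have h2 := (abs_le.1 hz).1
  have hmain : ε * ‖δ‖ * ‖δ‖ ≤ ‖z‖ * ‖δ‖ := by nlinarith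
  rcases eq_or_lt_of_le (norm_nonneg δ) with h0 | h0
  · rw [← h0]; positivity
  · rw [inv_mul_eq_div, le_div_iff₀ hεpos, mul_comm]
    exact le_of_mul_le_mul_right hmain h0

theorem IsParametricModel.measurable_objective (hf : IsParametricModel μ Θ f) (θ : Param p) :
    Measurable (objective μ f β θ) := by
  have := hf.measurable_apply θ
  unfold objective
  split_ifs
  · fun_prop
  · fun_prop

/-- There is a consistent sequence of measurable functions of the data that, with probability
tending to one, are local minimizers of the empirical objective function on a locally closed set
containing the true parameter. -/
theorem IsRandomSample.exists_consistent_localMin [IsProbabilityMeasure P]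
    (hX : IsRandomSample P X (modelLaw μ f θ₀)) (hLB : LehmannBasu μ Θ f β θ₀ U)
    (hf : IsParametricModel μ Θ f) (hβ : 0 ≤ β) {S : Set (Param p)} (h0 : θ₀ ∈ S)
    (hS : ∀ r, Metric.closedBall θ₀ r ⊆ U → IsClosed (Metric.closedBall θ₀ r ∩ S)) :
    ∃ T : ∀ n : ℕ, (Fin n → 𝒳) → Param p, (∀ n, Measurable (T n)) ∧
      Tendsto (fun q : ℕ × Ω => T q.1 (sample X q.1 q.2)) (probFilter P) (𝓝 θ₀) ∧
      ∀ᶠ q in probFilter P, T q.1 (sample X q.1 q.2) ∈ S ∧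
        IsLocalMinOn (empObjective μ f β (sample X q.1 q.2)) S (T q.1 (sample X q.1 q.2)) := by
  classical
  obtain ⟨C, ρ, hρ, hρU, hev⟩ := hX.exists_ball_norm_sub_le_of_empObjective_le hLB hf hβ
  set s : ℝ := ρ / 2 with hs
  have hspos : 0 < s := half_pos hρ
  have hsρ : Metric.closedBall θ₀ s ⊆ Metric.ball θ₀ ρ :=
    Metric.closedBall_subset_ball (half_lt_self hρ)
  set K := Metric.closedBall θ₀ s ∩ S with hK
  have hKcomp : IsCompact K :=
    (isCompact_closedBall θ₀ s).of_isClosed_subset (hS s (hsρ.trans hρU)) Set.inter_subset_left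
  have hθ₀K : θ₀ ∈ K := ⟨Metric.mem_closedBall_self hspos.le, h0⟩
  -- The irregular points need not form a measurable set. Replacing the objective by 0 on samples
  -- meeting a measurable null set that contains them makes it measurable in the data and continuous
  -- on `K` for every sample.
  set N := toMeasurable (modelLaw μ f θ₀) {x | ¬ IsRegularPoint f U x} with hN
  have hNmeas : MeasurableSet N := measurableSet_toMeasurable _ _
  have hregN : ∀ x, x ∉ N → IsRegularPoint f U x := fun x hx => by
    by_contra h
    exact hx (subset_toMeasurable _ _ h)
  have hNae : ∀ᵐ x ∂modelLaw μ f θ₀, x ∉ N := by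
    have := ae_iff.1 (hLB.ae_isRegularPoint hf)
    rw [← measure_toMeasurable] at this
    exact measure_eq_zero_iff_ae_notMem.1 this
  have hsel : ∀ n : ℕ, ∃ T : (Fin n → 𝒳) → Param p, Measurable T ∧ ∀ x, T x ∈ K ∧ ∀ τ ∈ K,
      (if ∀ i, x i ∉ N then empObjective μ f β x (T x) else 0) ≤
        if ∀ i, x i ∉ N then empObjective μ f β x τ else 0 := fun n => by
    refine exists_measurable_argmin hKcomp ⟨θ₀, hθ₀K⟩
      (F := fun θ (x : Fin n → 𝒳) => if ∀ i, x i ∉ N then empObjective μ f β x θ else 0) ?_ ?_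
    · intro θ _
      refine Measurable.ite ?_ ?_ measurable_const
      · rw [Set.ofPred_forall]
        refine .iInter fun i => ?_
        exact (measurable_pi_apply i : Measurable fun x : Fin n → 𝒳 => x i) hNmeas.compl
      · unfold empObjective
        exact (Finset.measurable_fun_sum _ fun i _ =>
          (hf.measurable_objective θ).comp (measurable_pi_apply i)).const_mul _
    · intro x
      by_cases hx : ∀ i, x i ∉ N
      · simp only [if_pos hx]
        exact fun θ hθ => (hasFDerivAt_empObjective hLB (fun i => hregN _ (hx i))
          (hρU (hsρ hθ.1))).continuousAt.continuousWithinAt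
      · simp only [if_neg hx]
        exact continuousOn_const
  choose T hT hTmin using hsel
  have hminev : ∀ᶠ q in probFilter P, ∀ τ ∈ K,
      empObjective μ f β (sample X q.1 q.2) (T q.1 (sample X q.1 q.2)) ≤
        empObjective μ f β (sample X q.1 q.2) τ := by
    have : ∀ᶠ q in probFilter P, ∀ i, sample X q.1 q.2 i ∉ N := by
      refine eventually_probFilter_of_ae ?_
      filter_upwards [hX.ae_forall hNae] with ω hω n i using hω i
    filter_upwards [this] with q hq τ hτ
    simpa only [if_pos hq] using (hTmin q.1 (sample X q.1 q.2)).2 τ hτ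
  -- θ₀ is itself a competitor in `K`, so the minimizer does no worse there and its distance to θ₀
  -- is O(‖z_n‖), which tends to zero.
  have hcons : Tendsto (fun q : ℕ × Ω => T q.1 (sample X q.1 q.2)) (probFilter P) (𝓝 θ₀) := by
    rw [tendsto_iff_norm_sub_tendsto_zero]
    have hz := (hX.tendsto_sampleMean_objectiveGrad hLB hf hβ).norm.const_mul C
    rw [norm_zero, mul_zero] at hz
    refine squeeze_zero' (Eventually.of_forall fun _ => norm_nonneg _) ?_ hz
    filter_upwards [hev, hminev] with q hq hq'
    exact hq _ (hsρ (hTmin _ _).1.1) (hq' θ₀ hθ₀K)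
  refine ⟨T, hT, hcons, ?_⟩
  filter_upwards [hminev, hcons.eventually (Metric.ball_mem_nhds θ₀ hspos)] with q hq hq'
  refine ⟨(hTmin _ _).1.2, ?_⟩
  -- By consistency the minimizer is interior to the ball, so minimality over `K` is local
  -- minimality over `S`.
  filter_upwards [mem_nhdsWithin_of_mem_nhds (Metric.isOpen_ball.mem_nhds hq'),
    self_mem_nhdsWithin] with τ hτ hτS
  exact hq τ ⟨Metric.ball_subset_closedBall hτ, hτS⟩

/-- Take `S = Θ`: as Θ is open, a local minimum on it is a free one, hence a critical point. -/
theorem IsRandomSample.exists_isMDPDE [IsProbabilityMeasure P]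
    (hX : IsRandomSample P X (modelLaw μ f θ₀)) (hLB : LehmannBasu μ Θ f β θ₀ U)
    (hf : IsParametricModel μ Θ f) (hβ : 0 ≤ β) : ∃ T, IsMDPDE μ Θ f β θ₀ P X T := by
  obtain ⟨T, hT, hcons, hmin⟩ := hX.exists_consistent_localMin hLB hf hβ (S := Θ)
    (hLB.subset hLB.mem) fun r hr => by
      rw [Set.inter_eq_left.2 (hr.trans hLB.subset)]
      exact Metric.isClosed_closedBall
  refine ⟨T, hT, tendstoInMeasure_const_iff.2 hcons, (eventually_probFilter (p := fun q =>
    IsEstimatingRoot μ Θ f β (sample X q.1 q.2) (T q.1 (sample X q.1 q.2)))).1 ?_⟩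
  filter_upwards [hmin, hX.eventually_isRegularPoint hLB hf,
    hcons.eventually (hLB.isOpen.mem_nhds hLB.mem),
    tendsto_fst_probFilter.eventually (eventually_ne_atTop 0)] with q hq hreg hU hn
  rw [isEstimatingRoot_iff_fderiv_eq_zero hLB hf hβ hreg hn hU]
  exact (hq.2.isLocalMin (hf.isOpen.mem_nhds hq.1)).fderiv_eq_zero

/-- Take for `S` the null set: continuity of `g` makes its trace on a closed ball inside U closed.
-/
theorem IsRandomSample.exists_isRMDPDE [IsProbabilityMeasure P]
    (hX : IsRandomSample P X (modelLaw μ f θ₀)) (hLB : LehmannBasu μ Θ f β θ₀ U)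
    (hf : IsParametricModel μ Θ f) (hβ : 0 ≤ β) (hg : IsConstraint Θ g)
    (hθ₀ : θ₀ ∈ nullSet Θ g) : ∃ S, IsRMDPDE μ Θ f g β θ₀ P X S := by
  obtain ⟨T, hT, hcons, hmin⟩ := hX.exists_consistent_localMin hLB hf hβ (S := nullSet Θ g)
    hθ₀ fun r hr => by
      have : Metric.closedBall θ₀ r ∩ nullSet Θ g = Metric.closedBall θ₀ r ∩ g ⁻¹' {0} := by
        ext τ
        exact ⟨fun h => ⟨h.1, h.2.2⟩, fun h => ⟨h.1, hLB.subset (hr h.1), h.2⟩⟩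
      rw [this]
      exact ContinuousOn.preimage_isClosed_of_isClosed
        (fun τ hτ => (hg.differentiable τ (hLB.subset (hr hτ))).continuousAt.continuousWithinAt)
        Metric.isClosed_closedBall isClosed_singleton
  exact ⟨T, hT, tendstoInMeasure_const_iff.2 hcons, (eventually_probFilter (p := fun q =>
    IsRestrictedMin μ Θ f g β (sample X q.1 q.2) (T q.1 (sample X q.1 q.2)))).1 hmin⟩

end Existence

/-! ### Rectangular matrices as continuous linear maps. -/

section RectangularMatrices

variable {l m n : ℕ}

/-- The continuous linear map of a matrix. -/
noncomputable def matMap (M : Matrix (Fin m) (Fin n) ℝ) : Param n →L[ℝ] Param m :=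
  LinearMap.toContinuousLinearMap (Matrix.toLpLin 2 2 M)

theorem matMap_apply (M : Matrix (Fin m) (Fin n) ℝ) (v : Param n) :
    matMap M v = WithLp.toLp 2 (M *ᵥ v.ofLp) := rfl

theorem matMap_eq_matOp (M : Matrix (Fin m) (Fin m) ℝ) : matMap M = matOp M := rfl

theorem matMap_mul_apply (M : Matrix (Fin l) (Fin m) ℝ) (N : Matrix (Fin m) (Fin n) ℝ)
    (v : Param n) : matMap (M * N) v = matMap M (matMap N v) := by
  simp only [matMap_apply, Matrix.mulVec_mulVec]

theorem matMap_one_apply (v : Param n) : matMap 1 v = v := by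
  simp only [matMap_apply, Matrix.one_mulVec]

theorem matMap_sub (M N : Matrix (Fin m) (Fin n) ℝ) : matMap (M - N) = matMap M - matMap N := by
  simp only [matMap, map_sub]

theorem matMap_sub_apply (M N : Matrix (Fin m) (Fin n) ℝ) (v : Param n) :
    matMap (M - N) v = matMap M v - matMap N v := by
  rw [matMap_sub]; rfl

theorem matMap_smul_apply (c : ℝ) (M : Matrix (Fin m) (Fin n) ℝ) (v : Param n) :
    matMap (c • M) v = c • matMap M v := by
  simp only [matMap, map_smul]; rfl

theorem continuous_matMap :
    Continuous (matMap : Matrix (Fin m) (Fin n) ℝ → Param n →L[ℝ] Param m) :=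
  LinearMap.continuous_of_finiteDimensional
    (((Matrix.toLpLin 2 2).trans LinearMap.toContinuousLinearMap :
      Matrix (Fin m) (Fin n) ℝ ≃ₗ[ℝ] _) : Matrix (Fin m) (Fin n) ℝ →ₗ[ℝ] Param n →L[ℝ] Param m)

end RectangularMatrices

/-! ### Regularity of the constraint and Lagrange multipliers. -/

section Constraint

variable {p r : ℕ} {Θ : Set (Param p)} {g : Param p → Param r} {θ : Param p}

theorem IsConstraint.fderiv_eq (hg : IsConstraint Θ g) (hθ : θ ∈ Θ) :
    fderiv ℝ g θ = matMap (gMat g θ)ᵀ := by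
  refine clm_ext_single fun i => ?_
  ext j
  have h := (hg.differentiable θ hθ).hasFDerivAt
  have hj : HasFDerivAt (fun τ => g τ j)
      ((EuclideanSpace.proj j : Param r →L[ℝ] ℝ).comp (fderiv ℝ g θ)) θ :=
    (EuclideanSpace.proj j : Param r →L[ℝ] ℝ).hasFDerivAt.comp θ h
  simp [matMap_apply, gMat, partialDeriv, hj.fderiv]

/-- Continuity of G upgrades differentiability to the strict form that the multiplier theorem
requires. -/
theorem IsConstraint.hasStrictFDerivAt (hΘ : IsOpen Θ) (hg : IsConstraint Θ g) (hθ : θ ∈ Θ) :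
    HasStrictFDerivAt g (matMap (gMat g θ)ᵀ) θ := by
  rw [← hg.fderiv_eq hθ]
  refine hasStrictFDerivAt_of_hasFDerivAt_of_continuousAt ?_ ?_
  · filter_upwards [hΘ.mem_nhds hθ] with τ hτ using (hg.differentiable τ hτ).hasFDerivAt
  · have hc : ContinuousAt (fun τ => matMap (gMat g τ)ᵀ) θ :=
      (continuous_matMap.comp continuous_id.matrix_transpose).continuousAt.comp
        (hg.continuous.continuousAt (hΘ.mem_nhds hθ))
    refine hc.congr ?_
    filter_upwards [hΘ.mem_nhds hθ] with τ hτ using (hg.fderiv_eq hτ).symm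

theorem IsConstraint.injective_mulVec (hg : IsConstraint Θ g) (hθ : θ ∈ Θ) :
    Function.Injective (gMat g θ).mulVec := by
  rw [Matrix.mulVec_injective_iff, linearIndependent_iff_card_eq_finrank_span,
    Set.finrank, ← Matrix.rank_eq_finrank_span_cols, hg.rank θ hθ, Fintype.card_fin]

/-- The functional is an inner product with the vector of its values on the basis; passing to the
adjoint turns Gᵀ into G and the abstract multiplier into a vector. -/
theorem dual_matMap_transpose {m n : ℕ} (M : Matrix (Fin m) (Fin n) ℝ) (Λ : Param n →ₗ[ℝ] ℝ)
    (v : Param m) : Λ (matMap Mᵀ v) =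
      inner ℝ (matMap M (WithLp.toLp 2 fun j => Λ (EuclideanSpace.single j 1))) v := by
  have hΛ : ∀ w : Param n, Λ w = ∑ j, w j * Λ (EuclideanSpace.single j 1) := fun w => by
    have hw : w = ∑ i, w i • EuclideanSpace.single i (1 : ℝ) := by
      ext k
      simp [Finset.sum_apply, Pi.single_apply]
    conv_lhs => rw [hw]
    simp only [map_sum, map_smul, smul_eq_mul]
  rw [hΛ, EuclideanSpace.inner_eq_star_dotProduct]
  simp only [matMap_apply, star_trivial]
  rw [Matrix.dotProduct_mulVec, ← Matrix.mulVec_transpose]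
  rfl

open InnerProductSpace in
/-- At a constrained local minimizer the gradient lies in the range of `G`. -/
theorem IsConstraint.exists_gradient_eq (hΘ : IsOpen Θ) (hg : IsConstraint Θ g)
    {φ : Param p → ℝ} (hθ : θ ∈ nullSet Θ g) (hmin : IsLocalMinOn φ (nullSet Θ g) θ)
    (hφ : HasStrictFDerivAt φ (fderiv ℝ φ θ) θ) :
    ∃ l : Param r, gradient φ θ = matMap (gMat g θ) l := by
  have hextr : IsLocalExtrOn φ {τ | g τ = g θ} θ := by
    refine Or.inl ?_
    have h : ∀ᶠ τ in 𝓝 θ, τ ∈ nullSet Θ g → φ θ ≤ φ τ := eventually_nhdsWithin_iff.1 hmin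
    refine eventually_nhdsWithin_iff.2 ?_
    -- The multiplier theorem uses the level set of `g` in the whole space; near θ it agrees with
    -- the null set because Θ is open.
    filter_upwards [h, hΘ.mem_nhds hθ.1] with τ hτ hτΘ hgτ
    exact hτ ⟨hτΘ, (hgτ : g τ = g θ).trans hθ.2⟩
  obtain ⟨Λ, Λ₀, hne, hΛ⟩ := hextr.exists_linear_map_of_hasStrictFDerivAt
    (hg.hasStrictFDerivAt hΘ hθ.1) hφ
  set l : Param r := WithLp.toLp 2 fun j => Λ (EuclideanSpace.single j 1) with hl
  have key : matMap (gMat g θ) l = -(Λ₀ • gradient φ θ) := by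
    refine ext_inner_right ℝ fun v => ?_
    have h := hΛ v
    rw [dual_matMap_transpose] at h
    rw [inner_neg_left, inner_smul_left, gradient, toDual_symm_apply]
    exact eq_neg_of_add_eq_zero_left h
  -- If the multiplier of φ vanished, G l = 0 would force l = 0 by full column rank, so that both
  -- multipliers vanish, a contradiction.
  have hΛ₀ : Λ₀ ≠ 0 := by
    rintro rfl
    rw [zero_smul, neg_zero, matMap_apply] at key
    have hl0 : l.ofLp = 0 := hg.injective_mulVec hθ.1 (by
      rw [Matrix.mulVec_zero]
      exact congrArg WithLp.ofLp key)
    refine hne (Prod.ext (LinearMap.ext fun v => ?_) rfl)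
    have hΛv : Λ v = inner ℝ (matMap (1 : Matrix (Fin r) (Fin r) ℝ) l) v := by
      rw [← dual_matMap_transpose, Matrix.transpose_one, matMap_one_apply]
    rw [hΛv, matMap_one_apply, show l = 0 from by ext i; exact congrFun hl0 i, inner_zero_left]
    rfl
  refine ⟨-(Λ₀⁻¹ • l), ?_⟩
  rw [map_neg, map_smul, key, smul_neg, neg_neg, smul_smul, inv_mul_cancel₀ hΛ₀, one_smul]

end Constraint

/-! ### Linear expansions of the two estimators. -/

section Gradient

variable {𝒳 Ω : Type*} [MeasurableSpace 𝒳] {μ : Measure 𝒳} {p r : ℕ} {Θ U : Set (Param p)}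
  {f : Param p → 𝒳 → ℝ} {g : Param p → Param r} {β : ℝ} {θ₀ θ : Param p}
  [MeasurableSpace Ω] {P : Measure Ω} {X : ℕ → Ω → 𝒳}

-- The expansion is uniform on a ball, so it may be evaluated at any consistent random point, even
-- though that point depends on the sample.
open Asymptotics InnerProductSpace in
theorem IsRandomSample.isLittleO_gradient [IsProbabilityMeasure P]
    (hX : IsRandomSample P X (modelLaw μ f θ₀)) (hLB : LehmannBasu μ Θ f β θ₀ U)
    (hf : IsParametricModel μ Θ f) (hβ : 0 ≤ β) {T : ℕ × Ω → Param p}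
    (hT : Tendsto T (probFilter P) (𝓝 θ₀)) :
    (fun q => gradient (empObjective μ f β (sample X q.1 q.2)) (T q) -
      (sampleMean X (objectiveGrad μ f β θ₀) q +
        matMap ((1 + β) • jMat μ f β θ₀) (T q - θ₀))) =o[probFilter P] fun q => T q - θ₀ := by
  refine isLittleO_iff.2 fun ε hε => ?_
  obtain ⟨ρ, hρ, -, h⟩ := hX.exists_ball_norm_fderiv_empObjective_sub_le hLB hf hβ hε
  filter_upwards [h, hT.eventually (Metric.ball_mem_nhds θ₀ hρ)] with q hq hTq
  refine Eq.trans_le ?_ (hq _ hTq)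
  rw [← LinearIsometryEquiv.norm_map (toDual ℝ (Param p))]
  congr 1
  ext v
  simp only [toDual_apply_apply, inner_sub_left, inner_add_left, gradient, toDual_symm_apply,
    _root_.sub_apply, _root_.add_apply, innerSL_apply_apply, matForm_apply, matMap_eq_matOp]

open Asymptotics in
/-- The expansion of an estimator whose gradient is asymptotically in the kernel of `1 - J B` and
whose deviation is asymptotically in the kernel of `B J`. -/
theorem isLittleO_of_isLittleO_gradient {ι : Type*} {l : Filter ι}
    {J B : Matrix (Fin p) (Fin p) ℝ} (hJ : IsUnit J.det) {c : ℝ} (hc : 0 < c)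
    {w z δ : ι → Param p} (h : (fun q => w q - (z q + matMap (c • J) (δ q))) =o[l] δ)
    (hw : (fun q => matMap (1 - J * B) (w q)) =o[l] w)
    (hδ : (fun q => matMap (B * J) (δ q)) =o[l] δ) :
    δ =O[l] z ∧ (fun q => c • δ q + matMap (J⁻¹ - B) (z q)) =o[l] z := by
  have hJJ : J⁻¹ * J = 1 := Matrix.nonsing_inv_mul J hJ
  have hzO : z =O[l] fun q => ‖z q‖ + ‖δ q‖ := .of_norm_le fun q => by simp
  have hδO : δ =O[l] fun q => ‖z q‖ + ‖δ q‖ := .of_norm_le fun q => by simp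
  have hwO : w =O[l] fun q => ‖z q‖ + ‖δ q‖ := by
    have h1 := (h.isBigO.trans hδO).add
      (hzO.add (((matMap (c • J)).isBigO_comp δ l).trans hδO))
    refine h1.congr_left fun q => ?_
    abel
  -- Apply J⁻¹(1-JB) = J⁻¹-B to the expansion: `w` is negligible by `hw`, and cJδ becomes c(δ-BJδ),
  -- where BJδ is negligible by `hδ`.
  have hmain : (fun q => c • δ q + matMap (J⁻¹ - B) (z q)) =o[l] fun q => ‖z q‖ + ‖δ q‖ := by
    have h1 := (((matMap (J⁻¹ * (1 - J * B))).isBigO_comp _ l).trans_isLittleO h).trans_isBigO hδO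
    have h2 := (((matMap J⁻¹).isBigO_comp _ l).trans_isLittleO hw).trans_isBigO hwO
    have h3 := (hδ.trans_isBigO hδO).const_smul_left c
    refine ((h2.sub h1).add h3).congr_left fun q => ?_
    have e1 : J⁻¹ * (1 - J * B) = J⁻¹ - B := by
      rw [mul_sub, mul_one, ← mul_assoc, hJJ, one_mul]
    have e2 : matMap (J⁻¹ * (1 - J * B)) (matMap (c • J) (δ q)) =
        c • (δ q - matMap (B * J) (δ q)) := by
      rw [matMap_smul_apply, map_smul, ← matMap_mul_apply, e1, sub_mul, hJJ, matMap_sub_apply,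
        matMap_one_apply]
    rw [← matMap_mul_apply, map_sub, map_add, e2, e1, Pi.smul_apply]
    module
  have hO : δ =O[l] z := by
    -- The error is at most (c/2)(‖z‖+‖δ‖); the part (c/2)‖δ‖ is absorbed by c‖δ‖ on the left.
    refine IsBigO.of_bound ((‖matMap (J⁻¹ - B)‖ + c / 2) / (c / 2)) ?_
    filter_upwards [isLittleO_iff.1 hmain (half_pos hc)] with q hq
    rw [Real.norm_of_nonneg (by positivity)] at hq
    have h1 : ‖c • δ q‖ ≤ ‖c • δ q + matMap (J⁻¹ - B) (z q)‖ + ‖matMap (J⁻¹ - B) (z q)‖ := by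
      simpa using norm_sub_le (c • δ q + matMap (J⁻¹ - B) (z q)) (matMap (J⁻¹ - B) (z q))
    rw [norm_smul, Real.norm_of_nonneg hc.le] at h1
    have h2 := (matMap (J⁻¹ - B)).le_opNorm (z q)
    rw [div_mul_eq_mul_div, le_div_iff₀ (half_pos hc)]
    nlinarith
  exact ⟨hO, hmain.trans_isBigO ((isBigO_refl z l).norm_left.add hO.norm_left)⟩

theorem posDef_constraint_information (hLB : LehmannBasu μ Θ f β θ₀ U) (hg : IsConstraint Θ g) :
    ((gMat g θ₀)ᵀ * (jMat μ f β θ₀)⁻¹ * gMat g θ₀).PosDef := by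
  have h := hLB.posDef.inv.conjTranspose_mul_mul_same
    (hg.injective_mulVec (hLB.subset hLB.mem))
  simpa [Matrix.conjTranspose_eq_transpose_of_trivial] using h

theorem LehmannBasu.isUnit_det_jMat (hLB : LehmannBasu μ Θ f β θ₀ U) :
    IsUnit (jMat μ f β θ₀).det := (Matrix.isUnit_iff_isUnit_det _).1 hLB.posDef.isUnit

theorem transpose_bMat : (bMat μ f g β θ₀)ᵀ = bMat μ f g β θ₀ := by
  have hJ : ((jMat μ f β θ₀)⁻¹)ᵀ = (jMat μ f β θ₀)⁻¹ := by
    rw [Matrix.transpose_nonsing_inv, LehmannBasu.transpose_jMat]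
  have hG : (((gMat g θ₀)ᵀ * (jMat μ f β θ₀)⁻¹ * gMat g θ₀)⁻¹)ᵀ =
      ((gMat g θ₀)ᵀ * (jMat μ f β θ₀)⁻¹ * gMat g θ₀)⁻¹ := by
    rw [Matrix.transpose_nonsing_inv]
    simp only [Matrix.transpose_mul, hJ, Matrix.transpose_transpose, Matrix.mul_assoc]
  rw [bMat]
  generalize ((gMat g θ₀)ᵀ * (jMat μ f β θ₀)⁻¹ * gMat g θ₀)⁻¹ = I at hG ⊢
  simp only [Matrix.transpose_mul, hJ, hG, Matrix.transpose_transpose, Matrix.mul_assoc]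

/-- Hence 1-JB annihilates the range of G, where the gradient at a constrained minimizer
asymptotically lies. -/
theorem jMat_mul_bMat_mul_gMat (hLB : LehmannBasu μ Θ f β θ₀ U) (hg : IsConstraint Θ g) :
    jMat μ f β θ₀ * bMat μ f g β θ₀ * gMat g θ₀ = gMat g θ₀ := by
  have hI : IsUnit ((gMat g θ₀)ᵀ * (jMat μ f β θ₀)⁻¹ * gMat g θ₀).det :=
    (Matrix.isUnit_iff_isUnit_det _).1 (posDef_constraint_information hLB hg).isUnit
  calc _ = (jMat μ f β θ₀ * (jMat μ f β θ₀)⁻¹) * gMat g θ₀ *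
        (((gMat g θ₀)ᵀ * (jMat μ f β θ₀)⁻¹ * gMat g θ₀)⁻¹ *
          ((gMat g θ₀)ᵀ * (jMat μ f β θ₀)⁻¹ * gMat g θ₀)) := by
        simp only [bMat, Matrix.mul_assoc]
    _ = _ := by
        rw [Matrix.mul_nonsing_inv _ hLB.isUnit_det_jMat, Matrix.nonsing_inv_mul _ hI,
          Matrix.one_mul, Matrix.mul_one]

/-- Being a multiple of Gᵀ, BJ is negligible on deviations that respect the constraint to first
order. -/
theorem bMat_mul_jMat (hLB : LehmannBasu μ Θ f β θ₀ U) :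
    bMat μ f g β θ₀ * jMat μ f β θ₀ = (jMat μ f β θ₀)⁻¹ * gMat g θ₀ *
      ((gMat g θ₀)ᵀ * (jMat μ f β θ₀)⁻¹ * gMat g θ₀)⁻¹ * (gMat g θ₀)ᵀ := by
  rw [bMat, Matrix.mul_assoc _ _ (jMat μ f β θ₀),
    Matrix.nonsing_inv_mul _ hLB.isUnit_det_jMat, Matrix.mul_one]

theorem exists_left_inverse_gMat (hLB : LehmannBasu μ Θ f β θ₀ U) (hg : IsConstraint Θ g) :
    ∃ L : Matrix (Fin r) (Fin p) ℝ, L * gMat g θ₀ = 1 := by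
  have hI : IsUnit ((gMat g θ₀)ᵀ * (jMat μ f β θ₀)⁻¹ * gMat g θ₀).det :=
    (Matrix.isUnit_iff_isUnit_det _).1 (posDef_constraint_information hLB hg).isUnit
  refine ⟨((gMat g θ₀)ᵀ * (jMat μ f β θ₀)⁻¹ * gMat g θ₀)⁻¹ *
    ((gMat g θ₀)ᵀ * (jMat μ f β θ₀)⁻¹), ?_⟩
  rw [Matrix.mul_assoc, Matrix.nonsing_inv_mul _ hI]

open Asymptotics in
/-- Vectors in the ranges of matrices that converge to `G` are asymptotically in the kernel of
every matrix that annihilates `G`. -/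
theorem isLittleO_matMap_of_tendsto {ι : Type*} {l : Filter ι} {G : Matrix (Fin p) (Fin r) ℝ}
    {L : Matrix (Fin r) (Fin p) ℝ} (hL : L * G = 1) {N : Matrix (Fin p) (Fin p) ℝ}
    (hN : N * G = 0) {H : ι → Matrix (Fin p) (Fin r) ℝ} (hH : Tendsto H l (𝓝 G))
    {w : ι → Param p} {a : ι → Param r} (hw : ∀ᶠ q in l, w q = matMap (H q) (a q)) :
    (fun q => matMap N (w q)) =o[l] w := by
  have hD : Tendsto (fun q => matMap (H q - G)) l (𝓝 0) := by
    have h := (continuous_matMap.tendsto _).comp (hH.sub_const G)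
    rw [sub_self] at h
    simpa [Function.comp_def, matMap] using h
  have hda : (fun q => matMap (H q - G) (a q)) =o[l] a := by
    refine isLittleO_iff.2 fun ε hε => ?_
    filter_upwards [hD.norm.eventually (gt_mem_nhds (by simpa using hε))] with q hq
    exact ((matMap (H q - G)).le_opNorm _).trans
      (mul_le_mul_of_nonneg_right hq.le (norm_nonneg _))
  -- The left inverse recovers the coefficients from the vectors, L w = a + o(a), so errors relative
  -- to `a` are errors relative to `w`.
  have ha : a =O[l] w := by
    have h1 : (fun q => matMap L (w q) - a q) =o[l] a := by
      refine ((matMap L).isBigO_comp _ l).trans_isLittleO hda |>.congr' ?_ .rfl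
      filter_upwards [hw] with q hq
      rw [hq, ← matMap_mul_apply, ← matMap_mul_apply, Matrix.mul_sub, hL, matMap_sub_apply,
        matMap_one_apply]
    have h2 : a =O[l] fun q => matMap L (w q) :=
      IsEquivalent.isBigO_symm h1
    exact h2.trans ((matMap L).isBigO_comp w l)
  refine (((matMap N).isBigO_comp _ l).trans_isLittleO (hda.trans_isBigO ha)).congr' ?_ .rfl
  filter_upwards [hw] with q hq
  rw [hq, ← matMap_mul_apply, ← matMap_mul_apply, Matrix.mul_sub, hN, sub_zero]

theorem IsConsistentSeq.tendsto {C : ∀ n : ℕ, (Fin n → 𝒳) → Param p → Prop}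
    {T : ∀ n : ℕ, (Fin n → 𝒳) → Param p} (hT : IsConsistentSeq P X θ₀ C T) :
    Tendsto (fun q : ℕ × Ω => T q.1 (sample X q.1 q.2)) (probFilter P) (𝓝 θ₀) :=
  (tendstoInMeasure_const_iff (f := fun n ω => T n (sample X n ω))).1 hT.consistent

theorem IsConsistentSeq.eventually {C : ∀ n : ℕ, (Fin n → 𝒳) → Param p → Prop}
    {T : ∀ n : ℕ, (Fin n → 𝒳) → Param p} (hT : IsConsistentSeq P X θ₀ C T) :
    ∀ᶠ q in probFilter P, C q.1 (sample X q.1 q.2) (T q.1 (sample X q.1 q.2)) :=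
  (eventually_probFilter (p := fun q : ℕ × Ω =>
    C q.1 (sample X q.1 q.2) (T q.1 (sample X q.1 q.2)))).2 hT.property

open Asymptotics in
/-- The expansion of the unrestricted estimator. -/
theorem IsMDPDE.isLittleO [IsProbabilityMeasure P] {T : ∀ n : ℕ, (Fin n → 𝒳) → Param p}
    (hT : IsMDPDE μ Θ f β θ₀ P X T) (hX : IsRandomSample P X (modelLaw μ f θ₀))
    (hLB : LehmannBasu μ Θ f β θ₀ U) (hf : IsParametricModel μ Θ f) (hβ : 0 ≤ β) :
    (fun q : ℕ × Ω => T q.1 (sample X q.1 q.2) - θ₀) =O[probFilter P]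
        sampleMean X (objectiveGrad μ f β θ₀) ∧
      (fun q : ℕ × Ω => (1 + β) • (T q.1 (sample X q.1 q.2) - θ₀) +
        matMap (jMat μ f β θ₀)⁻¹ (sampleMean X (objectiveGrad μ f β θ₀) q)) =o[probFilter P]
        sampleMean X (objectiveGrad μ f β θ₀) := by
  have hT0 := IsConsistentSeq.tendsto hT
  -- Without a constraint B is 0: the first kernel condition holds because the gradient vanishes,
  -- the second trivially.
  have h := isLittleO_of_isLittleO_gradient (B := 0) hLB.isUnit_det_jMat
    (by positivity : 0 < 1 + β) (hX.isLittleO_gradient hLB hf hβ hT0) ?_ ?_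
  · simpa only [sub_zero] using h
  · refine (isLittleO_zero _ _).congr' ?_ .rfl
    filter_upwards [IsConsistentSeq.eventually hT, hX.eventually_isRegularPoint hLB hf,
      hT0.eventually (hLB.isOpen.mem_nhds hLB.mem),
      tendsto_fst_probFilter.eventually (eventually_ne_atTop 0)] with q hq hreg hU hn
    rw [gradient, (isEstimatingRoot_iff_fderiv_eq_zero hLB hf hβ hreg hn hU).1 hq, map_zero,
      map_zero]
  · refine (isLittleO_zero _ _).congr_left fun q => ?_
    rw [zero_mul, matMap_apply, Matrix.zero_mulVec]
    rfl

open Asymptotics in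
/-- The expansion of the restricted estimator. -/
theorem IsRMDPDE.isLittleO [IsProbabilityMeasure P] {S : ∀ n : ℕ, (Fin n → 𝒳) → Param p}
    (hS : IsRMDPDE μ Θ f g β θ₀ P X S) (hX : IsRandomSample P X (modelLaw μ f θ₀))
    (hLB : LehmannBasu μ Θ f β θ₀ U) (hf : IsParametricModel μ Θ f) (hβ : 0 ≤ β)
    (hg : IsConstraint Θ g) (hθ₀ : θ₀ ∈ nullSet Θ g) :
    (fun q : ℕ × Ω => S q.1 (sample X q.1 q.2) - θ₀) =O[probFilter P]
        sampleMean X (objectiveGrad μ f β θ₀) ∧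
      (fun q : ℕ × Ω => (1 + β) • (S q.1 (sample X q.1 q.2) - θ₀) +
        matMap ((jMat μ f β θ₀)⁻¹ - bMat μ f g β θ₀)
          (sampleMean X (objectiveGrad μ f β θ₀) q)) =o[probFilter P]
        sampleMean X (objectiveGrad μ f β θ₀) := by
  classical
  have hS0 := IsConsistentSeq.tendsto hS
  obtain ⟨L, hL⟩ := exists_left_inverse_gMat hLB hg
  refine isLittleO_of_isLittleO_gradient hLB.isUnit_det_jMat
    (by positivity : 0 < 1 + β) (hX.isLittleO_gradient hLB hf hβ hS0) ?_ ?_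
  · have hex : ∀ᶠ q in probFilter P, ∃ l : Param r,
        gradient (empObjective μ f β (sample X q.1 q.2)) (S q.1 (sample X q.1 q.2)) =
          matMap (gMat g (S q.1 (sample X q.1 q.2))) l := by
      filter_upwards [IsConsistentSeq.eventually hS, hX.eventually_isRegularPoint hLB hf,
        hS0.eventually (hLB.isOpen.mem_nhds hLB.mem)] with q hq hreg hU
      exact hg.exists_gradient_eq hf.isOpen hq.1 hq.2 (hasStrictFDerivAt_empObjective hLB hreg hU)
    -- The gradient is G(θ̃) times a multiplier and G(θ̃) tends to G(θ₀). The multiplier is set to 0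
    -- where none exists, an event of vanishing probability.
    refine isLittleO_matMap_of_tendsto hL (H := fun q => gMat g (S q.1 (sample X q.1 q.2)))
      (a := fun q => if h : ∃ l : Param r,
        gradient (empObjective μ f β (sample X q.1 q.2)) (S q.1 (sample X q.1 q.2)) =
          matMap (gMat g (S q.1 (sample X q.1 q.2))) l then h.choose else 0) ?_ ?_ ?_
    · rw [Matrix.sub_mul, Matrix.one_mul, jMat_mul_bMat_mul_gMat hLB hg, sub_self]
    · exact (hg.continuous.continuousAt (hf.isOpen.mem_nhds hθ₀.1)).tendsto.comp hS0
    · filter_upwards [hex] with q hq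
      rw [dif_pos hq]
      exact hq.choose_spec
  -- As g is 0 at both θ̃ and θ₀, differentiability of g at θ₀ says exactly that Gᵀ(θ̃-θ₀) =
  -- o(‖θ̃-θ₀‖).
  · have hd := ((hg.hasStrictFDerivAt hf.isOpen hθ₀.1).hasFDerivAt.isLittleO).comp_tendsto hS0
    have hG : (fun q : ℕ × Ω => matMap (gMat g θ₀)ᵀ (S q.1 (sample X q.1 q.2) - θ₀))
        =o[probFilter P] fun q : ℕ × Ω => S q.1 (sample X q.1 q.2) - θ₀ := by
      refine hd.neg_left.congr' ?_ .rfl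
      filter_upwards [IsConsistentSeq.eventually hS] with q hq
      simp only [Function.comp_apply, hq.1.2, hθ₀.2]
      abel
    rw [bMat_mul_jMat hLB]
    simp only [matMap_mul_apply _ (gMat g θ₀)ᵀ]
    exact ((matMap _).isBigO_comp _ _).trans_isLittleO hG

open Asymptotics in
/-- The expansion of the difference of the two estimators. -/
theorem IsMDPDE.isLittleO_sub [IsProbabilityMeasure P] {T S : ∀ n : ℕ, (Fin n → 𝒳) → Param p}
    (hT : IsMDPDE μ Θ f β θ₀ P X T) (hS : IsRMDPDE μ Θ f g β θ₀ P X S)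
    (hX : IsRandomSample P X (modelLaw μ f θ₀)) (hLB : LehmannBasu μ Θ f β θ₀ U)
    (hf : IsParametricModel μ Θ f) (hβ : 0 ≤ β) (hg : IsConstraint Θ g)
    (hθ₀ : θ₀ ∈ nullSet Θ g) :
    (fun q : ℕ × Ω => T q.1 (sample X q.1 q.2) - S q.1 (sample X q.1 q.2)) =O[probFilter P]
        sampleMean X (objectiveGrad μ f β θ₀) ∧
      (fun q : ℕ × Ω => (1 + β) • (T q.1 (sample X q.1 q.2) - S q.1 (sample X q.1 q.2)) +
        matMap (bMat μ f g β θ₀) (sampleMean X (objectiveGrad μ f β θ₀) q)) =o[probFilter P]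
        sampleMean X (objectiveGrad μ f β θ₀) := by
  obtain ⟨h1, h2⟩ := hT.isLittleO hX hLB hf hβ
  obtain ⟨h3, h4⟩ := hS.isLittleO hX hLB hf hβ hg hθ₀
  refine ⟨(h1.sub h3).congr_left fun q => by abel, (h2.sub h4).congr_left fun q => ?_⟩
  rw [matMap_sub_apply]
  module

end Gradient

/-! ### Quadratic approximation and limit law of the test statistic. -/

section Divergence

variable {𝒳 Ω : Type*} [MeasurableSpace 𝒳] {μ : Measure 𝒳} {p r : ℕ} {Θ U : Set (Param p)}
  {f : Param p → 𝒳 → ℝ} {g : Param p → Param r} {β γ : ℝ} {θ₀ : Param p}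
  [MeasurableSpace Ω] {P : Measure Ω} {X : ℕ → Ω → 𝒳}

/-- Joint measurability of the densities and σ-finiteness of μ make the parametric integral
measurable; this is what makes the test statistic a random variable. -/
theorem IsParametricModel.measurable_dpd [SigmaFinite μ] (hf : IsParametricModel μ Θ f) :
    Measurable fun q : Param p × Param p => dpd μ γ (f q.1) (f q.2) := by
  have h1 : Measurable fun q : (Param p × Param p) × 𝒳 => f q.1.1 q.2 :=
    hf.measurable.comp ((measurable_fst.comp measurable_fst).prodMk measurable_snd)
  have h2 : Measurable fun q : (Param p × Param p) × 𝒳 => f q.1.2 q.2 :=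
    hf.measurable.comp ((measurable_snd.comp measurable_fst).prodMk measurable_snd)
  have h : Measurable fun q : (Param p × Param p) × 𝒳 =>
      dpdIntegrand γ (f q.1.1 q.2) (f q.1.2 q.2) := by
    unfold dpdIntegrand
    split_ifs
    · exact h1.mul (h1.div h2).log
    · exact ((h2.pow_const _).sub (((h2.pow_const _).const_mul _).mul h1)).add
        ((h1.pow_const _).const_mul _)
  exact (StronglyMeasurable.integral_prod_right' h.stronglyMeasurable).measurable

theorem IsRandomSample.measurable_testStat [SigmaFinite μ] {ν : Measure 𝒳}
    (hX : IsRandomSample P X ν) (hf : IsParametricModel μ Θ f)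
    {T S : ∀ n : ℕ, (Fin n → 𝒳) → Param p} (hT : ∀ n, Measurable (T n))
    (hS : ∀ n, Measurable (S n)) (n : ℕ) : Measurable (testStat μ f γ X T S n) := by
  have hs : Measurable (sample X n) := measurable_pi_lambda _ fun i => hX.measurable i
  exact (hf.measurable_dpd.comp (((hT n).comp hs).prodMk ((hS n).comp hs))).const_mul _

theorem DivergenceRegular.tendsto_fderiv_fderiv_dpd (hreg : DivergenceRegular μ f γ U)
    (hLB : LehmannBasu μ Θ f β θ₀ U) (hf : IsParametricModel μ Θ f) :
    Tendsto (fun q : Param p × Param p =>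
      fderiv ℝ (fderiv ℝ fun θ => dpd μ γ (f θ) (f q.2)) q.1) (𝓝 (θ₀, θ₀))
      (𝓝 (matForm (aMat μ f γ θ₀))) := by
  refine tendsto_bilinear_of_tendsto_single fun i j => ?_
  have hU : U ×ˢ U ∈ 𝓝 (θ₀, θ₀) :=
    prod_mem_nhds (hLB.isOpen.mem_nhds hLB.mem) (hLB.isOpen.mem_nhds hLB.mem)
  have h := ((hreg.continuous ![EuclideanSpace.single i 1, EuclideanSpace.single j 1]).continuousAt
    hU).tendsto
  simp only [iteratedFDeriv_two_apply, Matrix.cons_val_zero, Matrix.cons_val_one] at h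
  have hij : aMat μ f γ θ₀ i j = aMat μ f γ θ₀ j i := congrFun (congrFun transpose_aMat j) i
  rwa [hreg.fderiv_fderiv_dpd_self hLB hf, hij, ← matForm_single (aMat μ f γ θ₀)] at h

set_option maxSynthPendingDepth 5 in
/-- The second order expansion of the divergence, uniformly in both arguments. -/
theorem DivergenceRegular.exists_ball_abs_dpd_sub_le (hreg : DivergenceRegular μ f γ U)
    (hLB : LehmannBasu μ Θ f β θ₀ U) (hf : IsParametricModel μ Θ f) (hγ : 0 ≤ γ) {ε : ℝ}
    (hε : 0 < ε) : ∃ ρ > 0, ∀ θ ∈ Metric.ball θ₀ ρ, ∀ τ ∈ Metric.ball θ₀ ρ,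
      |dpd μ γ (f θ) (f τ) - 1 / 2 * matForm (aMat μ f γ θ₀) (θ - τ) (θ - τ)|
        ≤ ε * ‖θ - τ‖ ^ 2 := by
  have h := (hreg.tendsto_fderiv_fderiv_dpd hLB hf).eventually (Metric.ball_mem_nhds _ hε)
  obtain ⟨r, hr, hball⟩ := Metric.eventually_nhds_iff_ball.1 h
  obtain ⟨s, hs, hsU⟩ := Metric.isOpen_iff.1 hLB.isOpen θ₀ hLB.mem
  -- The ball of radius 2ρ about τ then contains θ and stays in the ball about θ₀ where the Hessian
  -- is within ε of A.
  set ρ := min r s / 3 with hρ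
  have hmin : 0 < min r s := lt_min hr hs
  refine ⟨ρ, by positivity, fun θ hθ τ hτ => ?_⟩
  have hsub : Metric.ball τ (2 * ρ) ⊆ Metric.ball θ₀ (min r s) :=
    Metric.ball_subset_ball' (by have := (Metric.mem_ball.1 hτ).le; linarith)
  have hsubU : Metric.ball τ (2 * ρ) ⊆ U :=
    hsub.trans ((Metric.ball_subset_ball (min_le_right _ _)).trans hsU)
  have hρpos : 0 < ρ := by positivity
  have hττ : τ ∈ Metric.ball τ (2 * ρ) := Metric.mem_ball_self (by positivity)
  have hτU : τ ∈ U := hsubU hττ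
  have hθτ : θ ∈ Metric.ball τ (2 * ρ) := by
    have h1 := dist_triangle_right θ τ θ₀
    have h2 := Metric.mem_ball.1 hθ
    have h3 := Metric.mem_ball.1 hτ
    exact Metric.mem_ball.2 (by linarith)
  have hdiff : ∀ σ ∈ Metric.ball τ (2 * ρ), DifferentiableAt ℝ
      (fun θ => dpd μ γ (f θ) (f τ)) σ := fun σ hσ =>
    (hreg.diff_dpd τ hτU).differentiableAt two_pos (hsubU hσ)
  -- The derivative vanishes at σ = τ, so the bound on the Hessian integrates to a bound on the
  -- derivative without linear term.
  have hfirst : ∀ σ ∈ Metric.ball τ (2 * ρ), ‖fderiv ℝ (fun θ => dpd μ γ (f θ) (f τ)) σ -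
      (0 + matForm (aMat μ f γ θ₀) (σ - τ))‖ ≤ ε * ‖σ - τ‖ := by
    intro σ hσ
    have h1 := (convex_ball τ (2 * ρ)).norm_image_sub_le_of_norm_fderiv_le' (𝕜 := ℝ)
      (f := fderiv ℝ fun θ => dpd μ γ (f θ) (f τ)) (φ := matForm (aMat μ f γ θ₀)) (C := ε)
      (fun σ hσ => (hreg.diff_dpd τ hτU).differentiableAt_fderiv one_lt_two (hsubU hσ))
      (fun σ hσ => ?_) hττ hσ
    · rwa [hreg.fderiv_dpd_self hLB hf hτU, sub_zero, ← zero_add (matForm _ _)] at h1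
    · have h2 := hball (σ, τ) (by
        rw [← ball_prod_same]
        exact ⟨Metric.ball_subset_ball (min_le_left _ _) (hsub hσ),
          Metric.ball_subset_ball (min_le_left _ _) (hsub hττ)⟩)
      rw [dist_eq_norm] at h2
      exact h2.le
  have hsymm : ∀ v w, matForm (aMat μ f γ θ₀) v w = matForm (aMat μ f γ θ₀) w v := fun v w => by
    rw [matForm_apply, matForm_apply, inner_matOp_comm transpose_aMat]
  have h3 := abs_sub_le_of_norm_fderiv_sub_le hdiff hsymm hε.le hfirst hθτ
  rwa [dpd_self hf hγ (hLB.subset hτU), sub_zero, _root_.zero_apply, zero_add] at h3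

open Asymptotics in
/-- With probability tending to one the test statistic is a quadratic form in the mean gradient, up
to an error that is small compared to `n` times the square of its norm. -/
theorem IsMDPDE.isLittleO_testStat [IsProbabilityMeasure P]
    {T S : ∀ n : ℕ, (Fin n → 𝒳) → Param p}
    (hT : IsMDPDE μ Θ f β θ₀ P X T) (hS : IsRMDPDE μ Θ f g β θ₀ P X S)
    (hX : IsRandomSample P X (modelLaw μ f θ₀)) (hLB : LehmannBasu μ Θ f β θ₀ U)
    (hreg : DivergenceRegular μ f γ U) (hf : IsParametricModel μ Θ f) (hβ : 0 ≤ β) (hγ : 0 ≤ γ)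
    (hg : IsConstraint Θ g) (hθ₀ : θ₀ ∈ nullSet Θ g) :
    (fun q : ℕ × Ω => testStat μ f γ X T S q.1 q.2 -
      q.1 * ((1 + β)⁻¹ ^ 2 * matForm (aMat μ f γ θ₀)
        (matMap (bMat μ f g β θ₀) (sampleMean X (objectiveGrad μ f β θ₀) q))
        (matMap (bMat μ f g β θ₀) (sampleMean X (objectiveGrad μ f β θ₀) q)))) =o[probFilter P]
      fun q : ℕ × Ω => (q.1 : ℝ) * ‖sampleMean X (objectiveGrad μ f β θ₀) q‖ ^ 2 := by
  have hc : (1 + β) ≠ 0 := by positivity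
  set z := sampleMean X (objectiveGrad μ f β θ₀) with hz
  set A := matForm (aMat μ f γ θ₀) with hA
  set Δ : ℕ × Ω → Param p := fun q => T q.1 (sample X q.1 q.2) - S q.1 (sample X q.1 q.2) with hΔ
  obtain ⟨hO, ho⟩ := hT.isLittleO_sub hS hX hLB hf hβ hg hθ₀
  have hT0 := IsConsistentSeq.tendsto hT
  have hS0 := IsConsistentSeq.tendsto hS
  have hzz : (fun q => ‖z q‖ * ‖z q‖) =O[probFilter P] fun q => ‖z q‖ ^ 2 := by
    simp only [pow_two]
    exact isBigO_refl _ _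
  have hd : (fun q : ℕ × Ω => dpd μ γ (f (T q.1 (sample X q.1 q.2)))
      (f (S q.1 (sample X q.1 q.2))) - 1 / 2 * A (Δ q) (Δ q)) =o[probFilter P]
      fun q => ‖z q‖ ^ 2 := by
    refine IsLittleO.trans_isBigO (g := fun q => ‖Δ q‖ ^ 2) (isLittleO_iff.2 fun ε hε => ?_)
      (hO.norm_norm.pow 2)
    obtain ⟨ρ, hρ, h⟩ := hreg.exists_ball_abs_dpd_sub_le hLB hf hγ hε
    filter_upwards [hT0.eventually (Metric.ball_mem_nhds θ₀ hρ),
      hS0.eventually (Metric.ball_mem_nhds θ₀ hρ)] with q h1 h2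
    rw [Real.norm_of_nonneg (sq_nonneg ‖Δ q‖)]
    exact h _ h1 _ h2
  -- Δ is close to -y; the sign is immaterial in a quadratic form.
  set y : ℕ × Ω → Param p := fun q => (1 + β)⁻¹ • matMap (bMat μ f g β θ₀) (z q) with hy
  have hyO : y =O[probFilter P] z :=
    ((matMap (bMat μ f g β θ₀)).isBigO_comp z _).const_smul_left (1 + β)⁻¹
  have hs : (fun q => Δ q + y q) =o[probFilter P] z := by
    refine (ho.const_smul_left (1 + β)⁻¹).congr_left fun q => ?_
    rw [Pi.smul_apply, smul_add, inv_smul_smul₀ hc]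
  -- Write A(Δ,Δ) - A(y,y) = A(Δ+y,Δ) - A(y,Δ+y), where Δ+y = o(z) and Δ, y = O(z).
  have hq : (fun q => A (Δ q) (Δ q) - A (y q) (y q)) =o[probFilter P] fun q => ‖z q‖ ^ 2 := by
    have hb : ∀ {u v : ℕ × Ω → Param p}, (fun q => A (u q) (v q)) =O[probFilter P]
        fun q => ‖u q‖ * ‖v q‖ := fun {u v} => IsBigO.of_bound ‖A‖ (.of_forall fun q => by
      rw [Real.norm_of_nonneg (by positivity : 0 ≤ ‖u q‖ * ‖v q‖), ← mul_assoc]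
      exact A.le_opNorm₂ _ _)
    have h1 := (hb (u := fun q => Δ q + y q) (v := Δ)).trans_isLittleO
      (hs.norm_norm.mul_isBigO hO.norm_norm)
    have h2 := (hb (u := y) (v := fun q => Δ q + y q)).trans_isLittleO
      (hyO.norm_norm.mul_isLittleO hs.norm_norm)
    refine ((h1.sub h2).trans_isBigO hzz).congr_left fun q => ?_
    simp only [map_add, _root_.add_apply]
    ring
  have hsum := (isBigO_refl (fun q : ℕ × Ω => (q.1 : ℝ)) (probFilter P)).mul_isLittleO
    ((hd.const_mul_left 2).add hq)
  refine hsum.congr_left fun q => ?_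
  have e : A (y q) (y q) = (1 + β)⁻¹ ^ 2 * A (matMap (bMat μ f g β θ₀) (z q))
      (matMap (bMat μ f g β θ₀) (z q)) := by
    simp only [hy, map_smul, _root_.smul_apply, smul_eq_mul]
    ring
  rw [← e, testStat]
  ring

theorem IsMDPDE.tendsto_testStat_sub [IsProbabilityMeasure P]
    {T S : ∀ n : ℕ, (Fin n → 𝒳) → Param p}
    (hT : IsMDPDE μ Θ f β θ₀ P X T) (hS : IsRMDPDE μ Θ f g β θ₀ P X S)
    (hX : IsRandomSample P X (modelLaw μ f θ₀)) (hLB : LehmannBasu μ Θ f β θ₀ U)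
    (hreg : DivergenceRegular μ f γ U) (hf : IsParametricModel μ Θ f) (hβ : 0 ≤ β) (hγ : 0 ≤ γ)
    (hg : IsConstraint Θ g) (hθ₀ : θ₀ ∈ nullSet Θ g) :
    Tendsto (fun q : ℕ × Ω => testStat μ f γ X T S q.1 q.2 -
      q.1 * ((1 + β)⁻¹ ^ 2 * matForm (aMat μ f γ θ₀)
        (matMap (bMat μ f g β θ₀) (sampleMean X (objectiveGrad μ f β θ₀) q))
        (matMap (bMat μ f g β θ₀) (sampleMean X (objectiveGrad μ f β θ₀) q)))) (probFilter P)
      (𝓝 0) := by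
  have := hf.isProbabilityMeasure hθ₀.1
  obtain ⟨C, hC, hle⟩ := hX.exists_lintegral_sq_le (hLB.memLp_objectiveGrad hf hβ)
    (hLB.integral_objectiveGrad hf hβ)
  refine tendsto_zero_of_isLittleO_probFilter
    (N := fun n ω => (n : ℝ) * ‖sampleMean X (objectiveGrad μ f β θ₀) (n, ω)‖ ^ 2)
    (fun n => ?_) hC hle (hT.isLittleO_testStat hS hX hLB hreg hf hβ hγ hg hθ₀)
  exact ((aemeasurable_sampleMean hX (hLB.aemeasurable_objectiveGrad hf hβ) n).norm.pow_const
    2).const_mul _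

/-- The limit law of the test statistic, in terms of a factor of `K`. -/
theorem IsMDPDE.tendstoInDistribution_testStat [IsProbabilityMeasure P] [SigmaFinite μ] {m : ℕ}
    {T S : ∀ n : ℕ, (Fin n → 𝒳) → Param p}
    (hT : IsMDPDE μ Θ f β θ₀ P X T) (hS : IsRMDPDE μ Θ f g β θ₀ P X S)
    (hX : IsRandomSample P X (modelLaw μ f θ₀)) (hLB : LehmannBasu μ Θ f β θ₀ U)
    (hreg : DivergenceRegular μ f γ U) (hf : IsParametricModel μ Θ f) (hβ : 0 ≤ β) (hγ : 0 ≤ γ)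
    (hg : IsConstraint Θ g) (hθ₀ : θ₀ ∈ nullSet Θ g) {R : Matrix (Fin p) (Fin m) ℝ}
    (hR : R * Rᵀ = kMat μ f β θ₀) :
    TendstoInDistribution (testStat μ f γ X T S) atTop (fun z : Fin m → ℝ =>
        z ⬝ᵥ (Rᵀ * (bMat μ f g β θ₀ * aMat μ f γ θ₀ * bMat μ f g β θ₀) * R) *ᵥ z)
      (fun _ => P) (Measure.pi fun _ => gaussianReal 0 1) := by
  have hc : (1 + β) ≠ 0 := by positivity
  set B := bMat μ f g β θ₀ with hB
  set A := aMat μ f γ θ₀ with hA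
  -- The gradient has covariance (1+β)²K = ((1+β)R)((1+β)R)ᵀ; this factor cancels the (1+β)⁻² of the
  -- quadratic form.
  have hclt := hX.tendstoInDistribution_sqrt_smul_sampleMean
    (hLB.aemeasurable_objectiveGrad hf hβ) (hLB.memLp_objectiveGrad hf hβ)
    (hLB.integral_objectiveGrad hf hβ) ((1 + β) • R) fun i j => by
      rw [hLB.integral_objectiveGrad_mul hf hβ, ← hR, Matrix.transpose_smul, Matrix.smul_mul,
        Matrix.mul_smul, smul_smul, Matrix.smul_apply, smul_eq_mul, pow_two]
  have hQ : Continuous fun v : Param p =>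
      (1 + β)⁻¹ ^ 2 * matForm A (matMap B v) (matMap B v) := by fun_prop
  have hlim := hclt.continuous_comp hQ
  have hlaw : ((fun v : Param p => (1 + β)⁻¹ ^ 2 * matForm A (matMap B v) (matMap B v)) ∘
      fun z : Fin m → ℝ => WithLp.toLp 2 (((1 + β) • R) *ᵥ z)) = fun z : Fin m → ℝ =>
        z ⬝ᵥ (Rᵀ * (B * A * B) * R) *ᵥ z := by
    funext z
    have hBt : Bᵀ = B := transpose_bMat
    simp only [Function.comp_apply, matForm_apply, inner_matOp, matMap_apply, Matrix.smul_mulVec,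
      Matrix.mulVec_smul, smul_dotProduct, dotProduct_smul, smul_eq_mul]
    have e : z ⬝ᵥ (Rᵀ * (B * A * B) * R) *ᵥ z = B *ᵥ R *ᵥ z ⬝ᵥ A *ᵥ B *ᵥ R *ᵥ z := by
      simp only [← Matrix.mulVec_mulVec]
      rw [Matrix.dotProduct_mulVec, Matrix.vecMul_transpose, Matrix.dotProduct_mulVec,
        ← Matrix.mulVec_transpose, hBt]
    rw [e]
    field_simp
  rw [hlaw] at hlim
  -- Slutsky's theorem: the statistic differs from the quadratic form in √n z_n by a term tending to
  -- zero in probability.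
  refine tendstoInDistribution_of_tendstoInMeasure_sub _ _ hlim ?_
    fun n => (hX.measurable_testStat hf hT.measurable hS.measurable n).aemeasurable
  refine (tendstoInMeasure_const_iff (c := (0 : ℝ))).2 ?_
  refine (hT.tendsto_testStat_sub hS hX hLB hreg hf hβ hγ hg hθ₀).congr fun q => ?_
  have hn : √(q.1 : ℝ) * √(q.1 : ℝ) = q.1 := Real.mul_self_sqrt q.1.cast_nonneg
  simp only [Pi.sub_apply, Function.comp_apply, map_smul, _root_.smul_apply, smul_eq_mul]
  rw [← hB, ← hA]
  linear_combination ((1 + β)⁻¹ ^ 2 * matForm A (matMap B (sampleMean X (objectiveGrad μ f β θ₀) q))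
    (matMap B (sampleMean X (objectiveGrad μ f β θ₀) q))) * hn

end Divergence

end DPD

/-! ### Assembly of the theorem. -/

open DPD
theorem theorem3 {𝒳 : Type*} [MeasurableSpace 𝒳] (μ : Measure 𝒳) [SigmaFinite μ]
    {p r : ℕ} (hrp : r < p)
    (Θ : Set (Param p)) (f : Param p → 𝒳 → ℝ) (hf : IsParametricModel μ Θ f)
    (g : Param p → Param r) (hg : IsConstraint Θ g)
    (β γ : ℝ) (hβ : 0 ≤ β) (hγ : 0 ≤ γ)
    (θ₀ : Param p) (hθ₀ : θ₀ ∈ nullSet Θ g)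
    (U : Set (Param p)) (hLB : LehmannBasu μ Θ f β θ₀ U) (hreg : DivergenceRegular μ f γ U)
    {Ω : Type*} [MeasurableSpace Ω] (P : Measure Ω) [IsProbabilityMeasure P]
    (X : ℕ → Ω → 𝒳) (hX : IsRandomSample P X (modelLaw μ f θ₀)) :
    (∃ T, IsMDPDE μ Θ f β θ₀ P X T) ∧
    (∃ S, IsRMDPDE μ Θ f g β θ₀ P X S) ∧
    ∃ lam : Fin (limitRank μ f g β γ θ₀) → ℝ,
      -- the `lam i` are the nonzero eigenvalues of `A B K B`, with multiplicity
      (∀ i, lam i ≠ 0) ∧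
      (limitMat μ f g β γ θ₀).charpoly
        = Polynomial.X ^ (p - limitRank μ f g β γ θ₀) * ∏ i, (Polynomial.X - C (lam i)) ∧
      ∀ T S, IsMDPDE μ Θ f β θ₀ P X T → IsRMDPDE μ Θ f g β θ₀ P X S →
        TendstoInDistribution (testStat μ f γ X T S) atTop
          (fun z : Fin (limitRank μ f g β γ θ₀) → ℝ => ∑ i, lam i * z i ^ 2)
          (fun _ => P) (Measure.pi fun _ => gaussianReal 0 1) := by
  obtain ⟨R, l, hRK, hdiag, hchar, hrank⟩ := exists_factor_diagonalizing
    (hLB.posSemidef_kMat hf hβ) (transpose_aMat (μ := μ) (f := f) (γ := γ) (θ := θ₀))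
    (transpose_bMat (μ := μ) (f := f) (g := g) (β := β) (θ₀ := θ₀))
  -- The rank formula for k counts the nonzero diagonal entries, so these can be indexed by `Fin k`.
  obtain ⟨e⟩ : Nonempty (Fin (limitRank μ f g β γ θ₀) ≃ {i // l i ≠ 0}) :=
    ⟨Fintype.equivOfCardEq (by rw [Fintype.card_fin, limitRank, hrank])⟩
  refine ⟨hX.exists_isMDPDE hLB hf hβ, hX.exists_isRMDPDE hLB hf hβ hg hθ₀, fun i => l (e i),
    fun i => (e i).2, ?_, fun T S hT hS => ?_⟩
  · rw [limitMat, hchar, prod_eq_X_pow_mul_prod_ne_zero l e]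
  · have h := hT.tendstoInDistribution_testStat hS hX hLB hreg hf hβ hγ hg hθ₀ hRK
    have hq : ∀ z : Fin p → ℝ, z ⬝ᵥ Matrix.diagonal l *ᵥ z = ∑ i, l i * z i ^ 2 := fun z =>
      Finset.sum_congr rfl fun i _ => by rw [Matrix.mulVec_diagonal]; ring
    simp only [hdiag, hq] at h
    have hm : Measurable fun z : Fin (limitRank μ f g β γ θ₀) → ℝ =>
        ∑ i, l (e i) * z i ^ 2 := by fun_prop
    exact tendstoInDistribution_congr_law h hm.aemeasurable (map_sum_mul_sq_eq l e)
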